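/- **Setting.** Let $\mathbb G$ be a stratified group of step $\iota$, i.e. a connected, simply connected nilpotent Lie group whose Lie algebra splits as $V_1\oplus\dots\oplus V_\iota$ with $V_{j+1}=[V_1,V_j]$ for $j\ge1$, $V_\iota\neq\{0\}$ and $V_{\iota+1}=\{0\}$. Through the exponential map $\mathbb G$ is identified with the vector space of its Lie algebra, $\mathbb G=H_1\oplus\dots\oplus H_\iota$, with the group law given by the Baker–Campbell–Hausdorff formula; $0$ is the unit element, $l_x(z)=xz$ is the left translation, and $\delta_r$ ($r>0$) is the linear map that multiplies $H_j$ by $r^j$. Fix a left invariant Riemannian metric $g$ for which the layers are orthogonal (equivalently, a scalar product on the vector space $\mathbb G$ for which the $H_j$ are orthogonal), a basis $X_1,\dots,X_n$ of the Lie algebra that is orthonormal and adapted to the layers, with $X_i\in V_{d_i}$ and $d_1\le\dots\le d_n$, and a homogeneous distance $d$ on $\mathbb G$, i.e. a continuous distance with $d(zx,zy)=d(x,y)$ and $d(\delta_rx,\delta_ry)=r\,d(x,y)$. Let $B(x,r)$ be its open balls and $\mathbb B=B(0,1)$. For $\alpha=(\alpha_1<\dots<\alpha_p)$ put $X_\alpha=X_{\alpha_1}\wedge\dots\wedge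 X_{\alpha_p}$ and $d(\alpha)=d_{\alpha_1}+\dots+d_{\alpha_p}$, and let $D(p)=\max_\alpha d(\alpha)$. The norm $\|\cdot\|$ on $\Lambda_p\mathbb G$ makes the $X_\alpha$ orthonormal. For a $p$-vector $\tau$ at $x$, write $(\Lambda_p dl_{x^{-1}})(\tau)=\sum_\alpha c_\alpha X_\alpha$ and $(\tau)_{D,x}=\sum_{d(\alpha)=D}c_\alpha X_\alpha$, where $p$-vectors at $x$ and at $0$ are identified by left translation. For a $p$-dimensional (embedded) $C^1$ submanifold $\Sigma\subset\mathbb G$ let $\tau_\Sigma(x)=v_1\wedge\dots\wedge v_p$, where $v_1,\dots,v_p$ is any basis of the tangent space of $\Sigma$ at $x$; the degree of $\Sigma$ at $x$ is the largest $d(\alpha)$ with $c_\alpha\ne0$ for $\tau=\tau_\Sigma(x)$, and $x$ is transversal if this degree equals $D(p)$. Let $\tilde g$ be any smooth Riemannian metric on $\mathbb G$, let $\tilde\mu$ be the Riemannian surface measure that it induces on $\Sigma$, and let $\tau_{\Sigma,\tilde g}(x)=\tau_\Sigma(x)/\|\tau_\Sigma(x)\|_{\tilde g,x}$, where $\|v_1\wedge\dots\wedge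 v_p\|_{\tilde g,x}=\sqrt{\det(\tilde g_x(v_i,v_j))}$. For a nonzero simple $p$-vector $\tau$ with associated subspace $S=\{w\in\mathbb G: w\wedge\tau=0\}$, the metric factor is $\theta^d_g(\tau)=\mathcal H^p_{|\cdot|}(S\cap\mathbb B)$, where $\mathcal H^p_{|\cdot|}$ is the Hausdorff measure of the Euclidean distance given by $g$ on the vector space $\mathbb G$, normalized to be the Lebesgue measure on $p$-planes. **Theorem (Blow-up theorem).** Let $p\ge1$, let $\Sigma\subset\mathbb G$ be a $p$-dimensional $C^1$ submanifold and let $x\in\Sigma$ be transversal. Let $\Pi_\Sigma(x)=\{w\in\mathbb G: w\wedge(\tau_\Sigma(x))_{D(p),x}=0\}$ be the subspace associated to $(\tau_\Sigma(x))_{D(p),x}$. Then $\Pi_\Sigma(x)$ is a $p$-dimensional normal subgroup of $\mathbb G$ that is closed under dilations and has Hausdorff dimension $D(p)$ with respect to $d$; it has the form $Z\oplus H_{\ell+1}\oplus\dots\oplus H_\iota$ for some $\ell$ and some subspace $\{0\}\neq Z\subseteq H_\ell$. For every compact neighbourhood $F$ of $0$, the sets $\delta_{1/r}(x^{-1}\Sigma)$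 converge to $\Pi_\Sigma(x)$ on $F$ as $r\to0^+$, in the following sense: $F\cap\delta_{1/r}(x^{-1}\Sigma)$ is compact for all small $r>0$, $$\sup_{z\in F\cap\delta_{1/r}(x^{-1}\Sigma)}d\big(z,F\cap\Pi_\Sigma(x)\big)\to0,\qquad \sup_{w\in F\cap\Pi_\Sigma(x)}d\big(w,\delta_{1/r}(x^{-1}\Sigma)\big)\to0,$$ and, whenever $F\cap\Pi_\Sigma(x)$ is contained in the closure of $\mathrm{int}(F)\cap\Pi_\Sigma(x)$ (for instance if $F$ is a closed ball of $d$ centred at $0$), $$F\cap\delta_{1/r}(x^{-1}\Sigma)\to F\cap\Pi_\Sigma(x)\quad\text{as } r\to0^+$$ in the Hausdorff distance. Moreover, $$\lim_{r\to0^+}\frac{\tilde\mu\big(\Sigma\cap B(x,r)\big)}{r^{D(p)}}=\frac{\theta^d_g\big((\tau_\Sigma(x))_{D(p),x}\big)}{\big\|\big(\tau_{\Sigma,\tilde g}(x)\big)_{D(p),x}\big\|}.$$ -/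

import Mathlib

open Filter MeasureTheory Set
open scoped Topology ENNReal ContDiff Manifold

noncomputable section

/-! ### The Baker–Campbell–Hausdorff operation -/

/-- Right-nested iterated bracket `[x₁, [x₂, [… , x_m]]]` of a list of vectors. -/
def nestedLie {G : Type*} [AddCommGroup G] [Module ℝ G] (lie : G →ₗ[ℝ] G →ₗ[ℝ] G) :
    List G → G
  | [] => 0
  | [x] => x
  | x :: y :: l => lie x (nestedLie lie (y :: l))

/-- The word `x^{r₁} y^{s₁} ⋯ x^{r_k} y^{s_k}` for `a i = (r_i, s_i)`. -/
def dynkinWord {G : Type*} (x y : G) {k : ℕ} (a : Fin k → ℕ × ℕ) : List G :=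
  (List.ofFn a).flatMap fun q => List.replicate q.1 x ++ List.replicate q.2 y

/-- Exponent pairs `(r, s)` with `r, s ≤ N` and `r + s ≥ 1`. -/
def dynkinPairs (N : ℕ) : Finset (ℕ × ℕ) :=
  (Finset.range (N + 1) ×ˢ Finset.range (N + 1)).filter fun q => 1 ≤ q.1 + q.2

/-- The Baker–Campbell–Hausdorff series `log (exp x exp y)` in Dynkin's form,
`∑_k (-1)^{k-1}/k ∑_{r_i + s_i ≥ 1} (∑_i (r_i + s_i))⁻¹ ∏_i (r_i! s_i!)⁻¹ [x^{r₁} y^{s₁} ⋯ x^{r_k} y^{s_k}]`.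
If `lie` is nilpotent of step at most `N`, all words of length greater than `N` contribute zero,
so that the finite sum below is the whole series. -/
def bch {G : Type*} [AddCommGroup G] [Module ℝ G] (lie : G →ₗ[ℝ] G →ₗ[ℝ] G) (N : ℕ)
    (x y : G) : G :=
  ∑ k ∈ Finset.Icc 1 N, ∑ a ∈ Fintype.piFinset (fun _ : Fin k => dynkinPairs N),
    (((-1 : ℝ) ^ (k - 1) / (k : ℝ)) * (∑ i, ((a i).1 + (a i).2 : ℝ))⁻¹ *
      ∏ i, (((a i).1.factorial : ℝ) * ((a i).2.factorial : ℝ))⁻¹) •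
        nestedLie lie (dynkinWord x y a)

/-! ### Stratified groups -/

/-- A stratified group, seen (through the exponential map) as the vector space underlying its
Lie algebra, with the group operation given by the Baker–Campbell–Hausdorff formula.
The scalar product of `G` is the graded metric `g`: it is a scalar product on the Lie algebra
(hence a left invariant metric on the group) for which the layers are mutually orthogonal. -/
class StratifiedGroup (G : Type*) [NormedAddCommGroup G] [InnerProductSpace ℝ G]
    extends Group G where
  /-- The Lie bracket. -/
  lie : G →ₗ[ℝ] G →ₗ[ℝ] G
  lie_self : ∀ x, lie x x = 0
  jacobi : ∀ x y z, lie x (lie y z) + lie y (lie z x) + lie z (lie x y) = 0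
  /-- The step `ι`. -/
  step : ℕ
  /-- The layers; only the indices `1, …, ι` matter. -/
  layer : ℕ → Submodule ℝ G
  layer_zero : layer 0 = ⊥
  layer_of_gt : ∀ j, step < j → layer j = ⊥
  layer_step : layer step ≠ ⊥
  layer_iSup : ⨆ j, layer j = ⊤
  layer_ortho : ∀ i j, i ≠ j → layer i ⟂ layer j
  /-- `V_{j+1} = [V_1, V_j]`. -/
  layer_succ : ∀ j, 1 ≤ j →
    layer (j + 1) = Submodule.span ℝ {z | ∃ x ∈ layer 1, ∃ y ∈ layer j, lie x y = z}
  mul_eq_bch : ∀ x y : G, x * y = bch lie step x y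

open StratifiedGroup

/-- The dilations `δ_r`: multiplication by `r ^ j` on the layer `j`. -/
def dilation {G : Type*} [NormedAddCommGroup G] [InnerProductSpace ℝ G] [FiniteDimensional ℝ G]
    [StratifiedGroup G] (r : ℝ) (x : G) : G :=
  ∑ j ∈ Finset.Icc 1 (step G), r ^ j • (layer (G := G) j).starProjection x

/-- A homogeneous distance: a continuous, left invariant distance that is compatible with
dilations. -/
structure HomogeneousDistance (G : Type*) [NormedAddCommGroup G] [InnerProductSpace ℝ G]
    [FiniteDimensional ℝ G] [StratifiedGroup G] where
  d : G → G → ℝ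
  continuous_d : Continuous fun q : G × G => d q.1 q.2
  eq_zero_iff : ∀ x y, d x y = 0 ↔ x = y
  symm : ∀ x y, d x y = d y x
  triangle : ∀ x y z, d x z ≤ d x y + d y z
  left_inv : ∀ x y z, d (z * x) (z * y) = d x y
  homogeneous : ∀ r : ℝ, 0 < r → ∀ x y, d (dilation r x) (dilation r y) = r * d x y

namespace HomogeneousDistance

variable {G : Type*} [NormedAddCommGroup G] [InnerProductSpace ℝ G] [FiniteDimensional ℝ G]
  [StratifiedGroup G]

/-- The metric space `(G, d)`. -/
abbrev metricSpace (ρ : HomogeneousDistance G) : MetricSpace G where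
  dist := ρ.d
  dist_self x := (ρ.eq_zero_iff x x).2 rfl
  dist_comm := ρ.symm
  dist_triangle := ρ.triangle
  eq_of_dist_eq_zero {x y} h := (ρ.eq_zero_iff x y).1 h

/-- The open ball `B(x, r)` of the homogeneous distance. -/
def ball (ρ : HomogeneousDistance G) (x : G) (r : ℝ) : Set G := {y | ρ.d x y < r}

/-- The Hausdorff distance between subsets of `(G, d)`. -/
def hausdorffEDist (ρ : HomogeneousDistance G) (A B : Set G) : ℝ≥0∞ :=
  letI := ρ.metricSpace
  Metric.hausdorffEDist A B

/-- The Hausdorff dimension of a subset of `(G, d)`. -/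
def dimH (ρ : HomogeneousDistance G) (A : Set G) : ℝ≥0∞ :=
  letI := ρ.metricSpace
  _root_.dimH A

end HomogeneousDistance

/-! ### Graded bases, degrees of multi-indices, multivectors -/

/-- A graded basis: an orthonormal basis adapted to the stratification, with the degrees
`d_1 ≤ … ≤ d_n` of its elements. -/
structure GradedBasis (G : Type*) [NormedAddCommGroup G] [InnerProductSpace ℝ G]
    [StratifiedGroup G] (n : ℕ) where
  X : OrthonormalBasis (Fin n) ℝ G
  deg : Fin n → ℕ
  deg_mono : Monotone deg
  mem_layer : ∀ i, X i ∈ layer (G := G) (deg i)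

namespace GradedBasis

variable {G : Type*} [NormedAddCommGroup G] [InnerProductSpace ℝ G] [StratifiedGroup G] {n : ℕ}

/-- `d(α)`, for a multi-index `α_1 < … < α_p` given by the set of its entries. -/
def multiDeg (b : GradedBasis G n) {p : ℕ} (α : Set.powersetCard (Fin n) p) : ℕ :=
  ∑ i ∈ (α : Finset (Fin n)), b.deg i

/-- The maximal dimension `D(p)`. -/
def maxDim (b : GradedBasis G n) (p : ℕ) : ℕ :=
  Finset.univ.sup fun α : Set.powersetCard (Fin n) p => b.multiDeg α

/-- The coordinate `c_α` of the `p`-vector `∑ c_α X_α`. -/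
def coord (b : GradedBasis G n) {p : ℕ} (τ : ⋀[ℝ]^p G) (α : Set.powersetCard (Fin n) p) : ℝ :=
  (b.X.toBasis.exteriorPower p).repr τ α

/-- The norm on `p`-vectors induced by the graded metric (the `X_α` are orthonormal). -/
def pnorm (b : GradedBasis G n) {p : ℕ} (τ : ⋀[ℝ]^p G) : ℝ :=
  Real.sqrt (∑ α, b.coord τ α ^ 2)

/-- The projection `π_D` onto the homogeneous `p`-vectors of degree `D`,
which are spanned by the `X_α` with `d(α) = D`. -/
def proj (b : GradedBasis G n) {p : ℕ} (D : ℕ) (τ : ⋀[ℝ]^p G) : ⋀[ℝ]^p G :=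
  ∑ α with b.multiDeg α = D, b.coord τ α • b.X.toBasis.exteriorPower p α

end GradedBasis

/-- The linear subspace `{w | w ∧ τ = 0}`; if `τ = ζ_1 ∧ ⋯ ∧ ζ_p ≠ 0` is simple, this is the
span of `ζ_1, …, ζ_p`. -/
def assocSubspace {G : Type*} [AddCommGroup G] [Module ℝ G] {p : ℕ} (τ : ⋀[ℝ]^p G) :
    Submodule ℝ G :=
  LinearMap.ker
    ((LinearMap.mulRight ℝ (τ : ExteriorAlgebra ℝ G)).comp (ExteriorAlgebra.ι ℝ))

/-- The metric factor `θ(τ) = H^p(S ∩ 𝔹)`, where `S` is the subspace associated to `τ`, `𝔹` is the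
open unit ball of the homogeneous distance, and `H^p` is the Euclidean Hausdorff measure of the
scalar product of `G`, normalized so that it is the Lebesgue measure on `p`-planes. -/
def metricFactor {G : Type*} [NormedAddCommGroup G] [InnerProductSpace ℝ G]
    [FiniteDimensional ℝ G] [StratifiedGroup G] [MeasurableSpace G] [BorelSpace G]
    (ρ : HomogeneousDistance G) {p : ℕ} (τ : ⋀[ℝ]^p G) : ℝ≥0∞ :=
  (Measure.euclideanHausdorffMeasure p : Measure G) ((assocSubspace τ : Set G) ∩ ρ.ball 0 1)

/-! ### Submanifolds -/

/-- `Φ : A → M` is a `C¹` local parametrization of the set `M`: a `C¹` immersion of an open set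
`A ⊆ ℝ^p` that is a homeomorphism onto a relatively open subset of `M`. -/
structure IsC1Param {G : Type*} [NormedAddCommGroup G] [NormedSpace ℝ G] {p : ℕ} (M : Set G)
    (A : Set (EuclideanSpace ℝ (Fin p))) (Φ : EuclideanSpace ℝ (Fin p) → G) : Prop where
  isOpen : IsOpen A
  contDiffOn : ContDiffOn ℝ 1 Φ A
  immersion : ∀ t ∈ A, Function.Injective (fderiv ℝ Φ t)
  isEmbedding : Topology.IsEmbedding (A.domRestrict Φ)
  image_eq : ∃ U : Set G, IsOpen U ∧ Φ '' A = M ∩ U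

/-- `M` is a `p`-dimensional (embedded) `C¹` submanifold of `G`. -/
def IsC1Submanifold {G : Type*} [NormedAddCommGroup G] [NormedSpace ℝ G] (p : ℕ)
    (M : Set G) : Prop :=
  ∀ y ∈ M, ∃ (A : Set (EuclideanSpace ℝ (Fin p))) (Φ : EuclideanSpace ℝ (Fin p) → G),
    IsC1Param M A Φ ∧ y ∈ Φ '' A

/-- The Euclidean tangent cone of `M` at `x`. -/
def tangentCone {G : Type*} [NormedAddCommGroup G] [NormedSpace ℝ G] (M : Set G) (x : G) :
    Set G :=
  {w | ∃ (t : ℝ) (v : G) (u : ℕ → G), 0 ≤ t ∧ w = t • v ∧ (∀ i, u i ∈ M ∧ u i ≠ x) ∧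
    Tendsto u atTop (𝓝 x) ∧ Tendsto (fun i => ‖u i - x‖⁻¹ • (u i - x)) atTop (𝓝 v)}

/-- `v_1, …, v_p` is a basis of the tangent space of `M` at `x`, so that `v_1 ∧ ⋯ ∧ v_p` is a
tangent `p`-vector of `M` at `x`. -/
def IsTangentFrame {G : Type*} [NormedAddCommGroup G] [NormedSpace ℝ G] {p : ℕ} (M : Set G)
    (x : G) (v : Fin p → G) : Prop :=
  LinearIndependent ℝ v ∧ (Submodule.span ℝ (range v) : Set G) = tangentCone M x

/-- The `p`-vector `v_1 ∧ ⋯ ∧ v_p` at `x`, left translated to the origin: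
`(Λ_p dl_{x⁻¹}) (v_1 ∧ ⋯ ∧ v_p)`. -/
def translatedPVector {G : Type*} [NormedAddCommGroup G] [InnerProductSpace ℝ G]
    [StratifiedGroup G] {p : ℕ} (x : G) (v : Fin p → G) : ⋀[ℝ]^p G :=
  exteriorPower.ιMulti ℝ p fun i => fderiv ℝ (fun y : G => x⁻¹ * y) x (v i)

/-- The degree `d_M(x)`: the largest `d(α)` such that the left invariant `p`-vector field `X_α`
occurs in a tangent `p`-vector `∑ c_α X_α(x)` of `M` at `x`. -/
def pointDegree {G : Type*} [NormedAddCommGroup G] [InnerProductSpace ℝ G]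
    [StratifiedGroup G] {n : ℕ} (b : GradedBasis G n) (p : ℕ) (M : Set G) (x : G) : ℕ :=
  sSup {N | ∃ (v : Fin p → G) (α : Set.powersetCard (Fin n) p), IsTangentFrame M x v ∧
    b.coord (translatedPVector x v) α ≠ 0 ∧ N = b.multiDeg α}

/-- `x` is a transversal point of the `p`-dimensional submanifold `M`. -/
def IsTransversal {G : Type*} [NormedAddCommGroup G] [InnerProductSpace ℝ G]
    [StratifiedGroup G] {n : ℕ} (b : GradedBasis G n) (p : ℕ) (M : Set G) (x : G) : Prop :=
  pointDegree b p M x = b.maxDim p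

/-! ### Auxiliary Riemannian metric and surface measure -/

/-- A smooth Riemannian metric on the manifold `G`. -/
abbrev SmoothRiemannianMetric (G : Type*) [NormedAddCommGroup G] [NormedSpace ℝ G] :=
  Bundle.ContMDiffRiemannianMetric 𝓘(ℝ, G) ∞ G (fun x : G => TangentSpace 𝓘(ℝ, G) x)

/-- `‖v_1 ∧ ⋯ ∧ v_p‖_{g̃,x}`, the square root of the Gram determinant. -/
def riemNorm {G : Type*} [NormedAddCommGroup G] [NormedSpace ℝ G]
    (gt : SmoothRiemannianMetric G) (x : G) {p : ℕ} (v : Fin p → G) : ℝ :=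
  Real.sqrt (Matrix.det (Matrix.of fun i j : Fin p => (gt.inner x (v i) (v j) : ℝ)))

/-- The surface measure carried by one parametrization: the image under `Φ` of
`‖∂_1Φ ∧ ⋯ ∧ ∂_pΦ‖_{g̃} dt` on `A`. -/
def paramMeasure {G : Type*} [NormedAddCommGroup G] [NormedSpace ℝ G] [MeasurableSpace G]
    (gt : SmoothRiemannianMetric G) {p : ℕ}
    (A : Set (EuclideanSpace ℝ (Fin p))) (Φ : EuclideanSpace ℝ (Fin p) → G) : Measure G :=
  Measure.map Φ ((volume.restrict A).withDensity fun t => ENNReal.ofReal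
    (riemNorm gt (Φ t) fun i => fderiv ℝ Φ t (EuclideanSpace.single i 1)))

/-- The Riemannian surface measure of the `p`-dimensional `C¹` submanifold `M`. The measures
carried by the local parametrizations agree on overlaps, and the surface measure is the measure
obtained by gluing them, that is their least upper bound among measures. -/
def surfaceMeasure {G : Type*} [NormedAddCommGroup G] [NormedSpace ℝ G] [MeasurableSpace G]
    (gt : SmoothRiemannianMetric G) (p : ℕ) (M : Set G) : Measure G :=
  ⨆ (A : Set (EuclideanSpace ℝ (Fin p))) (Φ : EuclideanSpace ℝ (Fin p) → G)
    (_ : IsC1Param M A Φ), paramMeasure gt A Φ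

/-! ### Blow-ups -/

/-- The dilated translate `δ_{1/r}(x⁻¹ M)`. -/
def blowUp {G : Type*} [NormedAddCommGroup G] [InnerProductSpace ℝ G] [FiniteDimensional ℝ G]
    [StratifiedGroup G] (M : Set G) (x : G) (r : ℝ) : Set G :=
  (fun y => dilation (1 / r) (x⁻¹ * y)) '' M

/-- `Π_M(x)`, the subspace of `G` associated to the part `(τ_M(x))_{D(p),x}` of top degree of the
tangent `p`-vector `τ_M(x) = v_1 ∧ ⋯ ∧ v_p`. -/
def blowUpSubspace {G : Type*} [NormedAddCommGroup G] [InnerProductSpace ℝ G]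
    [StratifiedGroup G] {n : ℕ} (b : GradedBasis G n) {p : ℕ} (x : G) (v : Fin p → G) :
    Submodule ℝ G :=
  assocSubspace (b.proj (b.maxDim p) (translatedPVector x v))

/-- The unit tangent `p`-vector `τ_{M,g̃}(x)`, left translated to the origin. -/
def unitTangent {G : Type*} [NormedAddCommGroup G] [InnerProductSpace ℝ G]
    [StratifiedGroup G] (gt : SmoothRiemannianMetric G) {p : ℕ} (x : G) (v : Fin p → G) :
    ⋀[ℝ]^p G :=
  (riemNorm gt x v)⁻¹ • translatedPVector x v

end

open StratifiedGroup

/-! ### Iterated brackets and the Baker–Campbell–Hausdorff operation -/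

section Bch

variable {G : Type*} [AddCommGroup G] [Module ℝ G] (lie : G →ₗ[ℝ] G →ₗ[ℝ] G)

/-! Transversality supplies a multi-index `α` of maximal degree at which the left translated tangent
`p`-vector has a nonzero coordinate, that is, a nonzero minor. Inverting this minor yields a tangent
frame `w` whose coordinates of index in `α` form the identity matrix. By maximality, an index
outside `α` never has larger degree than an index in `α` (`deg_le_of_multiDeg_eq`). Hence `w i` has
no component of degree above that of the `i`-th entry of `α`, and the top degree part of the wedge
of the `w i` is the wedge of their homogeneous parts `topPart` (`proj_ιMulti`). The span of these
parts contains every layer above the lowest degree occurring in `α`, so it is a homogeneous ideal,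
hence a normal subgroup. This is the blow-up subspace.

By the inverse function theorem `x⁻¹ M` is near `0` a graph over the coordinates of index in `α`
(`exists_isGraphParam`). Rescale the graph by dilations in both source and target. A coordinate `k`
outside `α` is divided by `r ^ deg k`, while the dilated parameter is already of size `O(r ^ deg
k)`, since all degrees in `α` are at least `deg k`. The first order remainder therefore disappears,
and of the linear part only the terms of equal degree survive (`tendsto_rescaled`). Only
differentiability at the point enters here. All the convergence statements follow from this uniform
limit.

For the density, the dilation of the parameters has Jacobian `r ^ D(p)`, and dominated convergence
applies because the unit sphere of the blow-up subspace is null by homogeneity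
(`tendsto_surfaceMeasure_ball`). The area formula for the linear limit turns the result into the
metric factor; the choice of tangent frame cancels in the quotient.

For the Hausdorff dimension, Lebesgue measure in the coordinates of index in `α` is left invariant
on the blow-up subspace: the Jacobian of a translation is continuous, invariant under dilations, and
equal to `1` at the origin (`det_coordMulDeriv`). Balls thus have measure exactly `c r ^ D(p)`, and
a mass distribution and a packing argument give the two bounds. -/

theorem dynkinWord_map {H K : Type*} (f : H → K) (x y : H) {k : ℕ} (a : Fin k → ℕ × ℕ) :
    dynkinWord (f x) (f y) a = (dynkinWord x y a).map f := by
  simp [dynkinWord, List.map_flatMap]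

theorem eq_or_eq_of_mem_dynkinWord {H : Type*} {x y z : H} {k : ℕ} {a : Fin k → ℕ × ℕ}
    (h : z ∈ dynkinWord x y a) : z = x ∨ z = y := by
  simp only [dynkinWord, List.mem_flatMap, List.mem_append, List.mem_replicate] at h
  tauto

theorem length_dynkinWord {H : Type*} (x y : H) {k : ℕ} (a : Fin k → ℕ × ℕ) :
    (dynkinWord x y a).length = ∑ i, ((a i).1 + (a i).2) := by
  simp [dynkinWord, List.length_flatMap, List.map_ofFn, List.sum_ofFn, Function.comp_def]

theorem nestedLie_map {f : G →ₗ[ℝ] G} (hf : ∀ x y, f (lie x y) = lie (f x) (f y)) :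
    ∀ l : List G, f (nestedLie lie l) = nestedLie lie (l.map f)
  | [] => by simp [nestedLie]
  | [x] => by simp [nestedLie]
  | x :: y :: l => by
    have := nestedLie_map hf (y :: l)
    simp only [nestedLie, List.map_cons] at this ⊢
    rw [hf, this]

/-- Naturality of the series: Lie algebra endomorphisms, in particular dilations, become group
endomorphisms. -/
theorem bch_map {f : G →ₗ[ℝ] G} (hf : ∀ x y, f (lie x y) = lie (f x) (f y)) (N : ℕ) (x y : G) :
    f (bch lie N x y) = bch lie N (f x) (f y) := by
  simp only [bch, map_sum, map_smul, nestedLie_map lie hf, dynkinWord_map]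

/-- By bilinearity, replacing the entries one after the other produces brackets with an entry in the
ideal, which absorbs them. -/
theorem nestedLie_sub_mem {I : Submodule ℝ G} (hr : ∀ x, ∀ y ∈ I, lie x y ∈ I)
    (hl : ∀ x ∈ I, ∀ y, lie x y ∈ I) {l l' : List G} (h : List.Forall₂ (fun x y => x - y ∈ I) l l') :
    nestedLie lie l - nestedLie lie l' ∈ I := by
  induction h with
  | nil => simp [nestedLie]
  | @cons x x' l l' hx hl' ih =>
    cases hl' with
    | nil => simpa [nestedLie] using hx
    | @cons y y' m m' hy hm =>
      simp only [nestedLie]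
      have : lie x (nestedLie lie (y :: m)) - lie x' (nestedLie lie (y' :: m')) =
          lie x (nestedLie lie (y :: m) - nestedLie lie (y' :: m')) +
          lie (x - x') (nestedLie lie (y' :: m')) := by
        simp
      rw [this]
      exact I.add_mem (hr _ _ ih) (hl _ hx _)

theorem forall₂_dynkinWord {H K : Type*} {R : H → K → Prop} {x y : H} {x' y' : K} (hx : R x x')
    (hy : R y y') {k : ℕ} (a : Fin k → ℕ × ℕ) :
    List.Forall₂ R (dynkinWord x y a) (dynkinWord x' y' a) := by
  unfold dynkinWord
  induction List.ofFn a with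
  | nil => simp
  | cons q l ih =>
    simp only [List.flatMap_cons]
    refine List.rel_append (List.rel_append ?_ ?_) ih
    · induction q.1 with
      | zero => simp
      | succ n ih => simpa [List.replicate_succ] using ⟨hx, ih⟩
    · induction q.2 with
      | zero => simp
      | succ n ih => simpa [List.replicate_succ] using ⟨hy, ih⟩

/-- The operation descends to the quotient by an ideal. This single fact gives both closure under
products and normality of ideals. -/
theorem bch_sub_mem {I : Submodule ℝ G} (hr : ∀ x, ∀ y ∈ I, lie x y ∈ I)
    (hl : ∀ x ∈ I, ∀ y, lie x y ∈ I) (N : ℕ) {x x' y y' : G} (hx : x - x' ∈ I) (hy : y - y' ∈ I) :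
    bch lie N x y - bch lie N x' y' ∈ I := by
  simp only [bch, ← Finset.sum_sub_distrib, ← smul_sub]
  exact I.sum_mem fun k _ => I.sum_mem fun a _ =>
    I.smul_mem _ (nestedLie_sub_mem lie hr hl (forall₂_dynkinWord (R := fun x y => x - y ∈ I) hx hy a))

/-- The innermost bracket of two multiples of `z` vanishes. A word of length one has no bracket and
must be excluded. -/
theorem nestedLie_eq_zero_of_collinear (h : ∀ x, lie x x = 0) (z : G) :
    ∀ l : List G, (∀ x ∈ l, ∃ c : ℝ, x = c • z) → l.length ≠ 1 → nestedLie lie l = 0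
  | [], _, _ => rfl
  | [x], _, h1 => by simp at h1
  | [x, y], hl, _ => by
    obtain ⟨c, rfl⟩ := hl x (by simp)
    obtain ⟨c', rfl⟩ := hl y (by simp)
    simp [nestedLie, h]
  | x :: y :: w :: l, hl, _ => by
    have := nestedLie_eq_zero_of_collinear h z (y :: w :: l)
      (fun u hu => hl u (List.mem_cons_of_mem _ hu)) (by simp)
    rw [nestedLie, this, map_zero]

/-- Only words of length one survive on a line, so the series reduces to addition. This identifies
the unit with `0` and the inverse with the negative. -/
theorem bch_collinear (h : ∀ x, lie x x = 0) {N : ℕ} (hN : 1 ≤ N) (z : G) (c c' : ℝ) :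
    bch lie N (c • z) (c' • z) = (c + c') • z := by
  have hz : ∀ (k : ℕ) (a : Fin k → ℕ × ℕ), ∑ i, ((a i).1 + (a i).2) ≠ 1 →
      nestedLie lie (dynkinWord (c • z) (c' • z) a) = 0 := by
    intro k a ha
    refine nestedLie_eq_zero_of_collinear lie h z _ (fun x hx => ?_) (by rwa [length_dynkinWord])
    rcases eq_or_eq_of_mem_dynkinWord hx with rfl | rfl
    exacts [⟨c, rfl⟩, ⟨c', rfl⟩]
  have hpos : ∀ (k : ℕ) (a : Fin k → ℕ × ℕ),
      a ∈ Fintype.piFinset (fun _ : Fin k => dynkinPairs N) → k ≤ ∑ i, ((a i).1 + (a i).2) := by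
    intro k a ha
    have : ∑ _i : Fin k, 1 ≤ ∑ i, ((a i).1 + (a i).2) := Finset.sum_le_sum fun i _ => by
      have := Fintype.mem_piFinset.1 ha i
      exact (Finset.mem_filter.1 this).2
    simpa using this
  unfold bch
  rw [Finset.sum_eq_single_of_mem 1 (by simpa using hN)]
  · have h10 : (fun _ : Fin 1 => ((1, 0) : ℕ × ℕ)) ∈
        Fintype.piFinset (fun _ : Fin 1 => dynkinPairs N) := by
      simp [dynkinPairs]; omega
    have h01 : (fun _ : Fin 1 => ((0, 1) : ℕ × ℕ)) ∈
        Fintype.piFinset (fun _ : Fin 1 => dynkinPairs N) := by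
      simp [dynkinPairs]; omega
    have hne : (fun _ : Fin 1 => ((1, 0) : ℕ × ℕ)) ≠ fun _ => (0, 1) := fun h => by
      simpa using congrFun h 0
    -- For `k = 1` the pairs `(1, 0)` and `(0, 1)` are the only ones with words of length one; they
    -- contribute `c • z` and `c' • z`.
    rw [← Finset.sum_subset (s₁ := {fun _ => (1, 0), fun _ => (0, 1)})]
    · rw [Finset.sum_pair hne]
      simp [dynkinWord, nestedLie, add_smul]
    · intro a ha
      simp only [Finset.mem_insert, Finset.mem_singleton] at ha
      rcases ha with rfl | rfl
      exacts [h10, h01]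
    · intro a _ ha
      rw [hz 1 a, smul_zero]
      intro h1
      apply ha
      simp only [Fin.sum_univ_one] at h1
      simp only [Finset.mem_insert, Finset.mem_singleton, funext_iff, Fin.forall_fin_one, Prod.ext_iff]
      omega
  -- Each pair has at least one letter, so for `k ≥ 2` every word has length at least two.
  · intro k hk hk1
    refine Finset.sum_eq_zero fun a ha => ?_
    rw [hz k a, smul_zero]
    have := hpos k a ha
    have := (Finset.mem_Icc.1 hk).1
    omega

end Bch

/-! ### Smoothness of the Baker–Campbell–Hausdorff operation -/

section Smooth

variable {G : Type*} [NormedAddCommGroup G] [NormedSpace ℝ G] [FiniteDimensional ℝ G]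
  (lie : G →ₗ[ℝ] G →ₗ[ℝ] G)

theorem contDiff_bilinear {H : Type*} [NormedAddCommGroup H] [NormedSpace ℝ H]
    {f g : H → G} {m : WithTop ℕ∞} (hf : ContDiff ℝ m f) (hg : ContDiff ℝ m g) :
    ContDiff ℝ m fun q => lie (f q) (g q) := by
  let B : G →L[ℝ] G →L[ℝ] G :=
    ((LinearMap.toContinuousLinearMap : (G →ₗ[ℝ] G) ≃ₗ[ℝ] (G →L[ℝ] G)).toLinearMap ∘ₗ
      lie).toContinuousLinearMap
  exact (B.contDiff.comp hf).clm_apply hg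

theorem contDiff_nestedLie {H : Type*} [NormedAddCommGroup H] [NormedSpace ℝ H] {m : WithTop ℕ∞} :
    ∀ l : List (H → G), (∀ f ∈ l, ContDiff ℝ m f) →
      ContDiff ℝ m fun q => nestedLie lie (l.map fun f => f q)
  | [], _ => by simpa [nestedLie] using contDiff_const
  | [f], h => by simpa [nestedLie] using h f (by simp)
  | f :: g :: l, h => by
    simp only [List.map_cons, nestedLie]
    exact contDiff_bilinear lie (h f (by simp))
      (contDiff_nestedLie (g :: l) fun u hu => h u (List.mem_cons_of_mem _ hu))

theorem contDiff_bch (N : ℕ) {m : WithTop ℕ∞} :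
    ContDiff ℝ m fun q : G × G => bch lie N q.1 q.2 := by
  unfold bch
  refine ContDiff.sum fun k _ => ContDiff.sum fun a _ => ContDiff.const_smul _ ?_
  -- The word is written in the two projections as letters and evaluated afterwards, so only the
  -- smoothness of its letters is needed.
  have := contDiff_nestedLie (m := m) lie (dynkinWord (Prod.fst : G × G → G) Prod.snd a) (by
    intro f hf
    rcases eq_or_eq_of_mem_dynkinWord hf with rfl | rfl
    exacts [contDiff_fst, contDiff_snd])
  simpa only [← dynkinWord_map] using this

end Smooth

/-! ### Stratified groups -/

namespace StratifiedGroup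

variable {G : Type*} [NormedAddCommGroup G] [InnerProductSpace ℝ G] [StratifiedGroup G]

theorem step_pos : 1 ≤ step G := by
  by_contra! h
  have h0 : step G = 0 := by omega
  exact layer_step (G := G) (by rw [h0, layer_zero])

theorem lie_skew (x y : G) : lie x y = -lie y x := by
  have h := lie_self (x + y)
  simp only [map_add, LinearMap.add_apply, lie_self, zero_add, add_zero] at h
  exact eq_neg_of_add_eq_zero_right h

/-- The axioms only control brackets with the first layer. Induction on the first index: the next
layer is spanned by brackets `[a, z]` with `a` in the first layer, and Jacobi gives `[[a, z], y] =
[a, [z, y]] - [z, [a, y]]`. -/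
theorem lie_mem_layer {i j : ℕ} {x y : G} (hx : x ∈ layer (G := G) i) (hy : y ∈ layer (G := G) j) :
    lie x y ∈ layer (G := G) (i + j) := by
  have key : ∀ i j : ℕ, 1 ≤ j → ∀ x ∈ layer (G := G) (i + 1), ∀ y ∈ layer (G := G) j,
      lie x y ∈ layer (G := G) (i + 1 + j) := by
    intro i
    induction i with
    | zero =>
      intro j hj x hx y hy
      rw [show 0 + 1 + j = j + 1 by ring, layer_succ j hj]
      exact Submodule.subset_span ⟨x, hx, y, hy, rfl⟩
    | succ i ih =>
      intro j hj x hx y hy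
      have one : ∀ k : ℕ, 1 ≤ k → ∀ a ∈ layer (G := G) 1, ∀ z ∈ layer (G := G) k,
          lie a z ∈ layer (G := G) (k + 1) := by
        intro k hk a ha z hz
        rw [layer_succ k hk]
        exact Submodule.subset_span ⟨a, ha, z, hz, rfl⟩
      rw [layer_succ (i + 1) (by omega)] at hx
      induction hx using Submodule.span_induction with
      | zero => simp
      | add u v _ _ hu hv => simpa using Submodule.add_mem _ hu hv
      | smul c u _ hu => simpa using Submodule.smul_mem _ c hu
      | mem u hu =>
        obtain ⟨a, ha, z, hz, rfl⟩ := hu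
        have hj := jacobi a z y
        have : lie (lie a z) y = lie a (lie z y) - lie z (lie a y) := by
          rw [lie_skew (lie a z) y, lie_skew a y, map_neg, sub_neg_eq_add]
          exact neg_eq_of_add_eq_zero_left hj
        rw [this]
        refine Submodule.sub_mem _ ?_ ?_
        · have := one _ (by omega) a ha _ (ih j (by omega) z hz y hy)
          rwa [show i + 1 + j + 1 = i + 1 + 1 + j by ring] at this
        · have := ih (j + 1) (by omega) z hz _ (one j (by omega) a ha y hy)
          rwa [show i + 1 + (j + 1) = i + 1 + 1 + j by ring] at this
  rcases i with _ | i
  · rw [layer_zero, Submodule.mem_bot] at hx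
    simp [hx]
  rcases j with _ | j
  · rw [layer_zero, Submodule.mem_bot] at hy
    simp [hy]
  exact key i (j + 1) (by omega) x hx y hy

/-- The series gives `1 * 0 = 1`, since both factors are multiples of the vector `1`; the group law
gives `1 * 0 = 0`. -/
theorem one_eq_zero : (1 : G) = 0 := by
  have h : (1 : G) * 0 = 1 := by
    rw [mul_eq_bch]
    simpa using bch_collinear (lie (G := G)) lie_self step_pos 1 1 0
  simpa using h.symm

theorem mul_zero_eq (x : G) : x * 0 = x := by
  rw [← one_eq_zero, mul_one]

theorem zero_mul_eq (x : G) : 0 * x = x := by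
  rw [← one_eq_zero, one_mul]

theorem inv_mul_self_eq (x : G) : x⁻¹ * x = 0 := by
  rw [inv_mul_cancel, one_eq_zero]

theorem inv_eq_neg (x : G) : x⁻¹ = -x := by
  refine inv_eq_of_mul_eq_one_right ?_
  rw [mul_eq_bch, one_eq_zero]
  simpa using bch_collinear (lie (G := G)) lie_self step_pos x 1 (-1)

theorem mul_sub_mul_mem {I : Submodule ℝ G} (hI : ∀ x, ∀ y ∈ I, lie x y ∈ I) {x x' y y' : G}
    (hx : x - x' ∈ I) (hy : y - y' ∈ I) : x * y - x' * y' ∈ I := by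
  rw [mul_eq_bch, mul_eq_bch]
  refine bch_sub_mem _ hI (fun x hx y => ?_) _ hx hy
  rw [lie_skew]
  exact I.neg_mem (hI _ _ hx)

/-- An ideal of the Lie algebra is a normal subgroup. -/
theorem exists_normal_subgroup {I : Submodule ℝ G} (hI : ∀ x, ∀ y ∈ I, lie x y ∈ I) :
    ∃ P : Subgroup G, P.Normal ∧ (P : Set G) = I := by
  refine ⟨{ carrier := I, mul_mem' := ?_, one_mem' := ?_, inv_mem' := ?_ }, ⟨?_⟩, rfl⟩
  · intro a c ha hc
    have := mul_sub_mul_mem hI (x := a) (x' := 0) (y := c) (y' := 0) (by simpa using ha)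
      (by simpa using hc)
    simpa [zero_mul_eq] using this
  · change (1 : G) ∈ I
    rw [one_eq_zero]
    exact I.zero_mem
  · intro a ha
    change a⁻¹ ∈ I
    rw [inv_eq_neg]
    exact I.neg_mem ha
  · intro a ha g
    change g * a * g⁻¹ ∈ I
    -- Modulo the ideal, `g * a * g⁻¹` is congruent to `g * 0 * g⁻¹ = 0`.
    have h1 := mul_sub_mul_mem hI (x := g) (x' := g) (y := a) (y' := 0) (by simp) (by simpa using ha)
    have h2 := mul_sub_mul_mem hI (x := g * a) (x' := g * 0) (y := g⁻¹) (y' := g⁻¹) h1 (by simp)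
    rwa [mul_zero_eq, mul_inv_cancel, one_eq_zero, sub_zero] at h2

variable [FiniteDimensional ℝ G]

theorem contDiff_mul {m : WithTop ℕ∞} : ContDiff ℝ m fun q : G × G => q.1 * q.2 := by
  simp only [mul_eq_bch]
  exact contDiff_bch _ _

theorem contDiff_mul_left {m : WithTop ℕ∞} (x : G) : ContDiff ℝ m fun y : G => x * y :=
  contDiff_mul.comp (contDiff_const.prodMk contDiff_id)

/-- The differential of the left translation by `x⁻¹` at `x`, inverse to that of `x` at `0`. -/
theorem fderiv_mul_left_comp (x : G) :
    (fderiv ℝ (fun y : G => x * y) 0).comp (fderiv ℝ (fun y : G => x⁻¹ * y) x) =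
      ContinuousLinearMap.id ℝ G := by
  have h1 : HasFDerivAt (fun y : G => x⁻¹ * y) (fderiv ℝ (fun y : G => x⁻¹ * y) x) x :=
    ((contDiff_mul_left (m := 1) x⁻¹).differentiable one_ne_zero x).hasFDerivAt
  have h2 : HasFDerivAt (fun y : G => x * y) (fderiv ℝ (fun y : G => x * y) 0) (x⁻¹ * x) := by
    rw [inv_mul_self_eq]
    exact ((contDiff_mul_left (m := 1) x).differentiable one_ne_zero 0).hasFDerivAt
  have h3 := h2.comp x h1
  have h4 : (fun y : G => x * y) ∘ (fun y : G => x⁻¹ * y) = id := by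
    ext y; simp
  rw [h4] at h3
  exact h3.unique (hasFDerivAt_id x)

theorem injective_fderiv_inv_mul (x : G) :
    Function.Injective (fderiv ℝ (fun y : G => x⁻¹ * y) x) :=
  Function.LeftInverse.injective (g := fderiv ℝ (fun y : G => x * y) 0)
    fun y => congrArg (fun L : G →L[ℝ] G => L y) (fderiv_mul_left_comp x)

end StratifiedGroup

/-! ### Coordinates in a graded basis, dilations -/

namespace GradedBasis

variable {G : Type*} [NormedAddCommGroup G] [InnerProductSpace ℝ G] [StratifiedGroup G] {n : ℕ}
  (b : GradedBasis G n)

theorem ext_repr {x y : G} (h : ∀ i, b.X.repr x i = b.X.repr y i) : x = y :=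
  b.X.repr.injective (by ext i; exact h i)

theorem deg_pos (i : Fin n) : 1 ≤ b.deg i := by
  by_contra! h
  have h0 : b.deg i = 0 := by omega
  have := b.mem_layer i
  rw [h0, layer_zero, Submodule.mem_bot] at this
  exact b.X.orthonormal.ne_zero i this

theorem deg_le_step (i : Fin n) : b.deg i ≤ step G := by
  by_contra! h
  have := b.mem_layer i
  rw [layer_of_gt _ h, Submodule.mem_bot] at this
  exact b.X.orthonormal.ne_zero i this

theorem repr_eq_zero_of_mem_layer {j : ℕ} {x : G} (hx : x ∈ layer (G := G) j) {i : Fin n}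
    (hi : b.deg i ≠ j) : b.X.repr x i = 0 := by
  rw [OrthonormalBasis.repr_apply_apply]
  exact (layer_ortho (b.deg i) j hi).inner_eq (b.mem_layer i) hx

theorem mem_layer_iff {j : ℕ} {x : G} :
    x ∈ layer (G := G) j ↔ ∀ i, b.deg i ≠ j → b.X.repr x i = 0 := by
  refine ⟨fun hx i hi => b.repr_eq_zero_of_mem_layer hx hi, fun h => ?_⟩
  rw [← b.X.sum_repr x]
  refine Submodule.sum_mem _ fun i _ => ?_
  by_cases hi : b.deg i = j
  · exact Submodule.smul_mem _ _ (hi ▸ b.mem_layer i)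
  · simp [h i hi]

variable [FiniteDimensional ℝ G]

theorem repr_dilation (r : ℝ) (x : G) (i : Fin n) :
    b.X.repr (dilation r x) i = r ^ b.deg i * b.X.repr x i := by
  have hproj : ∀ j, b.X.repr ((layer (G := G) j).starProjection x) i =
      if b.deg i = j then b.X.repr x i else 0 := by
    intro j
    split_ifs with h
    · rw [OrthonormalBasis.repr_apply_apply, OrthonormalBasis.repr_apply_apply,
        ← Submodule.inner_starProjection_left_eq_right,
        Submodule.starProjection_eq_self_iff.2 (h ▸ b.mem_layer i)]
    · exact b.repr_eq_zero_of_mem_layer (Submodule.starProjection_apply_mem _ _) h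
  unfold dilation
  rw [map_sum, WithLp.ofLp_sum, Finset.sum_apply, Finset.sum_eq_single (b.deg i)]
  · simp [hproj]
  · intro j _ hj
    simp [hproj, hj.symm]
  · intro h
    exact absurd (Finset.mem_Icc.2 ⟨b.deg_pos i, b.deg_le_step i⟩) h

end GradedBasis

section Dilation

variable {G : Type*} [NormedAddCommGroup G] [InnerProductSpace ℝ G] [FiniteDimensional ℝ G]
  [StratifiedGroup G]

/-- The dilation as a linear map. -/
noncomputable def dilationLM (r : ℝ) : G →ₗ[ℝ] G where
  toFun := dilation r
  map_add' x y := by simp [dilation, Finset.sum_add_distrib]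
  map_smul' c x := by simp [dilation, Finset.smul_sum, smul_comm c]

@[simp] theorem dilationLM_apply (r : ℝ) (x : G) : dilationLM r x = dilation r x := rfl

@[simp] theorem dilation_zero_right (r : ℝ) : dilation r (0 : G) = 0 := (dilationLM r).map_zero

theorem continuous_dilation : Continuous fun q : ℝ × G => dilation q.1 q.2 := by
  unfold dilation
  fun_prop

variable {n : ℕ} (b : GradedBasis G n)
include b

theorem dilation_of_mem_layer (r : ℝ) {j : ℕ} {x : G} (hx : x ∈ layer (G := G) j) :
    dilation r x = r ^ j • x := by
  refine b.ext_repr fun i => ?_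
  rw [b.repr_dilation]
  by_cases hi : b.deg i = j
  · simp [hi]
  · simp [b.repr_eq_zero_of_mem_layer hx hi]

theorem dilation_mul_eq_comp (r s : ℝ) (x : G) : dilation r (dilation s x) = dilation (r * s) x :=
  b.ext_repr fun i => by simp only [b.repr_dilation]; ring

theorem dilation_one (x : G) : dilation 1 x = x :=
  b.ext_repr fun i => by simp [b.repr_dilation]

theorem dilation_zero_left (x : G) : dilation 0 x = 0 :=
  b.ext_repr fun i => by
    have := b.deg_pos i
    simp [b.repr_dilation, show b.deg i ≠ 0 by omega]

theorem dilation_dilation_inv {r : ℝ} (hr : r ≠ 0) (x : G) : dilation r (dilation (1 / r) x) = x := by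
  rw [dilation_mul_eq_comp b, mul_one_div_cancel hr, dilation_one b]

/-- Both sides are bilinear, so basis vectors suffice; there the bracket of degrees `i` and `j` lies
in degree `i + j`. -/
theorem dilation_lie (r : ℝ) (x y : G) : dilation r (lie x y) = lie (dilation r x) (dilation r y) := by
  have : (lie (G := G)).compr₂ (dilationLM r) =
      (lie (G := G)).compl₁₂ (dilationLM r) (dilationLM r) := by
    refine b.X.toBasis.ext fun i => b.X.toBasis.ext fun j => ?_
    simp only [OrthonormalBasis.coe_toBasis, LinearMap.compr₂_apply, LinearMap.compl₁₂_apply,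
      dilationLM_apply]
    rw [dilation_of_mem_layer b r (lie_mem_layer (b.mem_layer i) (b.mem_layer j)),
      dilation_of_mem_layer b r (b.mem_layer i), dilation_of_mem_layer b r (b.mem_layer j)]
    simp [pow_add, mul_smul, smul_comm (r ^ b.deg i)]
  exact congrArg (fun L : G →ₗ[ℝ] G →ₗ[ℝ] G => L x y) this

theorem dilation_mul (r : ℝ) (x y : G) : dilation r (x * y) = dilation r x * dilation r y := by
  rw [mul_eq_bch, mul_eq_bch]
  exact bch_map _ (f := dilationLM r) (dilation_lie b r) _ x y

end Dilation

/-! ### The topology of a homogeneous distance -/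

section HomogeneousDistance

variable {G : Type*} [NormedAddCommGroup G] [InnerProductSpace ℝ G] [FiniteDimensional ℝ G]
  [StratifiedGroup G] {n : ℕ} (b : GradedBasis G n)

include b in
theorem GradedBasis.norm_dilation_le {r : ℝ} (h0 : 0 ≤ r) (h1 : r ≤ 1) (x : G) :
    ‖dilation r x‖ ≤ r * ‖x‖ := by
  rw [← b.X.repr.norm_map, ← b.X.repr.norm_map x]
  refine le_of_sq_le_sq ?_ (by positivity)
  rw [mul_pow, EuclideanSpace.norm_sq_eq, EuclideanSpace.norm_sq_eq, Finset.mul_sum]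
  refine Finset.sum_le_sum fun i _ => ?_
  rw [b.repr_dilation, norm_mul, mul_pow]
  gcongr
  rw [Real.norm_of_nonneg (by positivity)]
  have := b.deg_pos i
  exact pow_le_of_le_one h0 h1 (by omega)

namespace HomogeneousDistance

variable (ρ : HomogeneousDistance G)

theorem d_self (x : G) : ρ.d x x = 0 := (ρ.eq_zero_iff x x).2 rfl

theorem d_nonneg (x y : G) : 0 ≤ ρ.d x y := by
  have h := ρ.triangle x y x
  rw [ρ.d_self, ρ.symm y x] at h
  linarith

theorem d_eq (x y : G) : ρ.d x y = ρ.d 0 (x⁻¹ * y) := by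
  rw [← ρ.left_inv x y x⁻¹, inv_mul_self_eq]

theorem d_zero_dilation {r : ℝ} (hr : 0 < r) (x : G) : ρ.d 0 (dilation r x) = r * ρ.d 0 x := by
  simpa using ρ.homogeneous r hr 0 x

theorem continuous_d_left (x : G) : Continuous (ρ.d x) :=
  ρ.continuous_d.comp (by fun_prop : Continuous fun y : G => (x, y))

theorem isOpen_ball (x : G) (r : ℝ) : IsOpen (ρ.ball x r) :=
  isOpen_lt (ρ.continuous_d_left x) continuous_const

include b in
-- Compactness of the Euclidean unit sphere bounds `d(0, ·)` below on it by some `c > 0`; dilations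
-- carry this bound to all points outside the sphere.
theorem exists_norm_le : ∃ C : ℝ, 0 < C ∧ ∀ z, ρ.d 0 z ≤ 1 → ‖z‖ ≤ C := by
  obtain ⟨c, hc, hcS⟩ : ∃ c : ℝ, 0 < c ∧ ∀ z ∈ Metric.sphere (0 : G) 1, c ≤ ρ.d 0 z := by
    rcases (Metric.sphere (0 : G) 1).eq_empty_or_nonempty with h | h
    · exact ⟨1, one_pos, by simp [h]⟩
    · obtain ⟨z₀, hz₀, hmin⟩ := (isCompact_sphere (0 : G) 1).exists_isMinOn h
        (ρ.continuous_d_left 0).continuousOn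
      refine ⟨ρ.d 0 z₀, lt_of_le_of_ne (ρ.d_nonneg _ _) fun h0 => ?_, fun z hz => hmin hz⟩
      have := (ρ.eq_zero_iff 0 z₀).1 h0.symm
      simp [← this] at hz₀
  -- A point of norm above `1` reaches the sphere under some dilation of ratio `r` in `(0, 1]`,
  -- whence `c ≤ r d(0, z) ≤ d(0, z)`.
  have key : ∀ z, ρ.d 0 z < c → ‖z‖ ≤ 1 := by
    intro z hz
    by_contra! h
    have hcont : ContinuousOn (fun r : ℝ => ‖dilation r z‖) (Icc 0 1) :=
      (continuous_dilation.comp (by fun_prop : Continuous fun r : ℝ => (r, z))).norm.continuousOn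
    obtain ⟨r, hr, hrz⟩ := intermediate_value_Icc zero_le_one hcont
      (show (1 : ℝ) ∈ _ by simp [dilation_zero_left b, dilation_one b, h.le])
    have hr0 : 0 < r := by
      refine lt_of_le_of_ne hr.1 fun h0 => ?_
      rw [← h0] at hrz
      simp [dilation_zero_left b] at hrz
    have h1 := hcS (dilation r z) (by simpa using hrz)
    rw [ρ.d_zero_dilation hr0] at h1
    nlinarith [hr.2, ρ.d_nonneg 0 z]
  -- Ratio `c / 2` sends the closed unit ball of `d` into `d(0, ·) < c`, hence into the Euclidean
  -- unit ball. `M` bounds the inverse dilation there.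
  obtain ⟨M, hM⟩ := (isCompact_closedBall (0 : G) 1).exists_bound_of_continuousOn
    (continuous_dilation.comp (by fun_prop : Continuous fun z : G => (1 / (c / 2), z))).continuousOn
  refine ⟨max M 1, by positivity, fun z hz => le_max_of_le_left ?_⟩
  have h1 : ‖dilation (c / 2) z‖ ≤ 1 := key _ (by
    rw [ρ.d_zero_dilation (by positivity)]
    nlinarith)
  have h2 := hM (dilation (c / 2) z) (by simpa using h1)
  simpa [dilation_mul_eq_comp b, hc.ne', dilation_one b] using h2

include b in
/-- A bound for the norm on the balls of the homogeneous distance. -/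
theorem norm_le_mul_of_d_le {C : ℝ} (hC : ∀ z, ρ.d 0 z ≤ 1 → ‖z‖ ≤ C) {r : ℝ} (h0 : 0 < r)
    (h1 : r ≤ 1) {z : G} (hz : ρ.d 0 z ≤ r) : ‖z‖ ≤ r * C := by
  have h2 := hC (dilation (1 / r) z) (by
    rw [ρ.d_zero_dilation (by positivity), one_div_mul_eq_div]
    exact (div_le_one h0).2 hz)
  have h3 := b.norm_dilation_le h0.le h1 (dilation (1 / r) z)
  rw [dilation_dilation_inv b h0.ne'] at h3
  nlinarith

include b in
theorem exists_ball_subset {x : G} {U : Set G} (hU : U ∈ 𝓝 x) : ∃ r > 0, ρ.ball x r ⊆ U := by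
  obtain ⟨C, hC0, hC⟩ := ρ.exists_norm_le b
  have hcont : Tendsto (fun z : G => x * z) (𝓝 0) (𝓝 x) := by
    have := (contDiff_mul_left (m := 0) x).continuous.tendsto 0
    rwa [mul_zero_eq] at this
  obtain ⟨η, hη, hηU⟩ := Metric.mem_nhds_iff.1 (hcont hU)
  refine ⟨min 1 (η / (2 * C)), by positivity, fun y hy => ?_⟩
  have hy' : ρ.d 0 (x⁻¹ * y) < min 1 (η / (2 * C)) := by rw [← ρ.d_eq]; exact hy
  have h1 := ρ.norm_le_mul_of_d_le b hC (by positivity) (min_le_left _ _) hy'.le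
  have h2 : x⁻¹ * y ∈ Metric.ball (0 : G) η := by
    rw [mem_ball_zero_iff]
    refine h1.trans_lt ?_
    calc min 1 (η / (2 * C)) * C ≤ η / (2 * C) * C := by gcongr; exact min_le_right _ _
      _ = η / 2 := by field_simp
      _ < η := by linarith
  simpa using hηU h2

include b in
/-- A homogeneous distance induces the topology of `G`. -/
theorem toTopologicalSpace_eq :
    ρ.metricSpace.toUniformSpace.toTopologicalSpace =
      (inferInstance : TopologicalSpace G) := by
  refine TopologicalSpace.ext_nhds fun x => ?_
  ext U
  rw [@Metric.mem_nhds_iff G ρ.metricSpace.toPseudoMetricSpace]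
  constructor
  · rintro ⟨r, hr, h⟩
    refine mem_of_superset ((ρ.isOpen_ball x r).mem_nhds ?_) (fun y hy => h ?_)
    · change ρ.d x x < r
      rwa [ρ.d_self]
    · change ρ.d y x < r
      rw [ρ.symm]; exact hy
  · intro hU
    obtain ⟨r, hr, h⟩ := ρ.exists_ball_subset b hU
    refine ⟨r, hr, fun y hy => h ?_⟩
    change ρ.d x y < r
    rw [ρ.symm]; exact hy

/-- Uniform comparison of a homogeneous distance with the norm on compact sets. -/
theorem exists_forall_d_lt {K : Set G} (hK : IsCompact K) {ε : ℝ} (hε : 0 < ε) :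
    ∃ η > 0, ∀ z ∈ K, ∀ w, ‖z - w‖ < η → ρ.d z w < ε := by
  have hK1 : IsCompact (Metric.cthickening 1 K) := hK.cthickening
  have hu := (hK1.prod hK1).uniformContinuousOn_of_continuous ρ.continuous_d.continuousOn
  obtain ⟨η, hη, h⟩ := Metric.uniformContinuousOn_iff.1 hu ε hε
  refine ⟨min η 1, by positivity, fun z hz w hw => ?_⟩
  have hz1 : z ∈ Metric.cthickening 1 K := Metric.self_subset_cthickening K hz
  have hw1 : w ∈ Metric.cthickening 1 K := by
    refine Metric.mem_cthickening_of_dist_le w z 1 K hz ?_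
    rw [dist_comm, dist_eq_norm]
    exact (hw.trans_le (min_le_right _ _)).le
  have := h (z, w) ⟨hz1, hw1⟩ (z, z) ⟨hz1, hz1⟩ (by
    rw [Prod.dist_eq]
    simp only [dist_self]
    rw [max_eq_right dist_nonneg, dist_comm, dist_eq_norm]
    exact hw.trans_le (min_le_left _ _))
  simp only [ρ.d_self, Real.dist_eq, sub_zero] at this
  exact (le_abs_self _).trans_lt this

end HomogeneousDistance

end HomogeneousDistance

/-! ### Simple multivectors -/

section Exterior

theorem ιMulti_ne_zero_of_linearIndependent {E : Type*} [AddCommGroup E] [Module ℝ E] {p : ℕ}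
    {v : Fin p → E} (hv : LinearIndependent ℝ v) : exteriorPower.ιMulti ℝ p v ≠ 0 := by
  have h := (exteriorPower.ιMulti_family_linearIndependent_field (n := p) hv).ne_zero
    (Set.powersetCard.ofFinEmbEquiv (RelEmbedding.refl _))
  simpa [exteriorPower.ιMulti_family] using h

theorem mem_assocSubspace {E : Type*} [AddCommGroup E] [Module ℝ E] {p : ℕ} (τ : ⋀[ℝ]^p E) (w : E) :
    w ∈ assocSubspace τ ↔ ExteriorAlgebra.ι ℝ w * (τ : ExteriorAlgebra ℝ E) = 0 := by
  simp [assocSubspace]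

/-- Here `w ∧ v₁ ∧ ⋯ ∧ v_p` is the wedge of the list `w, v₁, …, v_p`, which vanishes exactly when
that list is dependent. -/
theorem assocSubspace_ιMulti {E : Type*} [AddCommGroup E] [Module ℝ E] {p : ℕ} {v : Fin p → E}
    (hv : LinearIndependent ℝ v) :
    assocSubspace (exteriorPower.ιMulti ℝ p v) = Submodule.span ℝ (range v) := by
  ext w
  have hw : ExteriorAlgebra.ι ℝ w * (exteriorPower.ιMulti ℝ p v : ExteriorAlgebra ℝ E) =
      (exteriorPower.ιMulti ℝ (p + 1) (Fin.cons w v : Fin (p + 1) → E) : ExteriorAlgebra ℝ E) := by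
    simp only [exteriorPower.ιMulti_apply_coe]
    rw [ExteriorAlgebra.ιMulti_succ_apply]
    simp [Matrix.vecTail, Function.comp_def]
  rw [mem_assocSubspace, hw, ZeroMemClass.coe_eq_zero]
  constructor
  · intro h
    by_contra hn
    exact ιMulti_ne_zero_of_linearIndependent (linearIndependent_finCons.2 ⟨hv, hn⟩) h
  · intro h
    refine AlternatingMap.map_linearDependent _ _ fun hl => ?_
    exact (linearIndependent_finCons.1 hl).2 h

theorem assocSubspace_smul {E : Type*} [AddCommGroup E] [Module ℝ E] {p : ℕ} {c : ℝ} (hc : c ≠ 0)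
    (τ : ⋀[ℝ]^p E) : assocSubspace (c • τ) = assocSubspace τ := by
  ext w
  simp [mem_assocSubspace, hc]

namespace GradedBasis

variable {G : Type*} [NormedAddCommGroup G] [InnerProductSpace ℝ G] [StratifiedGroup G] {n p : ℕ}
  (b : GradedBasis G n)

/-- The increasing enumeration of a multi-index. -/
noncomputable def enum (α : Set.powersetCard (Fin n) p) : Fin p ↪o Fin n :=
  Set.powersetCard.ofFinEmbEquiv.symm α

/-- The coordinates of a simple multivector are minors; questions about wedges become questions
about determinants. -/
theorem coord_ιMulti (v : Fin p → G) (α : Set.powersetCard (Fin n) p) :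
    b.coord (exteriorPower.ιMulti ℝ p v) α =
      (Matrix.of fun i j => b.X.repr (v i) (enum α j)).det := by
  rw [coord, exteriorPower.basis_repr_apply, exteriorPower.ιMultiDual_apply_ιMulti]
  simp [enum, Module.Basis.coord_apply]

theorem exists_enum_eq_iff {α : Set.powersetCard (Fin n) p} {k : Fin n} :
    (∃ i, enum α i = k) ↔ k ∈ (α : Finset (Fin n)) := by
  have := Set.powersetCard.mem_range_ofFinEmbEquiv_symm_iff_mem α k
  rwa [← Set.powersetCard.mem_coe_iff] at this

theorem multiDeg_eq_sum (α : Set.powersetCard (Fin n) p) :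
    b.multiDeg α = ∑ i, b.deg (enum α i) := by
  refine Eq.trans ?_ (Finset.sum_map Finset.univ (enum α).toEmbedding b.deg)
  unfold multiDeg
  congr 1
  ext i
  simp [← exists_enum_eq_iff]

theorem coord_smul (c : ℝ) (τ : ⋀[ℝ]^p G) (α : Set.powersetCard (Fin n) p) :
    b.coord (c • τ) α = c * b.coord τ α := by
  simp [coord]

theorem ext_coord {τ τ' : ⋀[ℝ]^p G} (h : ∀ α, b.coord τ α = b.coord τ' α) : τ = τ' :=
  (b.X.toBasis.exteriorPower p).ext_elem h

theorem coord_proj (D : ℕ) (τ : ⋀[ℝ]^p G) (α : Set.powersetCard (Fin n) p) :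
    b.coord (b.proj D τ) α = if b.multiDeg α = D then b.coord τ α else 0 := by
  classical
  rw [proj, coord, map_sum, Finsupp.finsetSum_apply]
  simp only [map_smul, Module.Basis.repr_self, Finsupp.smul_single, Finsupp.single_apply,
    smul_eq_mul, mul_one]
  rw [Finset.sum_ite_eq']
  simp

theorem proj_smul (D : ℕ) (c : ℝ) (τ : ⋀[ℝ]^p G) : b.proj D (c • τ) = c • b.proj D τ :=
  b.ext_coord fun α => by simp [coord_proj, coord_smul]

theorem pnorm_smul (c : ℝ) (τ : ⋀[ℝ]^p G) : b.pnorm (c • τ) = |c| * b.pnorm τ := by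
  simp only [pnorm, coord_smul, mul_pow, ← Finset.mul_sum]
  rw [Real.sqrt_mul (sq_nonneg _), Real.sqrt_sq_eq_abs]

theorem pnorm_pos {τ : ⋀[ℝ]^p G} (h : τ ≠ 0) : 0 < b.pnorm τ := by
  refine Real.sqrt_pos.2 (lt_of_le_of_ne (by positivity) fun h0 => h ?_)
  have := (Finset.sum_eq_zero_iff_of_nonneg (fun α _ => sq_nonneg (b.coord τ α))).1 h0.symm
  refine b.ext_coord fun α => ?_
  have h1 := this α (Finset.mem_univ _)
  rw [show b.coord (0 : ⋀[ℝ]^p G) α = 0 by simp [coord]]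
  simpa using h1

/-- The norm of a simple multivector is the square root of its Gram determinant. -/
theorem pnorm_ιMulti (v : Fin p → G) :
    b.pnorm (exteriorPower.ιMulti ℝ p v) =
      Real.sqrt (Matrix.of fun i j => inner ℝ (v i) (v j)).det := by
  -- The pairing of simple multivectors by the determinant of mutual inner products. Expanding only
  -- its first argument in the basis gives the sum of squared coordinates, which is the Cauchy–Binet
  -- identity.
  let B : ⋀[ℝ]^p G →ₗ[ℝ] Module.Dual ℝ (⋀[ℝ]^p G) :=
    exteriorPower.pairingDual ℝ G p ∘ₗ exteriorPower.map p (innerₗ G)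
  have hB : ∀ u w : Fin p → G, B (exteriorPower.ιMulti ℝ p u) (exteriorPower.ιMulti ℝ p w) =
      (Matrix.of fun i j => inner ℝ (u j) (w i)).det := by
    intro u w
    simp [B, exteriorPower.pairingDual_ιMulti_ιMulti, innerₗ_apply_apply]
  have hBX : ∀ (α : Set.powersetCard (Fin n) p) (w : Fin p → G),
      B (b.X.toBasis.exteriorPower p α) (exteriorPower.ιMulti ℝ p w) =
        b.coord (exteriorPower.ιMulti ℝ p w) α := by
    intro α w
    rw [exteriorPower.basis_apply, exteriorPower.ιMulti_family, hB, coord_ιMulti]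
    simp [enum, OrthonormalBasis.repr_apply_apply]
  have hexp : B (exteriorPower.ιMulti ℝ p v) (exteriorPower.ιMulti ℝ p v) =
      ∑ α, b.coord (exteriorPower.ιMulti ℝ p v) α ^ 2 := by
    conv_lhs =>
      enter [1]
      rw [← (b.X.toBasis.exteriorPower p).sum_repr (exteriorPower.ιMulti ℝ p v)]
    rw [map_sum, LinearMap.sum_apply]
    refine Finset.sum_congr rfl fun α _ => ?_
    rw [map_smul, LinearMap.smul_apply, hBX, sq]
    rfl
  rw [pnorm, ← hexp, hB]
  simp_rw [real_inner_comm]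

include b in
theorem ιMulti_sum_smul (A : Matrix (Fin p) (Fin p) ℝ) (v : Fin p → G) :
    exteriorPower.ιMulti ℝ p (fun i => ∑ j, A i j • v j) =
      A.det • exteriorPower.ιMulti ℝ p v := by
  refine b.ext_coord fun α => ?_
  rw [coord_smul, coord_ιMulti, coord_ιMulti, ← Matrix.det_mul]
  congr 1
  ext i j
  simp [Matrix.mul_apply]

end GradedBasis

theorem exists_matrix_of_span_eq {E : Type*} [AddCommGroup E] [Module ℝ E] {p : ℕ}
    {v w : Fin p → E} (hw : LinearIndependent ℝ w) (h : ∀ i, w i ∈ Submodule.span ℝ (range v)) :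
    ∃ A : Matrix (Fin p) (Fin p) ℝ, A.det ≠ 0 ∧ w = fun i => ∑ j, A i j • v j := by
  choose A hA using fun i => (Submodule.mem_span_range_iff_exists_fun ℝ).1 (h i)
  refine ⟨Matrix.of A, fun h0 => ?_, funext fun i => (hA i).symm⟩
  -- A left null vector of the matrix would be a linear relation among the `w i`.
  obtain ⟨c, hc, hc0⟩ := Matrix.exists_vecMul_eq_zero_iff.2 h0
  refine hc (funext fun i => Fintype.linearIndependent_iff.1 hw c ?_ i)
  calc ∑ i, c i • w i = ∑ i, ∑ j, (c i * A i j) • v j :=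
        Finset.sum_congr rfl fun i _ => by rw [← hA i, Finset.smul_sum]; simp [mul_smul]
    _ = ∑ j, (∑ i, c i * A i j) • v j := by
        rw [Finset.sum_comm]; simp [Finset.sum_smul]
    _ = 0 := Finset.sum_eq_zero fun j _ => by
        have := congrFun hc0 j
        simp only [Matrix.vecMul, dotProduct, Matrix.of_apply, Pi.zero_apply] at this
        rw [this, zero_smul]

end Exterior

/-! ### Multi-indices of maximal degree and adapted frames -/

namespace GradedBasis

variable {G : Type*} [NormedAddCommGroup G] [InnerProductSpace ℝ G] [StratifiedGroup G] {n p : ℕ}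
  (b : GradedBasis G n)

theorem multiDeg_le_maxDim (α : Set.powersetCard (Fin n) p) : b.multiDeg α ≤ b.maxDim p :=
  Finset.le_sup (f := fun α => b.multiDeg α) (Finset.mem_univ α)

/-- Exchange argument: replacing an entry of `α` by an index `k` outside `α` cannot increase the
maximal total degree. -/
theorem deg_le_of_multiDeg_eq {α : Set.powersetCard (Fin n) p} (hα : b.multiDeg α = b.maxDim p)
    {k : Fin n} (hk : k ∉ (α : Finset (Fin n))) (i : Fin p) : b.deg k ≤ b.deg (enum α i) := by
  have hi : enum α i ∈ (α : Finset (Fin n)) := exists_enum_eq_iff.1 ⟨i, rfl⟩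
  have hk' : k ∉ (α : Finset (Fin n)).erase (enum α i) := fun h => hk (Finset.mem_of_mem_erase h)
  have hcard : (insert k ((α : Finset (Fin n)).erase (enum α i))).card = p := by
    rw [Finset.card_insert_of_notMem hk', Finset.card_erase_add_one hi]
    exact α.2
  have h1 := b.multiDeg_le_maxDim (⟨_, hcard⟩ : Set.powersetCard (Fin n) p)
  rw [← hα] at h1
  have h2 : b.multiDeg (⟨_, hcard⟩ : Set.powersetCard (Fin n) p) =
      b.deg k + ∑ j ∈ (α : Finset (Fin n)).erase (enum α i), b.deg j := by
    change ∑ j ∈ insert k ((α : Finset (Fin n)).erase (enum α i)), b.deg j = _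
    rw [Finset.sum_insert hk']
  have h3 : b.multiDeg α =
      b.deg (enum α i) + ∑ j ∈ (α : Finset (Fin n)).erase (enum α i), b.deg j :=
    (Finset.add_sum_erase _ _ hi).symm
  omega

/-- A frame whose coordinates of index in `α` form the identity matrix, for a multi-index `α` of
maximal degree. -/
structure IsAdaptedFrame (α : Set.powersetCard (Fin n) p) (w : Fin p → G) : Prop where
  multiDeg_eq : b.multiDeg α = b.maxDim p
  repr_enum : ∀ i j, b.X.repr (w i) (enum α j) = if i = j then 1 else 0

/-- The coordinate of index `α` is the determinant of the block to be normalized, so the recombining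
matrix is the inverse of that block. -/
theorem exists_isAdaptedFrame {α : Set.powersetCard (Fin n) p} (hα : b.multiDeg α = b.maxDim p)
    {u : Fin p → G} (hu : b.coord (exteriorPower.ιMulti ℝ p u) α ≠ 0) :
    ∃ A : Matrix (Fin p) (Fin p) ℝ, A.det ≠ 0 ∧ b.IsAdaptedFrame α fun i => ∑ j, A i j • u j := by
  rw [coord_ιMulti] at hu
  set C : Matrix (Fin p) (Fin p) ℝ := Matrix.of fun i j => b.X.repr (u i) (enum α j) with hC
  have hunit : IsUnit C.det := isUnit_iff_ne_zero.2 hu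
  refine ⟨C⁻¹, (Matrix.isUnit_nonsing_inv_det _ hunit).ne_zero, hα, fun i j => ?_⟩
  have h : (C⁻¹ * C) i j = if i = j then 1 else 0 := by
    rw [Matrix.nonsing_inv_mul _ hunit, Matrix.one_apply]
  simpa [Matrix.mul_apply, hC] using h

/-- The part of `w i` of the degree of the `i`-th entry of `α`. -/
noncomputable def topPart (α : Set.powersetCard (Fin n) p) (w : Fin p → G) (i : Fin p) : G :=
  ∑ k with b.deg k = b.deg (enum α i), b.X.repr (w i) k • b.X k

theorem repr_topPart (α : Set.powersetCard (Fin n) p) (w : Fin p → G) (i : Fin p) (k : Fin n) :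
    b.X.repr (b.topPart α w i) k =
      if b.deg k = b.deg (enum α i) then b.X.repr (w i) k else 0 := by
  rw [topPart, map_sum, WithLp.ofLp_sum, Finset.sum_apply]
  simp [Finset.sum_ite_eq]

theorem topPart_mem_layer (α : Set.powersetCard (Fin n) p) (w : Fin p → G) (i : Fin p) :
    b.topPart α w i ∈ layer (G := G) (b.deg (enum α i)) :=
  b.mem_layer_iff.2 fun k hk => by simp [repr_topPart, hk]

/-- The coordinates of index in `α`. -/
noncomputable def coords (α : Set.powersetCard (Fin n) p) : G →L[ℝ] EuclideanSpace ℝ (Fin p) :=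
  (EuclideanSpace.equiv (Fin p) ℝ).symm.toContinuousLinearMap ∘L
    ContinuousLinearMap.pi fun i => (EuclideanSpace.proj (enum α i)) ∘L
      (b.X.repr.toContinuousLinearEquiv : G →L[ℝ] EuclideanSpace ℝ (Fin n))

@[simp] theorem coords_apply (α : Set.powersetCard (Fin n) p) (x : G) (i : Fin p) :
    b.coords α x i = b.X.repr x (enum α i) := rfl

/-- The linear parametrization of the tangent subspace by its coordinates of index in `α`. -/
noncomputable def linParam (ζ : Fin p → G) : EuclideanSpace ℝ (Fin p) →L[ℝ] G :=
  ∑ i, (EuclideanSpace.proj i).smulRight (ζ i)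

omit [StratifiedGroup G] in
@[simp] theorem linParam_apply (ζ : Fin p → G) (s : EuclideanSpace ℝ (Fin p)) :
    linParam ζ s = ∑ i, s i • ζ i := by
  simp [linParam]

omit [StratifiedGroup G] in
theorem range_linParam (ζ : Fin p → G) :
    range (linParam ζ) = (Submodule.span ℝ (range ζ) : Set G) := by
  ext x
  rw [SetLike.mem_coe, Submodule.mem_span_range_iff_exists_fun]
  constructor
  · rintro ⟨s, rfl⟩
    exact ⟨s, by simp⟩
  · rintro ⟨c, rfl⟩
    exact ⟨WithLp.toLp 2 c, by simp⟩

/-- The dilations of the coordinates of index in `α`. -/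
noncomputable def stretch (α : Set.powersetCard (Fin n) p) (r : ℝ) :
    EuclideanSpace ℝ (Fin p) →L[ℝ] EuclideanSpace ℝ (Fin p) :=
  (EuclideanSpace.equiv (Fin p) ℝ).symm.toContinuousLinearMap ∘L
    ContinuousLinearMap.pi fun i => r ^ b.deg (enum α i) • EuclideanSpace.proj i

@[simp] theorem stretch_apply (α : Set.powersetCard (Fin n) p) (r : ℝ) (s : EuclideanSpace ℝ (Fin p))
    (i : Fin p) : b.stretch α r s i = r ^ b.deg (enum α i) * s i := rfl

theorem coords_dilation [FiniteDimensional ℝ G] (α : Set.powersetCard (Fin n) p) (r : ℝ) (x : G) :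
    b.coords α (dilation r x) = b.stretch α r (b.coords α x) := by
  ext i
  simp [b.repr_dilation]

theorem det_stretch (α : Set.powersetCard (Fin n) p) (r : ℝ) :
    (b.stretch α r).det = r ^ b.multiDeg α := by
  have h : LinearMap.toMatrix (EuclideanSpace.basisFun (Fin p) ℝ).toBasis
      (EuclideanSpace.basisFun (Fin p) ℝ).toBasis (b.stretch α r : _ →ₗ[ℝ] _) =
      Matrix.diagonal fun i => r ^ b.deg (enum α i) := by
    ext i j
    rw [LinearMap.toMatrix_apply]
    simp only [OrthonormalBasis.coe_toBasis, EuclideanSpace.basisFun_apply,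
      OrthonormalBasis.coe_toBasis_repr_apply, EuclideanSpace.basisFun_repr,
      ContinuousLinearMap.coe_coe, stretch_apply]
    by_cases hij : i = j
    · simp [hij]
    · simp [hij]
  rw [ContinuousLinearMap.det, ← LinearMap.det_toMatrix (EuclideanSpace.basisFun (Fin p) ℝ).toBasis, h,
    Matrix.det_diagonal, Finset.prod_pow_eq_pow_sum, b.multiDeg_eq_sum]

/-- Used with `m = 1` for plain convergence to the origin, and with `m = deg k` for `k` outside `α`
to gain the full power needed in that coordinate. -/
theorem norm_stretch_le (α : Set.powersetCard (Fin n) p) {m : ℕ}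
    (hm : ∀ i, m ≤ b.deg (enum α i)) {r : ℝ} (h0 : 0 ≤ r) (h1 : r ≤ 1)
    (s : EuclideanSpace ℝ (Fin p)) : ‖b.stretch α r s‖ ≤ r ^ m * ‖s‖ := by
  refine le_of_sq_le_sq ?_ (by positivity)
  rw [mul_pow, EuclideanSpace.norm_sq_eq, EuclideanSpace.norm_sq_eq, Finset.mul_sum]
  refine Finset.sum_le_sum fun i _ => ?_
  rw [stretch_apply, norm_mul, mul_pow]
  gcongr
  rw [Real.norm_of_nonneg (by positivity)]
  exact pow_le_pow_of_le_one h0 h1 (hm i)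

namespace IsAdaptedFrame

variable {b} {α : Set.powersetCard (Fin n) p} {w : Fin p → G} (h : b.IsAdaptedFrame α w)
include h

theorem repr_topPart_enum (i j : Fin p) :
    b.X.repr (b.topPart α w i) (enum α j) = if i = j then 1 else 0 := by
  rw [repr_topPart, h.repr_enum]
  by_cases hij : i = j <;> simp [hij]

theorem deg_le {k : Fin n} (hk : k ∉ (α : Finset (Fin n))) (i : Fin p) :
    b.deg k ≤ b.deg (enum α i) :=
  b.deg_le_of_multiDeg_eq h.multiDeg_eq hk i

/-- An index of larger degree than an entry of `α` must itself belong to `α`, where the frame has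
the coordinates of the identity matrix. -/
theorem repr_eq_zero_of_deg_lt {i : Fin p} {k : Fin n} (hk : b.deg (enum α i) < b.deg k) :
    b.X.repr (w i) k = 0 := by
  by_cases hkα : k ∈ (α : Finset (Fin n))
  · obtain ⟨j, rfl⟩ := exists_enum_eq_iff.2 hkα
    rw [h.repr_enum, if_neg]
    rintro rfl
    exact lt_irrefl _ hk
  · exact absurd (h.deg_le hkα i) (by omega)

theorem coords_linParam (s : EuclideanSpace ℝ (Fin p)) :
    b.coords α (linParam (b.topPart α w) s) = s := by
  ext j
  rw [coords_apply, linParam_apply, map_sum, WithLp.ofLp_sum, Finset.sum_apply]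
  simp [h.repr_topPart_enum]

theorem coords_linParam_frame (s : EuclideanSpace ℝ (Fin p)) :
    b.coords α (linParam w s) = s := by
  ext j
  rw [coords_apply, linParam_apply, map_sum, WithLp.ofLp_sum, Finset.sum_apply]
  simp [h.repr_enum]

theorem linearIndependent_topPart : LinearIndependent ℝ (b.topPart α w) := by
  rw [Fintype.linearIndependent_iff]
  intro c hc i
  have := h.coords_linParam (WithLp.toLp 2 c)
  rw [linParam_apply, hc, map_zero] at this
  exact (congrArg (fun s : EuclideanSpace ℝ (Fin p) => s i) this).symm

/-- The part of top degree of the simple multivector of an adapted frame is simple. -/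
theorem proj_ιMulti :
    b.proj (b.maxDim p) (exteriorPower.ιMulti ℝ p w) =
      exteriorPower.ιMulti ℝ p (b.topPart α w) := by
  refine b.ext_coord fun β => ?_
  rw [coord_proj]
  have hβ := b.multiDeg_le_maxDim β
  -- The minor of index `β` with each entry weighted by `ε` to the excess of degree. For `ε ≠ 0`,
  -- pulling the powers out of rows and columns gives `ε ^ (D(p) - d(β))` times the minor. The
  -- conditional removes entries with negative excess, where natural subtraction would be wrong;
  -- these vanish anyway.
  let P : ℝ → ℝ := fun ε => (Matrix.of fun i j : Fin p =>
    ε ^ (b.deg (enum α i) - b.deg (enum β j)) *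
      if b.deg (enum β j) ≤ b.deg (enum α i) then b.X.repr (w i) (enum β j) else 0).det
  have hP : Continuous P := by
    refine Continuous.matrix_det (continuous_matrix fun i j => ?_)
    simp only [Matrix.of_apply]
    fun_prop
  have key : P = fun ε => ε ^ (b.maxDim p - b.multiDeg β) *
      b.coord (exteriorPower.ιMulti ℝ p w) β := by
    -- The powers can only be cancelled for `ε ≠ 0`; continuity carries the identity to `ε = 0`.
    refine Continuous.ext_on (dense_compl_singleton (0 : ℝ)) hP (by fun_prop) fun ε hε => ?_
    have hε : ε ≠ 0 := hε
    have h1 : ε ^ b.multiDeg β * P ε =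
        ε ^ b.maxDim p * b.coord (exteriorPower.ιMulti ℝ p w) β := by
      rw [← h.multiDeg_eq, b.multiDeg_eq_sum, b.multiDeg_eq_sum, ← Finset.prod_pow_eq_pow_sum,
        ← Finset.prod_pow_eq_pow_sum, coord_ιMulti, ← Matrix.det_mul_row, ← Matrix.det_mul_column]
      congr 1
      ext i j
      simp only [Matrix.of_apply]
      split_ifs with hij
      · rw [← mul_assoc, ← pow_add, Nat.add_sub_cancel' hij]
      · rw [h.repr_eq_zero_of_deg_lt (not_le.1 hij)]
        simp
    have h2 : ε ^ b.maxDim p = ε ^ b.multiDeg β * ε ^ (b.maxDim p - b.multiDeg β) := by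
      rw [← pow_add, Nat.add_sub_cancel' hβ]
    rw [h2, mul_assoc] at h1
    exact mul_left_cancel₀ (pow_ne_zero _ hε) h1
  -- At `ε = 0` only the entries of equal degree remain, and these are the coordinates of the top
  -- parts.
  have h0 : P 0 = b.coord (exteriorPower.ιMulti ℝ p (b.topPart α w)) β := by
    rw [coord_ιMulti]
    simp only [P]
    congr 1
    ext i j
    simp only [Matrix.of_apply, repr_topPart]
    rcases lt_trichotomy (b.deg (enum β j)) (b.deg (enum α i)) with hij | hij | hij
    · simp [hij.ne, show b.deg (enum α i) - b.deg (enum β j) ≠ 0 by omega]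
    · simp [hij]
    · simp [hij.ne', hij.not_ge]
  rw [← h0, key]
  split_ifs with hd
  · simp [hd]
  · simp [show b.maxDim p - b.multiDeg β ≠ 0 by omega]

theorem finrank_span : Module.finrank ℝ (Submodule.span ℝ (range (b.topPart α w))) = p := by
  simpa using finrank_span_eq_card h.linearIndependent_topPart

/-- Above some degree present in `α`, all indices belong to `α`, so the identity block leaves a
single basis vector. -/
theorem topPart_eq_of_lt {i i₀ : Fin p} (hi : b.deg (enum α i₀) < b.deg (enum α i)) :
    b.topPart α w i = b.X (enum α i) := by
  refine b.ext_repr fun k => ?_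
  by_cases hk : k ∈ (α : Finset (Fin n))
  · obtain ⟨j, rfl⟩ := exists_enum_eq_iff.2 hk
    rw [h.repr_topPart_enum]
    simp [(enum α).injective.eq_iff, eq_comm]
  · have hne : k ≠ enum α i := fun hh => hk (exists_enum_eq_iff.1 ⟨i, hh.symm⟩)
    have := h.deg_le hk i₀
    rw [repr_topPart, if_neg (by omega)]
    simp [hne]

theorem layer_le_span {i₀ : Fin p} {j : ℕ} (hj : b.deg (enum α i₀) < j) :
    layer (G := G) j ≤ Submodule.span ℝ (b.topPart α w '' {i | b.deg (enum α i₀) < b.deg (enum α i)}) := by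
  intro y hy
  rw [← b.X.sum_repr y]
  refine Submodule.sum_mem _ fun k _ => ?_
  by_cases hk : b.deg k = j
  · have hkα : k ∈ (α : Finset (Fin n)) := by
      by_contra hn
      have := h.deg_le hn i₀
      omega
    obtain ⟨i, rfl⟩ := exists_enum_eq_iff.2 hkα
    rw [← h.topPart_eq_of_lt (i := i) (i₀ := i₀) (by omega)]
    exact Submodule.smul_mem _ _ (Submodule.subset_span ⟨i, by simp only [mem_ofPred_eq]; omega, rfl⟩)
  · simp [b.repr_eq_zero_of_mem_layer hy hk]

/-- `Z` is spanned by the top parts of lowest degree; the remaining top parts lie in the higher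
layers, which are contained in the span. -/
theorem exists_layer_decomposition (hp : 1 ≤ p) :
    ∃ (l : ℕ) (Z : Submodule ℝ G), Z ≤ layer (G := G) l ∧ Z ≠ ⊥ ∧
      Submodule.span ℝ (range (b.topPart α w)) = Z ⊔ ⨆ j > l, layer (G := G) j := by
  -- The enumeration of `α` and the degrees are both monotone, so entry `0` has the lowest degree.
  let i₀ : Fin p := ⟨0, hp⟩
  have hmin : ∀ i, b.deg (enum α i₀) ≤ b.deg (enum α i) := fun i =>
    b.deg_mono ((enum α).monotone (Fin.le_def.2 (Nat.zero_le _)))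
  refine ⟨b.deg (enum α i₀),
    Submodule.span ℝ (b.topPart α w '' {i | b.deg (enum α i) = b.deg (enum α i₀)}), ?_, ?_, ?_⟩
  · rw [Submodule.span_le]
    rintro _ ⟨i, hi, rfl⟩
    have := b.topPart_mem_layer α w i
    rwa [show b.deg (enum α i) = _ from hi] at this
  · rw [Submodule.ne_bot_iff]
    exact ⟨b.topPart α w i₀, Submodule.subset_span ⟨i₀, rfl, rfl⟩,
      h.linearIndependent_topPart.ne_zero i₀⟩
  · refine le_antisymm ?_ (sup_le (Submodule.span_mono (image_subset_range _ _)) ?_)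
    · rw [Submodule.span_le]
      rintro _ ⟨i, rfl⟩
      rcases (hmin i).eq_or_lt with hi | hi
      · exact Submodule.mem_sup_left (Submodule.subset_span ⟨i, hi.symm, rfl⟩)
      · refine Submodule.mem_sup_right ?_
        exact Submodule.mem_iSup_of_mem _ (Submodule.mem_iSup_of_mem hi (b.topPart_mem_layer α w i))
    · exact iSup₂_le fun j hj =>
        (h.layer_le_span hj).trans (Submodule.span_mono (image_subset_range _ _))

/-- Bracketing with a basis vector strictly raises the degree of a homogeneous top part, and layers
above the degree of an entry of `α` lie in the span. -/
theorem lie_mem_span (x : G) {y : G} (hy : y ∈ Submodule.span ℝ (range (b.topPart α w))) :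
    lie x y ∈ Submodule.span ℝ (range (b.topPart α w)) := by
  induction hy using Submodule.span_induction with
  | zero => simp
  | add u v _ _ hu hv => simpa using Submodule.add_mem _ hu hv
  | smul c u _ hu => simpa using Submodule.smul_mem _ c hu
  | mem u hu =>
    obtain ⟨i, rfl⟩ := hu
    rw [← b.X.sum_repr x, map_sum, LinearMap.sum_apply]
    refine Submodule.sum_mem _ fun k _ => ?_
    rw [map_smul, LinearMap.smul_apply]
    refine Submodule.smul_mem _ _ (Submodule.span_mono (image_subset_range _ _)
      (h.layer_le_span (i₀ := i) ?_ (lie_mem_layer (b.mem_layer k) (b.topPart_mem_layer α w i))))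
    have := b.deg_pos k
    omega

omit h in
theorem dilation_linParam [FiniteDimensional ℝ G] (r : ℝ) (s : EuclideanSpace ℝ (Fin p)) :
    dilation r (linParam (b.topPart α w) s) = linParam (b.topPart α w) (b.stretch α r s) := by
  rw [← dilationLM_apply, linParam_apply, linParam_apply, map_sum]
  refine Finset.sum_congr rfl fun i _ => ?_
  rw [map_smul, dilationLM_apply, dilation_of_mem_layer b r (b.topPart_mem_layer α w i), smul_smul,
    stretch_apply, mul_comm]

end IsAdaptedFrame

end GradedBasis

/-! ### Riemannian metrics and Gram determinants -/

section Riemannian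

variable {G : Type*} [NormedAddCommGroup G] [NormedSpace ℝ G] (gt : SmoothRiemannianMetric G)

open scoped Bundle in
theorem continuousOn_metric_inner {H : Type*} [TopologicalSpace H] {f v w : H → G} {s : Set H}
    (hf : ContinuousOn f s) (hv : ContinuousOn v s) (hw : ContinuousOn w s) :
    ContinuousOn (fun t => (gt.inner (f t) (v t) (w t) : ℝ)) s := by
  -- The metric is installed as a continuous Riemannian bundle structure, and the tangent bundle of
  -- a vector space is identified with a product, so that continuity of bundle inner products
  -- applies.
  let : Bundle.RiemannianBundle (fun x : G => TangentSpace 𝓘(ℝ, G) x) := ⟨gt.toRiemannianMetric⟩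
  have : IsContinuousRiemannianBundle G (fun x : G => TangentSpace 𝓘(ℝ, G) x) :=
    ⟨gt.inner, gt.contMDiff.continuous, fun _ _ _ => rfl⟩
  have key : ∀ {u : H → G}, ContinuousOn u s → ContinuousOn (fun t =>
      (⟨f t, u t⟩ : Bundle.TotalSpace G (fun x : G => TangentSpace 𝓘(ℝ, G) x))) s := fun hu =>
    (tangentBundleModelSpaceHomeomorph 𝓘(ℝ, G)).symm.continuous.comp_continuousOn (hf.prodMk hu)
  exact ContinuousOn.inner_bundle (F := G) (E := fun x : G => TangentSpace 𝓘(ℝ, G) x)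
    (key hv) (key hw)

theorem continuousOn_riemNorm {H : Type*} [TopologicalSpace H] {p : ℕ} {f : H → G}
    {v : H → Fin p → G} {s : Set H} (hf : ContinuousOn f s)
    (hv : ∀ i, ContinuousOn (fun t => v t i) s) :
    ContinuousOn (fun t => riemNorm gt (f t) (v t)) s := by
  unfold riemNorm
  refine Real.continuous_sqrt.comp_continuousOn ?_
  have hM : ContinuousOn (fun t => Matrix.of fun i j : Fin p =>
      (gt.inner (f t) (v t i) (v t j) : ℝ)) s :=
    continuousOn_pi.2 fun i => continuousOn_pi.2 fun j =>
      continuousOn_metric_inner gt hf (hv i) (hv j)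
  exact (continuous_id.matrix_det).comp_continuousOn hM

/-- The Gram matrix changes by the congruence `A Γ Aᵀ`. -/
theorem riemNorm_sum_smul (x : G) {p : ℕ} (A : Matrix (Fin p) (Fin p) ℝ) (v : Fin p → G) :
    riemNorm gt x (fun i => ∑ j, A i j • v j) = |A.det| * riemNorm gt x v := by
  let g : G →L[ℝ] G →L[ℝ] ℝ := gt.inner x
  have h : (Matrix.of fun i j : Fin p => g (∑ k, A i k • v k) (∑ k, A j k • v k)) =
      A * (Matrix.of fun i j : Fin p => g (v i) (v j)) * A.transpose := by
    ext i j
    simp only [Matrix.of_apply, map_sum, map_smul, Matrix.mul_apply, Matrix.transpose_apply,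
      sum_apply, smul_apply, smul_eq_mul, Finset.sum_mul, Finset.mul_sum]
    exact Finset.sum_congr rfl fun k _ => Finset.sum_congr rfl fun l _ => by ring
  change Real.sqrt (Matrix.of fun i j : Fin p => g (∑ k, A i k • v k) (∑ k, A j k • v k)).det =
    |A.det| * Real.sqrt (Matrix.of fun i j : Fin p => g (v i) (v j)).det
  rw [h, Matrix.det_mul, Matrix.det_mul, Matrix.det_transpose, mul_right_comm, ← sq,
    Real.sqrt_mul (sq_nonneg _), Real.sqrt_sq_eq_abs]

theorem riemNorm_pos (x : G) {p : ℕ} {v : Fin p → G} (hv : LinearIndependent ℝ v) :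
    0 < riemNorm gt x v := by
  let g : G →L[ℝ] G →L[ℝ] ℝ := gt.inner x
  have hsymm : ∀ u w : G, g u w = g w u := gt.symm x
  have hpos : ∀ u : G, u ≠ 0 → 0 < g u u := gt.pos x
  refine Real.sqrt_pos.2 (Matrix.PosDef.det_pos ?_)
  change (Matrix.of fun i j : Fin p => g (v i) (v j)).PosDef
  refine Matrix.PosDef.of_dotProduct_mulVec_pos ?_ fun c hc => ?_
  · ext i j
    simp [hsymm (v i)]
  · have h0 : ∑ i, c i • v i ≠ 0 := fun h =>
      hc (funext fun i => Fintype.linearIndependent_iff.1 hv c h i)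
    refine (hpos _ h0).trans_eq ?_
    simp only [map_sum, map_smul, sum_apply, smul_apply, smul_eq_mul, dotProduct, Matrix.mulVec,
      Matrix.of_apply, Pi.star_apply, star_trivial, Finset.mul_sum]
    rw [Finset.sum_comm]
    exact Finset.sum_congr rfl fun k _ => Finset.sum_congr rfl fun l _ => by ring

end Riemannian

/-! ### Local parametrizations -/

namespace IsC1Param

variable {G : Type*} [NormedAddCommGroup G] [NormedSpace ℝ G] {p : ℕ} {M : Set G}
  {A : Set (EuclideanSpace ℝ (Fin p))} {Φ : EuclideanSpace ℝ (Fin p) → G}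
  {t₀ : EuclideanSpace ℝ (Fin p)}

section

variable (h : IsC1Param M A Φ)
include h

theorem contDiffAt (ht : t₀ ∈ A) : ContDiffAt ℝ 1 Φ t₀ :=
  h.contDiffOn.contDiffAt (h.isOpen.mem_nhds ht)

theorem hasStrictFDerivAt (ht : t₀ ∈ A) : HasStrictFDerivAt Φ (fderiv ℝ Φ t₀) t₀ :=
  (h.contDiffAt ht).hasStrictFDerivAt one_ne_zero

theorem hasFDerivAt (ht : t₀ ∈ A) : HasFDerivAt Φ (fderiv ℝ Φ t₀) t₀ :=
  (h.hasStrictFDerivAt ht).hasFDerivAt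

theorem continuousOn : ContinuousOn Φ A := h.contDiffOn.continuousOn

theorem injOn : InjOn Φ A := injOn_iff_injective.2 h.isEmbedding.injective

theorem continuousOn_fderiv : ContinuousOn (fderiv ℝ Φ) A :=
  h.contDiffOn.continuousOn_fderiv_of_isOpen h.isOpen le_rfl

theorem exists_image_eq {O : Set (EuclideanSpace ℝ (Fin p))} (hO : IsOpen O) (hOA : O ⊆ A) :
    ∃ U : Set G, IsOpen U ∧ Φ '' O = M ∩ U := by
  obtain ⟨U, hU, hUA⟩ := h.image_eq
  obtain ⟨V, hV, hVO⟩ := h.isEmbedding.isOpen_iff.1 (hO.preimage (continuous_subtype_val (p := (· ∈ A))))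
  refine ⟨U ∩ V, hU.inter hV, ?_⟩
  have hV' : ∀ t ∈ A, Φ t ∈ V ↔ t ∈ O := fun t ht => by
    have := congrArg (fun S : Set A => (⟨t, ht⟩ : A) ∈ S) hVO
    simpa using this
  rw [← inter_assoc, ← hUA]
  ext y
  constructor
  · rintro ⟨t, ht, rfl⟩
    exact ⟨⟨t, hOA ht, rfl⟩, (hV' t (hOA ht)).2 ht⟩
  · rintro ⟨⟨t, ht, rfl⟩, hy⟩
    exact ⟨t, (hV' t ht).1 hy, rfl⟩

/-- Points of the submanifold close to `Φ t₀` have parameters close to `t₀`. -/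
theorem tendsto_of_tendsto {ι : Type*} {l : Filter ι} {t : ι → EuclideanSpace ℝ (Fin p)}
    (ht₀ : t₀ ∈ A) (ht : ∀ i, t i ∈ A) (hl : Tendsto (fun i => Φ (t i)) l (𝓝 (Φ t₀))) :
    Tendsto t l (𝓝 t₀) := by
  have := (h.isEmbedding.tendsto_nhds_iff (f := fun i => (⟨t i, ht i⟩ : A)) (y := ⟨t₀, ht₀⟩)).2 hl
  exact (continuous_subtype_val.tendsto _).comp this

/-- Composition with a local diffeomorphism of the parameter space. -/
theorem comp_symm (e : OpenPartialHomeomorph (EuclideanSpace ℝ (Fin p)) (EuclideanSpace ℝ (Fin p)))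
    (he : e.source ⊆ A) (hsymm : ContDiffOn ℝ 1 e.symm e.target)
    (hd : ∀ t ∈ e.source, DifferentiableAt ℝ e t) : IsC1Param M e.target (Φ ∘ e.symm) := by
  have hmaps : MapsTo e.symm e.target A := fun s hs => he (e.map_target hs)
  refine ⟨e.open_target, h.contDiffOn.comp hsymm hmaps, fun s hs => ?_, ?_, ?_⟩
  · have h1 : HasFDerivAt e.symm (fderiv ℝ e.symm s) s :=
      ((hsymm.contDiffAt (e.open_target.mem_nhds hs)).differentiableAt one_ne_zero).hasFDerivAt
    have h2 : HasFDerivAt e (fderiv ℝ e (e.symm s)) (e.symm s) :=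
      (hd _ (e.map_target hs)).hasFDerivAt
    have h3 : HasFDerivAt (e ∘ e.symm) (ContinuousLinearMap.id ℝ _) s :=
      (hasFDerivAt_id s).congr_of_eventuallyEq
        (Filter.eventually_of_mem (e.open_target.mem_nhds hs) fun u hu => e.right_inv hu)
    have h4 := (h2.comp s h1).unique h3
    rw [((h.hasFDerivAt (hmaps hs)).comp s h1).fderiv, ContinuousLinearMap.coe_comp]
    refine (h.immersion _ (hmaps hs)).comp ?_
    exact Function.LeftInverse.injective (g := fderiv ℝ e (e.symm s)) fun u =>
      congrArg (fun L : _ →L[ℝ] _ => L u) h4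
  · have h1 : Topology.IsEmbedding (e.target.domRestrict e.symm) := by
      have := (e.toHomeomorphSourceTarget.symm.isEmbedding)
      exact (Topology.IsEmbedding.subtypeVal.comp this)
    have h2 : Topology.IsEmbedding (hmaps.restrict e.symm e.target A) :=
      Topology.IsEmbedding.of_comp
        ((continuousOn_iff_continuous_domRestrict.1 e.continuousOn_symm).subtype_mk _)
        continuous_subtype_val h1
    exact h.isEmbedding.comp h2
  · obtain ⟨U, hU, hUe⟩ := h.exists_image_eq e.open_source he
    refine ⟨U, hU, ?_⟩
    rw [image_comp, e.symm_image_target_eq_source, hUe]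

end

/-- The tangent cone of a submanifold is the image of the differential of a parametrization. -/
theorem tangentCone_eq (h : IsC1Param M A Φ) (hp : 1 ≤ p) (ht : t₀ ∈ A) :
    tangentCone M (Φ t₀) = range (fderiv ℝ Φ t₀) := by
  have hd := h.hasFDerivAt ht
  obtain ⟨K, hK0, hK⟩ := (fderiv ℝ Φ t₀).exists_antilipschitzWith
    (LinearMap.ker_eq_bot.2 (h.immersion t₀ ht))
  ext w
  constructor
  · rintro ⟨c, v, u, hc, rfl, huM, hux, huv⟩
    have hclosed : IsClosed (range (fderiv ℝ Φ t₀)) :=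
      (LinearMap.range (fderiv ℝ Φ t₀).toLinearMap).closed_of_finiteDimensional
    suffices hv : v ∈ range (fderiv ℝ Φ t₀) by
      obtain ⟨a, rfl⟩ := hv
      exact ⟨c • a, by simp⟩
    obtain ⟨U, hU, hUA⟩ := h.image_eq
    have hxU : Φ t₀ ∈ U := by
      have : Φ t₀ ∈ M ∩ U := hUA ▸ mem_image_of_mem Φ ht
      exact this.2
    -- Points of `M` near `Φ t₀` have parameters. After dropping `N` terms, the whole sequence is
    -- parametrized.
    have hev : ∀ᶠ i in atTop, ∃ t ∈ A, Φ t = u i := by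
      filter_upwards [hux (hU.mem_nhds hxU)] with i hi
      have : u i ∈ Φ '' A := hUA ▸ ⟨(huM i).1, hi⟩
      exact this
    obtain ⟨N, hN⟩ := eventually_atTop.1 hev
    choose t htA htu using fun i => hN (i + N) (by omega)
    have hux' : Tendsto (fun i => Φ (t i)) atTop (𝓝 (Φ t₀)) := by
      simp only [htu]
      exact hux.comp (tendsto_add_atTop_nat N)
    have htt : Tendsto t atTop (𝓝 t₀) := h.tendsto_of_tendsto ht htA hux'
    have huv' : Tendsto (fun i => ‖Φ (t i) - Φ t₀‖⁻¹ • (Φ (t i) - Φ t₀)) atTop (𝓝 v) := by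
      simp only [htu]
      exact huv.comp (tendsto_add_atTop_nat N)
    -- The injective differential is bounded below, so the first order error is also negligible with
    -- respect to the secant `Φ (t i) - Φ t₀`. Normalized secants thus have the same limit as
    -- vectors in the range of the differential.
    have hlo : (fun i => Φ (t i) - Φ t₀ - fderiv ℝ Φ t₀ (t i - t₀)) =o[atTop]
        fun i => Φ (t i) - Φ t₀ := by
      have h1 := hd.isLittleO.comp_tendsto htt
      have h2 : (fun s => s - t₀) =O[𝓝 t₀] fun s => fderiv ℝ Φ t₀ (s - t₀) :=
        Asymptotics.isBigO_iff.2 ⟨K, Eventually.of_forall fun s => by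
          simpa [dist_eq_norm] using hK.le_mul_dist s t₀⟩
      have h3 : Asymptotics.IsEquivalent (𝓝 t₀) (fun s => Φ s - Φ t₀)
          fun s => fderiv ℝ Φ t₀ (s - t₀) := hd.isLittleO.trans_isBigO h2
      exact h1.trans_isBigO ((h2.trans h3.isBigO_symm).comp_tendsto htt)
    have h3 : Tendsto (fun i => ‖Φ (t i) - Φ t₀‖⁻¹ •
        (Φ (t i) - Φ t₀ - fderiv ℝ Φ t₀ (t i - t₀))) atTop (𝓝 0) := by
      have h4 := hlo.norm_norm.tendsto_div_nhds_zero
      refine tendsto_zero_iff_norm_tendsto_zero.2 (h4.congr fun i => ?_)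
      rw [norm_smul, norm_inv, norm_norm, div_eq_inv_mul]
    have h5 := huv'.sub h3
    rw [sub_zero] at h5
    refine hclosed.mem_of_tendsto h5 (Eventually.of_forall fun i => ?_)
    refine ⟨‖Φ (t i) - Φ t₀‖⁻¹ • (t i - t₀), ?_⟩
    rw [map_smul, ← smul_sub, sub_sub_cancel]
  · rintro ⟨a, rfl⟩
    -- A nonzero direction is reached along the curve `s ↦ Φ (t₀ + s • a)` with `s` decreasing to
    -- zero.
    have main : ∀ a : EuclideanSpace ℝ (Fin p), a ≠ 0 → ∃ u : ℕ → G, (∀ i, u i ∈ M ∧ u i ≠ Φ t₀) ∧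
        Tendsto u atTop (𝓝 (Φ t₀)) ∧ Tendsto (fun i => ‖u i - Φ t₀‖⁻¹ • (u i - Φ t₀)) atTop
          (𝓝 (‖fderiv ℝ Φ t₀ a‖⁻¹ • fderiv ℝ Φ t₀ a)) := by
      intro a ha
      have hLa : fderiv ℝ Φ t₀ a ≠ 0 := fun h0 =>
        ha (h.immersion t₀ ht (by rw [h0, map_zero]))
      have hcurve : HasDerivAt (fun s : ℝ => Φ (t₀ + s • a)) (fderiv ℝ Φ t₀ a) 0 := by
        have h1 : HasDerivAt (fun s : ℝ => t₀ + s • a) a 0 := by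
          simpa using ((hasDerivAt_id (0 : ℝ)).smul_const a).const_add t₀
        have h2 : HasFDerivAt Φ (fderiv ℝ Φ t₀) (t₀ + (0 : ℝ) • a) := by simpa using hd
        exact h2.comp_hasDerivAt 0 h1
      have hslope : Tendsto (fun s : ℝ => s⁻¹ • (Φ (t₀ + s • a) - Φ t₀)) (𝓝[>] 0)
          (𝓝 (fderiv ℝ Φ t₀ a)) := by
        have h1 := (hasDerivAt_iff_tendsto_slope.1 hcurve).mono_left
          (nhdsWithin_mono 0 (fun s (hs : 0 < s) => hs.ne'))
        refine h1.congr fun s => ?_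
        simp [slope]
      have hA : ∀ᶠ s : ℝ in 𝓝[>] 0, t₀ + s • a ∈ A := by
        have hc : Tendsto (fun s : ℝ => t₀ + s • a) (𝓝[>] 0) (𝓝 t₀) := by
          have : Continuous fun s : ℝ => t₀ + s • a := by fun_prop
          simpa using (this.tendsto 0).mono_left nhdsWithin_le_nhds
        exact hc (h.isOpen.mem_nhds ht)
      have hseq : Tendsto (fun i : ℕ => 1 / ((i : ℝ) + 1)) atTop (𝓝[>] 0) :=
        tendsto_nhdsWithin_iff.2 ⟨tendsto_one_div_add_atTop_nhds_zero_nat,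
          Eventually.of_forall fun i => by simp only [mem_Ioi]; positivity⟩
      obtain ⟨N, hN⟩ := eventually_atTop.1 (hseq.eventually hA)
      have hseq' := hseq.comp (tendsto_add_atTop_nat N)
      set s : ℕ → ℝ := (fun i : ℕ => 1 / ((i : ℝ) + 1)) ∘ (fun i => i + N) with hs
      have hspos : ∀ i, 0 < s i := fun i => by simp only [hs, Function.comp]; positivity
      have hsA : ∀ i, t₀ + s i • a ∈ A := fun i => hN (i + N) (by omega)
      obtain ⟨U, hU, hUA⟩ := h.image_eq
      refine ⟨fun i => Φ (t₀ + s i • a), fun i => ⟨?_, ?_⟩, ?_, ?_⟩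
      · have : Φ (t₀ + s i • a) ∈ M ∩ U := hUA ▸ mem_image_of_mem Φ (hsA i)
        exact this.1
      · intro heq
        have := h.injOn (hsA i) ht heq
        simp [ha, (hspos i).ne'] at this
      · have h1 := hcurve.continuousAt.tendsto.comp (tendsto_nhdsWithin_iff.1 hseq').1
        simpa [Function.comp_def] using h1
      · have h1 := hslope.comp hseq'
        have h2 := (h1.norm.inv₀ (norm_ne_zero_iff.2 hLa)).smul h1
        refine h2.congr fun i => ?_
        simp only [Function.comp_apply]
        rw [norm_smul, norm_inv, Real.norm_of_nonneg (hspos i).le, mul_inv, inv_inv, smul_smul,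
          mul_right_comm, mul_inv_cancel₀ (hspos i).ne', one_mul]
    -- The zero vector needs factor `0` and any admissible sequence; one exists because `p ≥ 1`.
    by_cases ha : a = 0
    · obtain ⟨u, h1, h2, h3⟩ := main (EuclideanSpace.single ⟨0, hp⟩ 1) (by simp)
      exact ⟨0, _, u, le_rfl, by simp [ha], h1, h2, h3⟩
    · obtain ⟨u, h1, h2, h3⟩ := main a ha
      refine ⟨‖fderiv ℝ Φ t₀ a‖, _, u, norm_nonneg _, ?_, h1, h2, h3⟩
      have hLa : fderiv ℝ Φ t₀ a ≠ 0 := fun h0 =>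
        ha (h.immersion t₀ ht (by rw [h0, map_zero]))
      rw [smul_smul, mul_inv_cancel₀ (norm_ne_zero_iff.2 hLa), one_smul]

end IsC1Param

/-! ### The surface measure in one parametrization -/

namespace IsC1Param

variable {G : Type*} [NormedAddCommGroup G] [NormedSpace ℝ G] {p : ℕ} {M : Set G}
  {A : Set (EuclideanSpace ℝ (Fin p))} {Φ : EuclideanSpace ℝ (Fin p) → G}

/-- The density of the surface measure. -/
noncomputable def _root_.surfaceDensity (gt : SmoothRiemannianMetric G)
    (Φ : EuclideanSpace ℝ (Fin p) → G) (t : EuclideanSpace ℝ (Fin p)) : ℝ :=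
  riemNorm gt (Φ t) fun i => fderiv ℝ Φ t (EuclideanSpace.single i 1)

theorem continuousOn_surfaceDensity (h : IsC1Param M A Φ) (gt : SmoothRiemannianMetric G) :
    ContinuousOn (surfaceDensity gt Φ) A :=
  continuousOn_riemNorm gt h.continuousOn fun _ => h.continuousOn_fderiv.clm_apply continuousOn_const

variable [MeasurableSpace G] [BorelSpace G]

theorem measurableSet_inter_preimage (h : IsC1Param M A Φ) {S : Set G} (hS : MeasurableSet S) :
    MeasurableSet (A ∩ Φ ⁻¹' S) := by
  have h1 : Measurable (A.domRestrict Φ) := h.isEmbedding.continuous.measurable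
  have h2 := h.isOpen.measurableSet.subtype_image (h1 hS)
  convert h2 using 1
  ext t
  simp [and_comm]

theorem paramMeasure_apply (h : IsC1Param M A Φ) (gt : SmoothRiemannianMetric G) {S : Set G}
    (hS : MeasurableSet S) :
    paramMeasure gt A Φ S = ∫⁻ t in A ∩ Φ ⁻¹' S, ENNReal.ofReal (surfaceDensity gt Φ t) := by
  have hA := h.isOpen.measurableSet
  have hmeas : AEMeasurable Φ (volume.restrict A) := h.continuousOn.aemeasurable hA
  have hmeas' : AEMeasurable Φ ((volume.restrict A).withDensity fun t => ENNReal.ofReal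
      (riemNorm gt (Φ t) fun i => fderiv ℝ Φ t (EuclideanSpace.single i 1))) :=
    hmeas.mono_ac (withDensity_absolutelyContinuous _ _)
  rw [paramMeasure, Measure.map_apply_of_aemeasurable hmeas' hS, withDensity_apply',
    Measure.restrict_restrict' hA, inter_comm]
  rfl

variable {A₀ : Set (EuclideanSpace ℝ (Fin p))} {Φ₀ : EuclideanSpace ℝ (Fin p) → G}

omit [MeasurableSpace G] [BorelSpace G] in
/-- Two parametrizations differ by a local diffeomorphism. -/
theorem exists_transition [FiniteDimensional ℝ G] (h : IsC1Param M A Φ) (h₀ : IsC1Param M A₀ Φ₀)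
    {U : Set G} (hU : IsOpen U) (hUA : Φ₀ '' A₀ = M ∩ U) :
    ∃ (φ : EuclideanSpace ℝ (Fin p) → EuclideanSpace ℝ (Fin p))
      (φ' : EuclideanSpace ℝ (Fin p) → EuclideanSpace ℝ (Fin p) →L[ℝ] EuclideanSpace ℝ (Fin p)),
      ∀ t ∈ A ∩ Φ ⁻¹' U, φ t ∈ A₀ ∧ Φ₀ (φ t) = Φ t ∧ HasFDerivAt φ (φ' t) t ∧
        fderiv ℝ Φ t = (fderiv ℝ Φ₀ (φ t)).comp (φ' t) := by
  obtain ⟨V, -, hVA⟩ := h.image_eq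
  have hmem : ∀ t ∈ A ∩ Φ ⁻¹' U, ∃ s ∈ A₀, Φ₀ s = Φ t := fun t ht => by
    have h1 : Φ t ∈ M ∩ V := hVA ▸ mem_image_of_mem Φ ht.1
    have h2 : Φ t ∈ Φ₀ '' A₀ := hUA ▸ ⟨h1.1, ht.2⟩
    exact h2
  classical
  let φ : EuclideanSpace ℝ (Fin p) → EuclideanSpace ℝ (Fin p) := fun t =>
    if ht : t ∈ A ∩ Φ ⁻¹' U then (hmem t ht).choose else 0
  have hφ : ∀ t ∈ A ∩ Φ ⁻¹' U, φ t ∈ A₀ ∧ Φ₀ (φ t) = Φ t := fun t ht => by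
    simp only [φ, dif_pos ht]
    exact (hmem t ht).choose_spec
  have hO : IsOpen (A ∩ Φ ⁻¹' U) := h.continuousOn.isOpen_inter_preimage h.isOpen hU
  have hcont : ContinuousOn φ (A ∩ Φ ⁻¹' U) := by
    rw [continuousOn_iff_continuous_domRestrict, continuous_iff_continuousAt]
    intro t
    refine h₀.tendsto_of_tendsto (hφ t t.2).1 (fun s => (hφ s s.2).1) ?_
    have h1 : Continuous ((A ∩ Φ ⁻¹' U).domRestrict Φ) :=
      continuousOn_iff_continuous_domRestrict.1 (h.continuousOn.mono inter_subset_left)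
    refine (h1.tendsto t).congr' ?_ |>.trans_eq ?_
    · exact Eventually.of_forall fun s => ((hφ s s.2).2).symm
    · exact congrArg 𝓝 (hφ t t.2).2.symm
  have hderiv : ∀ t ∈ A ∩ Φ ⁻¹' U, DifferentiableAt ℝ φ t := by
    intro t ht
    -- Composing `Φ₀` with a left inverse of its differential reduces to equal dimensions, where the
    -- inverse function theorem applies.
    obtain ⟨q, hq⟩ := LinearMap.exists_leftInverse_of_injective (fderiv ℝ Φ₀ (φ t)).toLinearMap
      (LinearMap.ker_eq_bot.2 (h₀.immersion _ (hφ t ht).1))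
    let Q : G →L[ℝ] EuclideanSpace ℝ (Fin p) := q.toContinuousLinearMap
    have hQ : Q.comp (fderiv ℝ Φ₀ (φ t)) =
        (ContinuousLinearEquiv.refl ℝ (EuclideanSpace ℝ (Fin p)) :
          EuclideanSpace ℝ (Fin p) →L[ℝ] EuclideanSpace ℝ (Fin p)) := by
      refine ContinuousLinearMap.ext fun u => ?_
      exact congrArg (fun L : _ →ₗ[ℝ] _ => L u) hq
    have hs : HasStrictFDerivAt (fun s => Q (Φ₀ s))
        (ContinuousLinearEquiv.refl ℝ (EuclideanSpace ℝ (Fin p)) :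
          EuclideanSpace ℝ (Fin p) →L[ℝ] EuclideanSpace ℝ (Fin p)) (φ t) := by
      rw [← hQ]
      exact Q.hasStrictFDerivAt.comp _ (h₀.hasStrictFDerivAt (hφ t ht).1)
    have hinv := hs.eventually_left_inverse
    have hct : ContinuousAt φ t := hcont.continuousAt (hO.mem_nhds ht)
    -- By continuity `φ` stays in the domain of the local inverse, so it agrees near `t` with that
    -- inverse composed with `Q ∘ Φ`, which is differentiable.
    have heq : φ =ᶠ[𝓝 t] fun s =>
        HasStrictFDerivAt.localInverse (fun s => Q (Φ₀ s)) _ (φ t) hs (Q (Φ s)) := by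
      filter_upwards [hct.eventually hinv, hO.mem_nhds ht] with s hs1 hs2
      rw [← (hφ s hs2).2]
      exact hs1.symm
    have hd1 : DifferentiableAt ℝ
        (HasStrictFDerivAt.localInverse (fun s => Q (Φ₀ s)) _ (φ t) hs) (Q (Φ t)) := by
      rw [← (hφ t ht).2]
      exact hs.to_localInverse.hasFDerivAt.differentiableAt
    refine DifferentiableAt.congr_of_eventuallyEq ?_ heq
    exact hd1.comp t (Q.differentiableAt.comp t (h.hasFDerivAt ht.1).differentiableAt)
  refine ⟨φ, fderiv ℝ φ, fun t ht => ⟨(hφ t ht).1, (hφ t ht).2, (hderiv t ht).hasFDerivAt, ?_⟩⟩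
  have h1 : HasFDerivAt (Φ₀ ∘ φ) ((fderiv ℝ Φ₀ (φ t)).comp (fderiv ℝ φ t)) t :=
    (h₀.hasFDerivAt (hφ t ht).1).comp t (hderiv t ht).hasFDerivAt
  refine (h1.congr_of_eventuallyEq ?_).fderiv
  filter_upwards [hO.mem_nhds ht] with s hs
  exact ((hφ s hs).2).symm

omit [MeasurableSpace G] [BorelSpace G] in
theorem riemNorm_comp (gt : SmoothRiemannianMetric G) (x : G)
    (L : EuclideanSpace ℝ (Fin p) →L[ℝ] G)
    (T : EuclideanSpace ℝ (Fin p) →L[ℝ] EuclideanSpace ℝ (Fin p)) :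
    riemNorm gt x (fun i => L (T (EuclideanSpace.single i 1))) =
      |T.det| * riemNorm gt x fun i => L (EuclideanSpace.single i 1) := by
  let e := (EuclideanSpace.basisFun (Fin p) ℝ).toBasis
  have hdet : T.det = ((LinearMap.toMatrix e e T.toLinearMap).transpose).det := by
    rw [Matrix.det_transpose, LinearMap.det_toMatrix, ContinuousLinearMap.det]
  rw [hdet, ← riemNorm_sum_smul]
  congr 1
  ext1 i
  have h1 : T (EuclideanSpace.single i 1) =
      ∑ j, T (EuclideanSpace.single i 1) j • EuclideanSpace.single j (1 : ℝ) := by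
    conv_lhs => rw [← (EuclideanSpace.basisFun (Fin p) ℝ).sum_repr (T (EuclideanSpace.single i 1))]
    simp
  conv_lhs => rw [h1]
  rw [map_sum]
  refine Finset.sum_congr rfl fun j _ => ?_
  rw [map_smul]
  rw [Matrix.transpose_apply, LinearMap.toMatrix_apply]
  simp [e]

/-- The measures carried by two parametrizations agree on the common part of their images. -/
theorem paramMeasure_restrict_le [FiniteDimensional ℝ G] (gt : SmoothRiemannianMetric G)
    (h : IsC1Param M A Φ) (h₀ : IsC1Param M A₀ Φ₀)
    {U : Set G} (hU : IsOpen U) (hUA : Φ₀ '' A₀ = M ∩ U) :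
    (paramMeasure gt A Φ).restrict U ≤ paramMeasure gt A₀ Φ₀ := by
  refine Measure.le_iff.2 fun S hS => ?_
  obtain ⟨φ, φ', hφ⟩ := h.exists_transition h₀ hU hUA
  rw [Measure.restrict_apply hS, h.paramMeasure_apply gt (hS.inter hU.measurableSet),
    h₀.paramMeasure_apply gt hS]
  set T := A ∩ Φ ⁻¹' (S ∩ U) with hT
  have hTO : ∀ t ∈ T, t ∈ A ∩ Φ ⁻¹' U := fun t ht => ⟨ht.1, ht.2.2⟩
  have hTm : MeasurableSet T := h.measurableSet_inter_preimage (hS.inter hU.measurableSet)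
  have hinj : InjOn φ T := fun s hs t ht hst => by
    refine h.injOn hs.1 ht.1 ?_
    rw [← (hφ s (hTO s hs)).2.1, ← (hφ t (hTO t ht)).2.1, hst]
  calc ∫⁻ t in T, ENNReal.ofReal (surfaceDensity gt Φ t)
      = ∫⁻ t in T, ENNReal.ofReal |(φ' t).det| * ENNReal.ofReal (surfaceDensity gt Φ₀ (φ t)) := by
        refine setLIntegral_congr_fun hTm fun t ht => ?_
        obtain ⟨-, h2, -, h4⟩ := hφ t (hTO t ht)
        rw [← ENNReal.ofReal_mul (abs_nonneg _)]
        congr 1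
        simp only [surfaceDensity, h4, ← h2]
        exact riemNorm_comp gt _ _ _
    _ = ∫⁻ s in φ '' T, ENNReal.ofReal (surfaceDensity gt Φ₀ s) :=
        (lintegral_image_eq_lintegral_abs_det_fderiv_mul volume hTm
          (fun t ht => (hφ t (hTO t ht)).2.2.1.hasFDerivWithinAt) hinj
          fun s => ENNReal.ofReal (surfaceDensity gt Φ₀ s)).symm
    _ ≤ ∫⁻ s in A₀ ∩ Φ₀ ⁻¹' S, ENNReal.ofReal (surfaceDensity gt Φ₀ s) := by
        refine lintegral_mono_set ?_
        rintro _ ⟨t, ht, rfl⟩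
        obtain ⟨h1, h2, -, -⟩ := hφ t (hTO t ht)
        refine ⟨h1, ?_⟩
        rw [mem_preimage, h2]
        exact ht.2.1

/-- The surface measure is computed in any parametrization. -/
theorem surfaceMeasure_apply [FiniteDimensional ℝ G] (gt : SmoothRiemannianMetric G)
    (h₀ : IsC1Param M A₀ Φ₀) {U : Set G} (hU : IsOpen U) (hUA : Φ₀ '' A₀ = M ∩ U)
    {S : Set G} (hS : MeasurableSet S) (hSU : S ⊆ U) :
    surfaceMeasure gt p M S = paramMeasure gt A₀ Φ₀ S := by
  refine le_antisymm ?_ ?_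
  -- The right-hand side dominates each parametrized measure: on `U` by comparison with `Φ₀`, off
  -- `U` by the supremum itself. Hence it dominates the supremum, and its second term vanishes on `S
  -- ⊆ U`.
  · have hle : surfaceMeasure gt p M ≤
        paramMeasure gt A₀ Φ₀ + (surfaceMeasure gt p M).restrict Uᶜ := by
      conv_lhs => unfold surfaceMeasure
      refine iSup_le fun A => iSup_le fun Φ => iSup_le fun h => ?_
      rw [← Measure.restrict_add_restrict_compl (μ := paramMeasure gt A Φ) hU.measurableSet]
      refine add_le_add (h.paramMeasure_restrict_le gt h₀ hU hUA)
        (Measure.restrict_mono subset_rfl ?_)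
      exact le_iSup_of_le A (le_iSup_of_le Φ (le_iSup_of_le h le_rfl))
    refine (hle S).trans_eq ?_
    rw [Measure.add_apply, Measure.restrict_apply hS,
      (disjoint_compl_right_iff_subset.2 hSU).inter_eq, measure_empty, add_zero]
  · exact (le_iSup_of_le A₀ (le_iSup_of_le Φ₀ (le_iSup_of_le h₀ le_rfl)) :
      paramMeasure gt A₀ Φ₀ ≤ surfaceMeasure gt p M) S

end IsC1Param

/-! ### Graph parametrizations and their rescalings -/

namespace GradedBasis

variable {G : Type*} [NormedAddCommGroup G] [InnerProductSpace ℝ G] [FiniteDimensional ℝ G]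
  [StratifiedGroup G] {n p : ℕ} (b : GradedBasis G n)

/-- A parametrization `Ψ` of `M` around `x` that writes `x⁻¹ M` as a graph over the coordinates of
index in `α`, with tangent frame `w` at the origin. -/
structure IsGraphParam (M : Set G) (x : G) (α : Set.powersetCard (Fin n) p) (w : Fin p → G)
    (B : Set (EuclideanSpace ℝ (Fin p))) (Ψ : EuclideanSpace ℝ (Fin p) → G) : Prop where
  param : IsC1Param M B Ψ
  adapted : b.IsAdaptedFrame α w
  zero_mem : 0 ∈ B
  map_zero : Ψ 0 = x
  coords_eq : ∀ s ∈ B, b.coords α (x⁻¹ * Ψ s) = s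
  hasFDerivAt : HasFDerivAt (fun s => x⁻¹ * Ψ s) (linParam w) 0

/-- Inverse function theorem for the map sending a parameter to the coordinates of index in `α` of
`x⁻¹ * Φ t`; the new parameters are these coordinates. -/
theorem exists_isGraphParam {M : Set G} {A : Set (EuclideanSpace ℝ (Fin p))}
    {Φ : EuclideanSpace ℝ (Fin p) → G} (h : IsC1Param M A Φ) {t₀ : EuclideanSpace ℝ (Fin p)}
    (ht₀ : t₀ ∈ A) {α : Set.powersetCard (Fin n) p} {w : Fin p → G} (hw : b.IsAdaptedFrame α w)
    (hrange : range (fun t => fderiv ℝ (fun y : G => (Φ t₀)⁻¹ * y) (Φ t₀) (fderiv ℝ Φ t₀ t)) =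
      Submodule.span ℝ (range w)) :
    ∃ B Ψ, b.IsGraphParam M (Φ t₀) α w B Ψ := by
  set x := Φ t₀ with hx
  set T : G →L[ℝ] G := fderiv ℝ (fun y : G => x⁻¹ * y) x with hT
  set L : EuclideanSpace ℝ (Fin p) →L[ℝ] G := T.comp (fderiv ℝ Φ t₀) with hL
  let f : EuclideanSpace ℝ (Fin p) → EuclideanSpace ℝ (Fin p) := fun t => b.coords α (x⁻¹ * Φ t)
  have htrans : HasFDerivAt (fun y : G => x⁻¹ * y) T x :=
    ((contDiff_mul_left (m := 1) x⁻¹).differentiable one_ne_zero x).hasFDerivAt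
  have hf : ContDiffOn ℝ 1 f A :=
    (b.coords α).contDiff.comp_contDiffOn ((contDiff_mul_left x⁻¹).comp_contDiffOn h.contDiffOn)
  have hf' : HasFDerivAt f ((b.coords α).comp L) t₀ :=
    (b.coords α).hasFDerivAt.comp t₀ (htrans.comp t₀ (h.hasFDerivAt ht₀))
  -- The translated tangent space is the span of `w`, on which the coordinates of index in `α` are
  -- onto because `w` is adapted.
  have hsurj : Function.Surjective ((b.coords α).comp L) := by
    intro s
    have hs : linParam w s ∈ range fun t => T (fderiv ℝ Φ t₀ t) := by
      rw [hrange, ← range_linParam]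
      exact mem_range_self s
    obtain ⟨t, ht⟩ := hs
    refine ⟨t, ?_⟩
    change b.coords α (T (fderiv ℝ Φ t₀ t)) = s
    rw [show T (fderiv ℝ Φ t₀ t) = linParam w s from ht, hw.coords_linParam_frame]
  have hinj : Function.Injective ((b.coords α).comp L) :=
    LinearMap.injective_iff_surjective.2 hsurj
  let f' : EuclideanSpace ℝ (Fin p) ≃L[ℝ] EuclideanSpace ℝ (Fin p) :=
    (LinearEquiv.ofBijective ((b.coords α).comp L).toLinearMap
      ⟨hinj, hsurj⟩).toContinuousLinearEquiv
  have hf'' : HasFDerivAt f (f' : EuclideanSpace ℝ (Fin p) →L[ℝ] EuclideanSpace ℝ (Fin p)) t₀ := hf'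
  have hfat : ContDiffAt ℝ 1 f t₀ := hf.contDiffAt (h.isOpen.mem_nhds ht₀)
  let e₀ := hfat.toOpenPartialHomeomorph f hf'' one_ne_zero
  -- Shrinking to the open set of invertible derivatives makes the local inverse `C¹` on its whole
  -- domain.
  let N : Set (EuclideanSpace ℝ (Fin p)) := A ∩ fderiv ℝ f ⁻¹'
    range fun g : EuclideanSpace ℝ (Fin p) ≃L[ℝ] EuclideanSpace ℝ (Fin p) =>
      (g : EuclideanSpace ℝ (Fin p) →L[ℝ] EuclideanSpace ℝ (Fin p))
  have hN : IsOpen N :=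
    (hf.continuousOn_fderiv_of_isOpen h.isOpen le_rfl).isOpen_inter_preimage h.isOpen
      ContinuousLinearEquiv.isOpen
  have ht₀N : t₀ ∈ N := ⟨ht₀, f', hf''.fderiv.symm⟩
  let e := e₀.restrOpen N hN
  have he : ∀ t, e t = f t := fun t => rfl
  have hsource : e.source ⊆ N := by
    rw [OpenPartialHomeomorph.restrOpen_source]
    exact inter_subset_right
  have ht₀e : t₀ ∈ e.source := by
    rw [OpenPartialHomeomorph.restrOpen_source]
    exact ⟨hfat.mem_toOpenPartialHomeomorph_source hf'' one_ne_zero, ht₀N⟩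
  have hft₀ : f t₀ = 0 := by
    simp only [f, ← hx, inv_mul_self_eq, map_zero]
  have hdiff : ∀ t ∈ e.source, ContDiffAt ℝ 1 f t := fun t ht =>
    hf.contDiffAt (h.isOpen.mem_nhds (hsource ht).1)
  have hsymm : ContDiffOn ℝ 1 e.symm e.target := by
    intro s hs
    obtain ⟨g, hg⟩ := (hsource (e.map_target hs)).2
    have hd := ((hdiff _ (e.map_target hs)).differentiableAt one_ne_zero).hasFDerivAt
    rw [← hg] at hd
    exact (e.contDiffAt_symm hs hd (hdiff _ (e.map_target hs))).contDiffWithinAt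
  have hzero : (0 : EuclideanSpace ℝ (Fin p)) ∈ e.target := by
    rw [← hft₀]
    exact e.map_source ht₀e
  have hsymm0 : e.symm 0 = t₀ := by
    rw [← hft₀]
    exact e.left_inv ht₀e
  have hcoords : ∀ s ∈ e.target, b.coords α (x⁻¹ * (Φ ∘ e.symm) s) = s := fun s hs =>
    e.right_inv hs
  refine ⟨e.target, Φ ∘ e.symm,
    h.comp_symm e (fun t ht => (hsource ht).1) hsymm
      fun t ht => (hdiff t ht).differentiableAt one_ne_zero,
    hw, hzero, by simp [hsymm0, hx], hcoords, ?_⟩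
  have h1 : HasFDerivAt e.symm (fderiv ℝ e.symm 0) 0 :=
    ((hsymm.contDiffAt (e.open_target.mem_nhds hzero)).differentiableAt one_ne_zero).hasFDerivAt
  have h2 : HasFDerivAt (fun t => x⁻¹ * Φ t) L (e.symm 0) := by
    rw [hsymm0]
    exact htrans.comp t₀ (h.hasFDerivAt ht₀)
  have h3 : HasFDerivAt (fun s => x⁻¹ * (Φ ∘ e.symm) s) (L.comp (fderiv ℝ e.symm 0)) 0 :=
    h2.comp 0 h1
  -- The derivative of the graph at the origin takes values in the span of `w` and has the identity
  -- as its coordinates of index in `α`; together these force it to be `linParam w`.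
  have h4 : (b.coords α).comp (L.comp (fderiv ℝ e.symm 0)) = ContinuousLinearMap.id ℝ _ := by
    refine ((b.coords α).hasFDerivAt.comp 0 h3).unique ?_
    exact (hasFDerivAt_id _).congr_of_eventuallyEq
      (eventually_of_mem (e.open_target.mem_nhds hzero) hcoords)
  convert h3 using 1
  ext1 s
  have h5 : L (fderiv ℝ e.symm 0 s) ∈ range (linParam w) := by
    rw [range_linParam, ← hrange]
    exact mem_range_self _
  obtain ⟨c, hc⟩ := h5
  have h6 : b.coords α (L (fderiv ℝ e.symm 0 s)) = s :=
    congrArg (fun F : _ →L[ℝ] _ => F s) h4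
  rw [← hc, hw.coords_linParam_frame] at h6
  rw [← h6]
  exact hc.trans (by rw [h6]; rfl)

/-- The rescaled graph `σ ↦ δ_{1/r} (x⁻¹ Ψ (δ_r σ))`. -/
noncomputable def rescaled (α : Set.powersetCard (Fin n) p) (x : G)
    (Ψ : EuclideanSpace ℝ (Fin p) → G) (r : ℝ) (s : EuclideanSpace ℝ (Fin p)) : G :=
  dilation (1 / r) (x⁻¹ * Ψ (b.stretch α r s))

omit [FiniteDimensional ℝ G] in
theorem stretch_inv_stretch (α : Set.powersetCard (Fin n) p) {r : ℝ} (hr : r ≠ 0)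
    (s : EuclideanSpace ℝ (Fin p)) : b.stretch α (1 / r) (b.stretch α r s) = s := by
  ext i
  simp only [stretch_apply]
  rw [← mul_assoc, ← mul_pow, one_div_mul_cancel hr, one_pow, one_mul]

namespace IsGraphParam

variable {b} {M : Set G} {x : G} {α : Set.powersetCard (Fin n) p} {w : Fin p → G}
  {B : Set (EuclideanSpace ℝ (Fin p))} {Ψ : EuclideanSpace ℝ (Fin p) → G}
  (h : b.IsGraphParam M x α w B Ψ)
include h

omit [FiniteDimensional ℝ G] in
theorem eventually_stretch_mem (R : ℝ) :
    ∀ᶠ r in 𝓝[>] (0 : ℝ), ∀ s : EuclideanSpace ℝ (Fin p), ‖s‖ ≤ R → b.stretch α r s ∈ B := by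
  obtain ⟨η, hη, hηB⟩ := Metric.isOpen_iff.1 h.param.isOpen 0 h.zero_mem
  have h1 : ∀ᶠ r in 𝓝[>] (0 : ℝ), r * R < η := by
    have : Tendsto (fun r : ℝ => r * R) (𝓝[>] 0) (𝓝 0) := by
      have : Continuous fun r : ℝ => r * R := by fun_prop
      simpa using (this.tendsto 0).mono_left nhdsWithin_le_nhds
    exact this.eventually_lt_const hη
  filter_upwards [h1, Ioo_mem_nhdsGT one_pos] with r hr hr1 s hs
  refine hηB (mem_ball_zero_iff.2 (lt_of_le_of_lt ?_ hr))
  have := b.norm_stretch_le α (m := 1) (fun i => b.deg_pos _) hr1.1.le hr1.2.le s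
  rw [pow_one] at this
  exact this.trans (mul_le_mul_of_nonneg_left hs hr1.1.le)

theorem coords_rescaled {r : ℝ} (hr : r ≠ 0) {s : EuclideanSpace ℝ (Fin p)}
    (hs : b.stretch α r s ∈ B) : b.coords α (b.rescaled α x Ψ r s) = s := by
  rw [rescaled, b.coords_dilation, h.coords_eq _ hs, b.stretch_inv_stretch α hr]

omit [FiniteDimensional ℝ G] in
theorem mem_of_mem {s : EuclideanSpace ℝ (Fin p)} (hs : s ∈ B) : Ψ s ∈ M := by
  obtain ⟨U, -, hU⟩ := h.param.image_eq
  have : Ψ s ∈ M ∩ U := hU ▸ mem_image_of_mem Ψ hs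
  exact this.1

theorem rescaled_mem_blowUp {r : ℝ} {s : EuclideanSpace ℝ (Fin p)}
    (hs : b.stretch α r s ∈ B) : b.rescaled α x Ψ r s ∈ blowUp M x r :=
  ⟨Ψ (b.stretch α r s), h.mem_of_mem hs, rfl⟩

/-- A point of norm at most `R` in the blow-up comes from a point of `M` whose translate has norm at
most `r R`, hence from the parametrized patch. On bounded sets the blow-up is therefore exactly the
rescaled graph. -/
theorem eventually_rescaled_coords (R : ℝ) :
    ∀ᶠ r in 𝓝[>] (0 : ℝ), ∀ z : G, ‖z‖ ≤ R → z ∈ blowUp M x r →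
      b.rescaled α x Ψ r (b.coords α z) = z := by
  obtain ⟨U, hU, hUB⟩ := h.param.image_eq
  have hxU : x ∈ U := by
    have : Ψ 0 ∈ M ∩ U := hUB ▸ mem_image_of_mem Ψ h.zero_mem
    rw [h.map_zero] at this
    exact this.2
  have hcont : Tendsto (fun z : G => x * z) (𝓝 0) (𝓝 x) := by
    have := (contDiff_mul_left (m := 0) x).continuous.tendsto 0
    rwa [mul_zero_eq] at this
  obtain ⟨η, hη, hηU⟩ := Metric.mem_nhds_iff.1 (hcont (hU.mem_nhds hxU))
  have h1 : ∀ᶠ r in 𝓝[>] (0 : ℝ), r * R < η := by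
    have : Tendsto (fun r : ℝ => r * R) (𝓝[>] 0) (𝓝 0) := by
      have : Continuous fun r : ℝ => r * R := by fun_prop
      simpa using (this.tendsto 0).mono_left nhdsWithin_le_nhds
    exact this.eventually_lt_const hη
  filter_upwards [h1, Ioo_mem_nhdsGT one_pos] with r hr hr1
  rintro z hz ⟨y, hyM, rfl⟩
  have hr0 : r ≠ 0 := hr1.1.ne'
  set z := dilation (1 / r) (x⁻¹ * y) with hzdef
  have hz' : dilation r z = x⁻¹ * y := dilation_dilation_inv b hr0 _
  have hyU : y ∈ U := by
    have h2 : dilation r z ∈ Metric.ball (0 : G) η := by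
      rw [mem_ball_zero_iff]
      exact ((b.norm_dilation_le hr1.1.le hr1.2.le z).trans
        (mul_le_mul_of_nonneg_left hz hr1.1.le)).trans_lt hr
    have h3 := hηU h2
    rw [mem_preimage, hz', mul_inv_cancel_left] at h3
    exact h3
  obtain ⟨s, hs, hsy⟩ : y ∈ Ψ '' B := hUB ▸ ⟨hyM, hyU⟩
  have h4 : b.stretch α r (b.coords α z) = s := by
    rw [← b.coords_dilation, hz', ← hsy, h.coords_eq s hs]
  rw [rescaled, h4, hsy]

/-- The rescaled graphs converge to the blow-up subspace, uniformly on bounded sets. -/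
theorem tendsto_rescaled (R : ℝ) :
    Tendsto (fun q : ℝ × EuclideanSpace ℝ (Fin p) =>
      b.rescaled α x Ψ q.1 q.2 - linParam (b.topPart α w) q.2)
      (𝓝[>] (0 : ℝ) ×ˢ 𝓟 {s | ‖s‖ ≤ R}) (𝓝 0) := by
  set F : Filter (ℝ × EuclideanSpace ℝ (Fin p)) := 𝓝[>] (0 : ℝ) ×ˢ 𝓟 {s | ‖s‖ ≤ R} with hF
  have hbd : ∀ᶠ q in F, ‖q.2‖ ≤ R := tendsto_snd.eventually (eventually_principal.2 fun s hs => hs)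
  have hr : Tendsto (fun q : ℝ × EuclideanSpace ℝ (Fin p) => q.1) F (𝓝[>] 0) := tendsto_fst
  have hr' : Tendsto (fun q : ℝ × EuclideanSpace ℝ (Fin p) => q.1) F (𝓝 0) :=
    hr.mono_right nhdsWithin_le_nhds
  have hr1 : ∀ᶠ q in F, 0 < q.1 ∧ q.1 < 1 := hr.eventually (Ioo_mem_nhdsGT one_pos)
  have hmem : ∀ᶠ q in F, b.stretch α q.1 q.2 ∈ B := by
    have := (h.eventually_stretch_mem R).prod_inl (𝓟 {s : EuclideanSpace ℝ (Fin p) | ‖s‖ ≤ R})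
    filter_upwards [this, hbd] with q hq hq2
    exact hq _ hq2
  have hst : Tendsto (fun q : ℝ × EuclideanSpace ℝ (Fin p) => b.stretch α q.1 q.2) F (𝓝 0) := by
    have h1 : Tendsto (fun q : ℝ × EuclideanSpace ℝ (Fin p) => q.1 * R) F (𝓝 0) := by
      simpa using hr'.mul_const R
    refine squeeze_zero_norm' ?_ h1
    filter_upwards [hr1, hbd] with q hq hq2
    have := b.norm_stretch_le α (m := 1) (fun i => b.deg_pos _) hq.1.le hq.2.le q.2
    rw [pow_one] at this
    exact this.trans (mul_le_mul_of_nonneg_left hq2 hq.1.le)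
  suffices hk : ∀ k : Fin n, Tendsto (fun q : ℝ × EuclideanSpace ℝ (Fin p) =>
      b.X.repr (b.rescaled α x Ψ q.1 q.2 - linParam (b.topPart α w) q.2) k) F (𝓝 0) by
    have h1 : Tendsto (fun q : ℝ × EuclideanSpace ℝ (Fin p) =>
        ∑ k, b.X.repr (b.rescaled α x Ψ q.1 q.2 - linParam (b.topPart α w) q.2) k • b.X k) F
        (𝓝 (∑ k, (0 : ℝ) • b.X k)) :=
      tendsto_finsetSum _ fun k _ => (hk k).smul_const _
    simpa only [b.X.sum_repr, zero_smul, Finset.sum_const_zero] using h1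
  intro k
  by_cases hkα : k ∈ (α : Finset (Fin n))
  -- In a coordinate of index in `α`, the rescaled graph and its limit agree exactly.
  · obtain ⟨j, rfl⟩ := exists_enum_eq_iff.2 hkα
    refine tendsto_const_nhds.congr' ?_
    filter_upwards [hmem, hr1] with q hq hq1
    rw [← b.coords_apply, map_sub, h.coords_rescaled hq1.1.ne' hq, h.adapted.coords_linParam]
    simp
  · have hdeg := h.adapted.deg_le hkα
    have hlo := h.hasFDerivAt.isLittleO
    simp only [h.map_zero, inv_mul_self_eq, sub_zero] at hlo
    have hlo2 := hlo.comp_tendsto hst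
    -- The decisive use of maximality: all degrees in `α` are at least `deg k`, so the dilated
    -- parameter is small enough to absorb the division by `r ^ deg k`.
    have hO : (fun q : ℝ × EuclideanSpace ℝ (Fin p) => b.stretch α q.1 q.2) =O[F]
        fun q => q.1 ^ b.deg k := by
      refine Asymptotics.IsBigO.of_bound R ?_
      filter_upwards [hr1, hbd] with q hq hq2
      rw [Real.norm_of_nonneg (pow_nonneg hq.1.le _), mul_comm]
      exact (b.norm_stretch_le α hdeg hq.1.le hq.2.le q.2).trans
        (mul_le_mul_of_nonneg_left hq2 (pow_nonneg hq.1.le _))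
    have hlo3 := hlo2.trans_isBigO hO
    have hlo4 : (fun q : ℝ × EuclideanSpace ℝ (Fin p) =>
        b.X.repr (x⁻¹ * Ψ (b.stretch α q.1 q.2) - linParam w (b.stretch α q.1 q.2)) k) =o[F]
        fun q => q.1 ^ b.deg k := by
      refine (Asymptotics.isBigO_of_le _ fun q => ?_).trans_isLittleO hlo3
      refine (PiLp.norm_apply_le _ k).trans_eq ?_
      rw [b.X.repr.norm_map]
      rfl
    have hrem := hlo4.tendsto_div_nhds_zero
    -- In the linear part, a term of larger degree keeps a positive power of `r` and vanishes; a
    -- term of equal degree is exactly that of the top part.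
    have hmain : Tendsto (fun q : ℝ × EuclideanSpace ℝ (Fin p) => ∑ i, q.2 i * (b.X.repr (w i) k *
        (q.1 ^ (b.deg (enum α i) - b.deg k) - if b.deg k = b.deg (enum α i) then 1 else 0)))
        F (𝓝 0) := by
      rw [show (0 : ℝ) = ∑ _i : Fin p, (0 : ℝ) by simp]
      refine tendsto_finsetSum _ fun i _ => ?_
      have h0 : Tendsto (fun q : ℝ × EuclideanSpace ℝ (Fin p) => b.X.repr (w i) k *
          (q.1 ^ (b.deg (enum α i) - b.deg k) - if b.deg k = b.deg (enum α i) then 1 else 0))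
          F (𝓝 0) := by
        have h1 := ((hr'.pow (b.deg (enum α i) - b.deg k)).sub_const
          (if b.deg k = b.deg (enum α i) then (1 : ℝ) else 0)).const_mul (b.X.repr (w i) k)
        convert h1 using 2
        split_ifs with hd
        · simp [hd]
        · have := hdeg i
          simp [show b.deg (enum α i) - b.deg k ≠ 0 by omega]
      refine bdd_le_mul_tendsto_zero' R ?_ h0
      filter_upwards [hbd] with q hq
      exact (PiLp.norm_apply_le _ i).trans hq
    have hsum := hrem.add hmain
    rw [add_zero] at hsum
    refine hsum.congr' ?_
    filter_upwards [hr1] with q hq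
    have hq0 : q.1 ≠ 0 := hq.1.ne'
    rw [map_sub, PiLp.sub_apply, map_sub, PiLp.sub_apply, rescaled, b.repr_dilation, sub_div,
      linParam_apply, linParam_apply, map_sum, map_sum, WithLp.ofLp_sum, WithLp.ofLp_sum,
      Finset.sum_apply, Finset.sum_apply, Finset.sum_div, sub_add, ← Finset.sum_sub_distrib]
    congr 1
    · rw [one_div, inv_pow, div_eq_inv_mul]
    · refine Finset.sum_congr rfl fun i _ => ?_
      have h1 : q.1 ^ b.deg (enum α i) = q.1 ^ b.deg k * q.1 ^ (b.deg (enum α i) - b.deg k) := by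
        rw [← pow_add, Nat.add_sub_cancel' (hdeg i)]
      simp only [map_smul, PiLp.smul_apply, smul_eq_mul, stretch_apply, repr_topPart]
      rw [h1, mul_assoc, mul_assoc, mul_div_cancel_left₀ _ (pow_ne_zero _ hq0)]
      split_ifs with hd <;> ring

theorem eventually_norm_rescaled_sub_lt (R : ℝ) {ε : ℝ} (hε : 0 < ε) :
    ∀ᶠ r in 𝓝[>] (0 : ℝ), ∀ s : EuclideanSpace ℝ (Fin p), ‖s‖ ≤ R →
      ‖b.rescaled α x Ψ r s - linParam (b.topPart α w) s‖ < ε := by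
  have h1 := (h.tendsto_rescaled R).norm
  rw [norm_zero] at h1
  have h2 := h1.eventually_lt_const hε
  rw [eventually_prod_principal_iff] at h2
  filter_upwards [h2] with r hr s hs
  exact hr s hs

theorem continuousOn_rescaled (r : ℝ) :
    ContinuousOn (b.rescaled α x Ψ r) {s | b.stretch α r s ∈ B} := by
  have h1 : Continuous fun z : G => dilation (1 / r) (x⁻¹ * z) :=
    (continuous_dilation.comp (by fun_prop : Continuous fun z : G => (1 / r, z))).comp
      (contDiff_mul_left (m := 0) x⁻¹).continuous
  exact h1.comp_continuousOn (h.param.continuousOn.comp (b.stretch α r).continuous.continuousOn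
    fun s hs => hs)

end IsGraphParam

end GradedBasis

/-! ### Convergence of the blow-ups -/

theorem HomogeneousDistance.hausdorffEDist_le {G : Type*} [NormedAddCommGroup G]
    [InnerProductSpace ℝ G] [FiniteDimensional ℝ G] [StratifiedGroup G] (ρ : HomogeneousDistance G)
    {S T : Set G} {ε : ℝ} (h1 : ∀ z ∈ S, ∃ w ∈ T, ρ.d z w ≤ ε) (h2 : ∀ w ∈ T, ∃ z ∈ S, ρ.d w z ≤ ε) :
    ρ.hausdorffEDist S T ≤ ENNReal.ofReal ε := by
  have key : ∀ z w : G, ρ.d z w ≤ ε →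
      @edist G ρ.metricSpace.toPseudoMetricSpace.toEDist z w ≤ ENNReal.ofReal ε := fun z w hzw =>
    (@edist_dist G ρ.metricSpace.toPseudoMetricSpace z w).trans_le (ENNReal.ofReal_le_ofReal hzw)
  refine @Metric.hausdorffEDist_le_of_mem_edist G ρ.metricSpace.toPseudoEMetricSpace S T _
    (fun z hz => ?_) fun w hw => ?_
  · obtain ⟨w, hw, hzw⟩ := h1 z hz
    exact ⟨w, hw, key _ _ hzw⟩
  · obtain ⟨z, hz, hzw⟩ := h2 w hw
    exact ⟨z, hz, key _ _ hzw⟩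

namespace GradedBasis.IsGraphParam

variable {G : Type*} [NormedAddCommGroup G] [InnerProductSpace ℝ G] [FiniteDimensional ℝ G]
  [StratifiedGroup G] {n p : ℕ} {b : GradedBasis G n}
  {M : Set G} {x : G} {α : Set.powersetCard (Fin n) p} {w : Fin p → G}
  {B : Set (EuclideanSpace ℝ (Fin p))} {Ψ : EuclideanSpace ℝ (Fin p) → G}
  (h : b.IsGraphParam M x α w B Ψ)

omit [FiniteDimensional ℝ G] [StratifiedGroup G] in
theorem exists_norm_bound [StratifiedGroup G] (b : GradedBasis G n)
    (α : Set.powersetCard (Fin n) p) {F : Set G} (hF : IsCompact F) :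
    ∃ R, ∀ z ∈ F, ‖z‖ ≤ R ∧ ‖b.coords α z‖ ≤ R := by
  obtain ⟨R₁, h1⟩ := hF.exists_bound_of_continuousOn continuousOn_id
  obtain ⟨R₂, h2⟩ := hF.exists_bound_of_continuousOn (b.coords α).continuous.continuousOn
  exact ⟨max R₁ R₂, fun z hz => ⟨(h1 z hz).trans (le_max_left _ _), (h2 z hz).trans (le_max_right _ _)⟩⟩

include h

theorem eventually_isCompact {F : Set G} (hF : IsCompact F) :
    ∀ᶠ r in 𝓝[>] (0 : ℝ), IsCompact (F ∩ blowUp M x r) := by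
  obtain ⟨R, hR⟩ := exists_norm_bound b α hF
  filter_upwards [h.eventually_rescaled_coords R, h.eventually_stretch_mem R] with r h1 h2
  -- Within `F` the blow-up is the fixed point set of a continuous map, hence closed.
  have heq : F ∩ blowUp M x r =
      F ∩ (fun z => b.rescaled α x Ψ r (b.coords α z) - z) ⁻¹' {0} := by
    ext z
    refine and_congr_right fun hz => ⟨fun hzb => ?_, fun hz0 => ?_⟩
    · simp [h1 z (hR z hz).1 hzb]
    · have hz1 : b.rescaled α x Ψ r (b.coords α z) = z := sub_eq_zero.1 hz0
      rw [← hz1]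
      exact h.rescaled_mem_blowUp (h2 _ (hR z hz).2)
  rw [heq]
  have hc : ContinuousOn (fun z => b.rescaled α x Ψ r (b.coords α z) - z) F :=
    ((h.continuousOn_rescaled r).comp (b.coords α).continuous.continuousOn
      fun z hz => h2 _ (hR z hz).2).sub continuousOn_id
  exact hF.of_isClosed_subset (hc.preimage_isClosed_of_isClosed hF.isClosed isClosed_singleton)
    inter_subset_left

/-- Nearness must be to points of `F` itself. On the compact set `K` of points of `F` at distance at
least `ε` from the limit set, the distance to the linear graph has a positive minimum, which points
of the blow-up eventually undercut. -/
theorem eventually_exists_mem_span (ρ : HomogeneousDistance G) {F : Set G} (hF : IsCompact F)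
    {ε : ℝ} (hε : 0 < ε) :
    ∀ᶠ r in 𝓝[>] (0 : ℝ), ∀ z ∈ F ∩ blowUp M x r,
      ∃ y ∈ F ∩ (Submodule.span ℝ (range (b.topPart α w)) : Set G), ρ.d z y < ε := by
  obtain ⟨R, hR⟩ := exists_norm_bound b α hF
  let K : Set G := F ∩ ⋂ y ∈ F ∩ (Submodule.span ℝ (range (b.topPart α w)) : Set G),
    {z | ε ≤ ρ.d z y}
  have hK : IsCompact K := hF.inter_right <| isClosed_biInter fun y _ =>
    isClosed_le continuous_const (ρ.continuous_d.comp (by fun_prop : Continuous fun z : G => (z, y)))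
  let f : G → ℝ := fun z => ‖z - linParam (b.topPart α w) (b.coords α z)‖
  have hf : Continuous f := by fun_prop
  obtain ⟨c, hc, hcK⟩ : ∃ c > 0, ∀ z ∈ K, c ≤ f z := by
    rcases K.eq_empty_or_nonempty with h0 | h0
    · exact ⟨1, one_pos, by simp [h0]⟩
    · obtain ⟨z₀, hz₀, hmin⟩ := hK.exists_isMinOn h0 hf.continuousOn
      refine ⟨f z₀, lt_of_le_of_ne (norm_nonneg _) fun hz => ?_, fun z hz => hmin hz⟩
      have h1 : z₀ = linParam (b.topPart α w) (b.coords α z₀) :=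
        sub_eq_zero.1 (norm_eq_zero.1 hz.symm)
      have h2 : z₀ ∈ (Submodule.span ℝ (range (b.topPart α w)) : Set G) := by
        rw [← range_linParam]
        exact ⟨_, h1.symm⟩
      have h3 := mem_iInter₂.1 hz₀.2 z₀ ⟨hz₀.1, h2⟩
      rw [mem_ofPred_eq, ρ.d_self] at h3
      linarith
  filter_upwards [h.eventually_rescaled_coords R, h.eventually_norm_rescaled_sub_lt R hc]
    with r h1 h2 z hz
  by_contra! hn
  have hzK : z ∈ K := ⟨hz.1, mem_iInter₂.2 hn⟩
  have h3 := h2 (b.coords α z) (hR z hz.1).2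
  rw [h1 z (hR z hz.1).1 hz.2] at h3
  exact absurd (hcK z hzK) (not_le.2 h3)

/-- A point of the subspace is approximated by the point of the rescaled graph with the same
coordinates of index in `α`; the approximant may leave `F`. -/
theorem eventually_exists_mem_blowUp (ρ : HomogeneousDistance G) {F : Set G} (hF : IsCompact F)
    {ε : ℝ} (hε : 0 < ε) :
    ∀ᶠ r in 𝓝[>] (0 : ℝ), ∀ y ∈ F ∩ (Submodule.span ℝ (range (b.topPart α w)) : Set G),
      ∃ z ∈ blowUp M x r, ρ.d y z < ε := by
  obtain ⟨R, hR⟩ := exists_norm_bound b α hF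
  obtain ⟨η, hη, hηd⟩ := ρ.exists_forall_d_lt hF hε
  filter_upwards [h.eventually_stretch_mem R, h.eventually_norm_rescaled_sub_lt R hη]
    with r h1 h2 y hy
  refine ⟨b.rescaled α x Ψ r (b.coords α y), h.rescaled_mem_blowUp (h1 _ (hR y hy.1).2),
    hηd y hy.1 _ ?_⟩
  obtain ⟨s, hs⟩ : y ∈ range (linParam (b.topPart α w)) := by
    rw [range_linParam]
    exact hy.2
  have h3 := h2 (b.coords α y) (hR y hy.1).2
  rw [← hs, h.adapted.coords_linParam, norm_sub_rev] at h3
  rw [← hs, h.adapted.coords_linParam]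
  exact h3

theorem eventually_rescaled_mem_of_isOpen {V : Set G} (hV : IsOpen V)
    {s : EuclideanSpace ℝ (Fin p)} (hs : linParam (b.topPart α w) s ∈ V) :
    ∀ᶠ r in 𝓝[>] (0 : ℝ), b.rescaled α x Ψ r s ∈ V := by
  obtain ⟨η, hη, hηV⟩ := Metric.isOpen_iff.1 hV _ hs
  filter_upwards [h.eventually_norm_rescaled_sub_lt ‖s‖ hη] with r hr
  exact hηV (mem_ball_iff_norm.2 (hr s le_rfl))

/-- The closure condition allows approximants to stay in `F`: centres in the interior of `F` can be
approached without leaving it, and finitely many centres suffice. -/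
theorem tendsto_hausdorffEDist (ρ : HomogeneousDistance G) {F : Set G} (hF : IsCompact F)
    (hcl : F ∩ (Submodule.span ℝ (range (b.topPart α w)) : Set G) ⊆
      closure (interior F ∩ (Submodule.span ℝ (range (b.topPart α w)) : Set G))) :
    Tendsto (fun r : ℝ => ρ.hausdorffEDist (F ∩ blowUp M x r)
      (F ∩ (Submodule.span ℝ (range (b.topPart α w)) : Set G))) (𝓝[>] 0) (𝓝 0) := by
  set P : Set G := (Submodule.span ℝ (range (b.topPart α w)) : Set G) with hP
  have hPc : IsClosed P := Submodule.closed_of_finiteDimensional _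
  suffices key : ∀ ε : ℝ, 0 < ε → ∀ᶠ r in 𝓝[>] (0 : ℝ), ρ.hausdorffEDist (F ∩ blowUp M x r)
      (F ∩ P) ≤ ENNReal.ofReal ε by
    rw [ENNReal.tendsto_nhds_zero]
    intro ε hε
    obtain ⟨c, hc0, hc⟩ := ENNReal.lt_iff_exists_nnreal_btwn.1 hε
    filter_upwards [key c (by exact_mod_cast hc0)] with r hr
    refine hr.trans ?_
    simpa using hc.le
  intro ε hε
  have hFP : IsCompact (F ∩ P) := hF.inter_right hPc
  obtain ⟨I, hI, hIfin, hIcov⟩ := hFP.elim_finite_subcover_image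
    (b := interior F ∩ P) (c := fun y => ρ.ball y (ε / 2)) (fun y _ => ρ.isOpen_ball y _) (by
      intro z hz
      have hnb : {y | ρ.d y z < ε / 2} ∈ 𝓝 z := by
        refine (isOpen_lt (ρ.continuous_d.comp (by fun_prop : Continuous fun y : G => (y, z)))
          continuous_const).mem_nhds ?_
        simp only [mem_ofPred_eq, Function.comp_apply, ρ.d_self]
        positivity
      obtain ⟨y, hy1, hy2⟩ := mem_closure_iff_nhds.1 (hcl hz) _ hnb
      exact mem_iUnion₂.2 ⟨y, hy2, hy1⟩)
  have hnear : ∀ y ∈ I, ∀ᶠ r in 𝓝[>] (0 : ℝ), ∃ z ∈ F ∩ blowUp M x r, ρ.d y z < ε / 2 := by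
    intro y hy
    obtain ⟨s, rfl⟩ : y ∈ range (linParam (b.topPart α w)) := by
      rw [range_linParam]
      exact (hI hy).2
    have hV : IsOpen (interior F ∩ ρ.ball (linParam (b.topPart α w) s) (ε / 2)) :=
      isOpen_interior.inter (ρ.isOpen_ball _ _)
    filter_upwards [h.eventually_rescaled_mem_of_isOpen hV (s := s) ⟨(hI hy).1, by
        change ρ.d _ _ < _
        rw [ρ.d_self]; positivity⟩, h.eventually_stretch_mem ‖s‖] with r h1 h2
    exact ⟨_, ⟨interior_subset h1.1, h.rescaled_mem_blowUp (h2 s le_rfl)⟩, h1.2⟩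
  filter_upwards [h.eventually_exists_mem_span ρ hF hε, hIfin.eventually_all.2 hnear] with r h1 h2
  refine ρ.hausdorffEDist_le (fun z hz => ?_) fun y hy => ?_
  · obtain ⟨y, hy, hzy⟩ := h1 z hz
    exact ⟨y, hy, hzy.le⟩
  · obtain ⟨y', hy', hyy'⟩ := mem_iUnion₂.1 (hIcov hy)
    obtain ⟨z, hz, hz'⟩ := h2 y' hy'
    refine ⟨z, hz, ?_⟩
    have h3 := ρ.triangle y y' z
    have h4 : ρ.d y' y < ε / 2 := hyy'
    rw [ρ.symm] at h4
    linarith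

end GradedBasis.IsGraphParam

/-! ### Euclidean Hausdorff measure of the image of a linear map -/

namespace GradedBasis

section LinearImage

variable {G : Type*} [NormedAddCommGroup G] [InnerProductSpace ℝ G] {p : ℕ}

theorem linParam_single (ζ : Fin p → G) (i : Fin p) :
    linParam ζ (EuclideanSpace.single i 1) = ζ i := by
  rw [linParam_apply, Finset.sum_eq_single i] <;> simp +contextual

/-- The area formula for an injective linear parametrization. -/
theorem euclideanHausdorffMeasure_linParam_image [MeasurableSpace G] [BorelSpace G]
    {ζ : Fin p → G} (hζ : LinearIndependent ℝ ζ) (V : Set (EuclideanSpace ℝ (Fin p))) :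
    (Measure.euclideanHausdorffMeasure p : Measure G) (linParam ζ '' V) =
      ENNReal.ofReal (Real.sqrt (Matrix.of fun i j => inner ℝ (ζ i) (ζ j)).det) * volume V := by
  let S := Submodule.span ℝ (range ζ)
  have hS : Module.finrank ℝ S = p := by simpa using finrank_span_eq_card hζ
  have : FiniteDimensional ℝ S := FiniteDimensional.span_of_finite ℝ (finite_range ζ)
  -- An orthonormal basis of the span factors the parametrization as a linear isometry `i` after an
  -- endomorphism `T` of the parameter space.
  let o : OrthonormalBasis (Fin p) ℝ S := (stdOrthonormalBasis ℝ S).reindex (finCongr hS)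
  let i : EuclideanSpace ℝ (Fin p) →ₗᵢ[ℝ] G := S.subtypeₗᵢ.comp o.repr.symm.toLinearIsometry
  have hmem : ∀ s, linParam ζ s ∈ S := fun s => by
    have : linParam ζ s ∈ (S : Set G) := range_linParam ζ ▸ mem_range_self s
    exact this
  let T : EuclideanSpace ℝ (Fin p) →ₗ[ℝ] EuclideanSpace ℝ (Fin p) :=
    o.repr.toLinearEquiv.toLinearMap ∘ₗ ((linParam ζ).toLinearMap.codRestrict S hmem)
  have hT : ∀ s, i (T s) = linParam ζ s := fun s => by
    simp [i, T]
  have himage : linParam ζ '' V = i '' (T.toContinuousLinearMap '' V) := by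
    rw [image_image]
    exact image_congr fun s _ => (hT s).symm
  rw [himage, i.isometry.euclideanHausdorffMeasure_image,
    EuclideanSpace.euclideanHausdorffMeasure_eq_volume, Measure.addHaar_image_continuousLinearMap]
  congr 2
  let e := (EuclideanSpace.basisFun (Fin p) ℝ)
  let Q := LinearMap.toMatrix e.toBasis e.toBasis T
  -- The Gram matrix is `Qᵀ Q`, so the volume factor `|det T|` is the square root of its
  -- determinant.
  have hQ : (Matrix.of fun i j => inner ℝ (ζ i) (ζ j)) = Q.transpose * Q := by
    ext j k
    rw [Matrix.of_apply, ← linParam_single ζ j, ← linParam_single ζ k, ← hT, ← hT,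
      i.inner_map_map, Matrix.mul_apply]
    simp [Q, LinearMap.toMatrix_apply, PiLp.inner_apply, e, mul_comm]
  rw [hQ, Matrix.det_mul, Matrix.det_transpose, ← sq, Real.sqrt_sq_eq_abs, LinearMap.det_toMatrix]
  rfl

end LinearImage

variable {G : Type*} [NormedAddCommGroup G] [InnerProductSpace ℝ G] [FiniteDimensional ℝ G]
  [StratifiedGroup G] {n p : ℕ} {b : GradedBasis G n}
  {α : Set.powersetCard (Fin n) p} {w : Fin p → G} (ρ : HomogeneousDistance G)

namespace IsAdaptedFrame

/-- The ball of radius `r` of the blow-up subspace, in coordinates. -/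
def coordBall (b : GradedBasis G n) (α : Set.powersetCard (Fin n) p) (w : Fin p → G)
    (ρ : HomogeneousDistance G) (r : ℝ) : Set (EuclideanSpace ℝ (Fin p)) :=
  {s | ρ.d 0 (linParam (b.topPart α w) s) < r}

theorem isOpen_coordBall (r : ℝ) : IsOpen (coordBall b α w ρ r) :=
  isOpen_lt ((ρ.continuous_d_left 0).comp (linParam _).continuous) continuous_const

theorem stretch_image_coordBall {r : ℝ} (hr : 0 < r) (c : ℝ) :
    b.stretch α r '' coordBall b α w ρ c = coordBall b α w ρ (r * c) := by
  have key : ∀ s, ρ.d 0 (linParam (b.topPart α w) (b.stretch α r s)) =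
      r * ρ.d 0 (linParam (b.topPart α w) s) := fun s => by
    rw [← dilation_linParam, ρ.d_zero_dilation hr]
  ext s
  constructor
  · rintro ⟨s, hs, rfl⟩
    change ρ.d 0 _ < r * c
    rw [key]
    exact mul_lt_mul_of_pos_left hs hr
  · intro hs
    have h1 := b.stretch_inv_stretch α (r := 1 / r) (by positivity) s
    rw [one_div_one_div] at h1
    refine ⟨b.stretch α (1 / r) s, ?_, h1⟩
    have h2 := key (b.stretch α (1 / r) s)
    rw [h1] at h2
    have h3 : ρ.d 0 (linParam (b.topPart α w) s) < r * c := hs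
    rw [h2] at h3
    exact lt_of_mul_lt_mul_left h3 hr.le

theorem volume_coordBall (h : b.IsAdaptedFrame α w) {r : ℝ} (hr : 0 < r) :
    volume (coordBall b α w ρ r) =
      ENNReal.ofReal (r ^ b.maxDim p) * volume (coordBall b α w ρ 1) := by
  have h1 := Measure.addHaar_image_continuousLinearMap (volume : Measure (EuclideanSpace ℝ (Fin p)))
    (b.stretch α r) (coordBall b α w ρ 1)
  rw [stretch_image_coordBall ρ hr, mul_one] at h1
  rw [h1]
  have h2 := b.det_stretch α r
  rw [ContinuousLinearMap.det, h.multiDeg_eq] at h2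
  rw [h2, abs_of_nonneg (by positivity)]

theorem exists_coordBall_subset (h : b.IsAdaptedFrame α w) :
    ∃ R, 0 < R ∧ coordBall b α w ρ 1 ⊆ Metric.closedBall 0 R ∧
      ∀ z, ρ.d 0 z < 1 → ‖b.coords α z‖ ≤ R := by
  obtain ⟨C, hC0, hC⟩ := ρ.exists_norm_le b
  have key : ∀ z, ρ.d 0 z < 1 → ‖b.coords α z‖ ≤ ‖b.coords α‖ * C + 1 := fun z hz =>
    ((b.coords α).le_opNorm z).trans (by
      have := mul_le_mul_of_nonneg_left (hC z hz.le) (norm_nonneg (b.coords α))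
      linarith)
  refine ⟨‖b.coords α‖ * C + 1, by positivity, fun s hs => ?_, key⟩
  have := key _ hs
  rw [h.coords_linParam] at this
  simpa using this

theorem volume_coordBall_ne_top (h : b.IsAdaptedFrame α w) :
    volume (coordBall b α w ρ 1) ≠ ⊤ := by
  obtain ⟨R, -, hR, -⟩ := h.exists_coordBall_subset ρ
  exact ((measure_mono hR).trans_lt measure_closedBall_lt_top).ne

theorem volume_coordBall_pos : 0 < volume (coordBall b α w ρ 1) := by
  refine (isOpen_coordBall ρ 1).measure_pos _ ⟨0, ?_⟩
  change ρ.d 0 _ < 1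
  rw [map_zero, ρ.d_self]
  exact one_pos

/-- For `r > 1` the ball of radius `r` contains the sphere and the unit ball disjointly. Its volume
tends to that of the unit ball as `r → 1`, leaving nothing for the sphere. -/
theorem volume_coordSphere (h : b.IsAdaptedFrame α w) :
    volume {s : EuclideanSpace ℝ (Fin p) | ρ.d 0 (linParam (b.topPart α w) s) = 1} = 0 := by
  set S := {s : EuclideanSpace ℝ (Fin p) | ρ.d 0 (linParam (b.topPart α w) s) = 1} with hS
  have hle : ∀ r : ℝ, 1 < r → volume S + volume (coordBall b α w ρ 1) ≤
      ENNReal.ofReal (r ^ b.maxDim p) * volume (coordBall b α w ρ 1) := by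
    intro r hr
    rw [← h.volume_coordBall ρ (by linarith), ← measure_union _ (isOpen_coordBall ρ 1).measurableSet]
    · refine measure_mono (union_subset (fun s hs => ?_) fun s hs => ?_)
      · change ρ.d 0 _ < r
        rwa [show ρ.d 0 _ = 1 from hs]
      · exact lt_trans (show ρ.d 0 _ < 1 from hs) hr
    · refine disjoint_left.2 fun s hs hs' => ?_
      have h1 : ρ.d 0 (linParam (b.topPart α w) s) = 1 := hs
      have h2 : ρ.d 0 (linParam (b.topPart α w) s) < 1 := hs'
      linarith
  have hlim : Tendsto (fun r : ℝ => ENNReal.ofReal (r ^ b.maxDim p) * volume (coordBall b α w ρ 1))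
      (𝓝[>] 1) (𝓝 (volume (coordBall b α w ρ 1))) := by
    have h1 : Tendsto (fun r : ℝ => ENNReal.ofReal (r ^ b.maxDim p)) (𝓝[>] 1) (𝓝 1) := by
      have : Continuous fun r : ℝ => ENNReal.ofReal (r ^ b.maxDim p) :=
        ENNReal.continuous_ofReal.comp (by fun_prop)
      simpa using (this.tendsto 1).mono_left nhdsWithin_le_nhds
    simpa using ENNReal.Tendsto.mul_const h1 (Or.inr (h.volume_coordBall_ne_top ρ))
  have h2 := ge_of_tendsto hlim (eventually_mem_nhdsWithin.mono fun r hr => hle r hr)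
  have h3 : volume S + volume (coordBall b α w ρ 1) ≤ 0 + volume (coordBall b α w ρ 1) := by
    rwa [zero_add]
  exact le_antisymm ((ENNReal.add_le_add_iff_right (h.volume_coordBall_ne_top ρ)).1 h3) zero_le

theorem metricFactor_eq (h : b.IsAdaptedFrame α w) [MeasurableSpace G] [BorelSpace G] :
    metricFactor ρ (exteriorPower.ιMulti ℝ p (b.topPart α w)) =
      ENNReal.ofReal (b.pnorm (exteriorPower.ιMulti ℝ p (b.topPart α w))) *
        volume (coordBall b α w ρ 1) := by
  have himage : (Submodule.span ℝ (range (b.topPart α w)) : Set G) ∩ ρ.ball 0 1 =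
      linParam (b.topPart α w) '' coordBall b α w ρ 1 := by
    rw [← range_linParam]
    ext z
    constructor
    · rintro ⟨⟨s, rfl⟩, hs⟩
      exact ⟨s, hs, rfl⟩
    · rintro ⟨s, hs, rfl⟩
      exact ⟨mem_range_self s, hs⟩
  rw [metricFactor, assocSubspace_ιMulti h.linearIndependent_topPart, himage,
    euclideanHausdorffMeasure_linParam_image h.linearIndependent_topPart, b.pnorm_ιMulti]

end IsAdaptedFrame

/-! ### Surface measure of small balls -/

namespace IsGraphParam

open IsAdaptedFrame

variable {M : Set G} {x : G} {B : Set (EuclideanSpace ℝ (Fin p))} {Ψ : EuclideanSpace ℝ (Fin p) → G}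
  (h : b.IsGraphParam M x α w B Ψ)

theorem mem_ball_iff {r : ℝ} (hr : 0 < r) (s : EuclideanSpace ℝ (Fin p)) :
    Ψ (b.stretch α r s) ∈ ρ.ball x r ↔ ρ.d 0 (b.rescaled α x Ψ r s) < 1 := by
  rw [rescaled, ρ.d_zero_dilation (by positivity), one_div_mul_eq_div, div_lt_one hr, ← ρ.d_eq]
  rfl

variable [MeasurableSpace G] [BorelSpace G] (gt : SmoothRiemannianMetric G)
include h

/-- The surface measure of small balls, after rescaling. -/
theorem eventually_surfaceMeasure_ball_eq :
    ∀ᶠ r in 𝓝[>] (0 : ℝ), surfaceMeasure gt p M (M ∩ ρ.ball x r) / ENNReal.ofReal (r ^ b.maxDim p) =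
      ∫⁻ s in b.stretch α r ⁻¹' (B ∩ Ψ ⁻¹' ρ.ball x r),
        ENNReal.ofReal (surfaceDensity gt Ψ (b.stretch α r s)) := by
  obtain ⟨U, hU, hUB⟩ := h.param.image_eq
  have hxU : x ∈ U := by
    have : Ψ 0 ∈ M ∩ U := hUB ▸ mem_image_of_mem Ψ h.zero_mem
    rw [h.map_zero] at this
    exact this.2
  obtain ⟨r₀, hr₀, hr₀U⟩ := ρ.exists_ball_subset b (hU.mem_nhds hxU)
  filter_upwards [Ioo_mem_nhdsGT hr₀] with r hr
  have hball : ρ.ball x r ⊆ U := fun y hy => hr₀U (lt_trans (show ρ.d x y < r from hy) hr.2)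
  have hset : M ∩ ρ.ball x r = Ψ '' B ∩ ρ.ball x r := by
    rw [hUB, inter_assoc, inter_eq_self_of_subset_right hball]
  have hmeas : MeasurableSet (M ∩ ρ.ball x r) := by
    rw [hset]
    exact (h.param.isOpen.measurableSet.image_of_continuousOn_injOn h.param.continuousOn
      h.param.injOn).inter (ρ.isOpen_ball x r).measurableSet
  rw [h.param.surfaceMeasure_apply gt hU hUB hmeas (inter_subset_right.trans hball),
    h.param.paramMeasure_apply gt hmeas]
  -- The domain of integration is rewritten as an image under the dilation of parameters, whose
  -- Jacobian is the power `r ^ D(p)` to be cancelled.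
  have hdom : B ∩ Ψ ⁻¹' (M ∩ ρ.ball x r) =
      b.stretch α r '' (b.stretch α r ⁻¹' (B ∩ Ψ ⁻¹' ρ.ball x r)) := by
    rw [image_preimage_eq]
    · ext s
      exact ⟨fun hs => ⟨hs.1, hs.2.2⟩, fun hs => ⟨hs.1, h.mem_of_mem hs.1, hs.2⟩⟩
    · intro s
      have h1 := b.stretch_inv_stretch α (r := 1 / r) (one_div_ne_zero hr.1.ne') s
      rw [one_div_one_div] at h1
      exact ⟨_, h1⟩
  have hpre : MeasurableSet (b.stretch α r ⁻¹' (B ∩ Ψ ⁻¹' ρ.ball x r)) :=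
    (b.stretch α r).continuous.measurable
      (h.param.measurableSet_inter_preimage (ρ.isOpen_ball x r).measurableSet)
  have hinj : Function.Injective (b.stretch α r) :=
    Function.LeftInverse.injective (b.stretch_inv_stretch α hr.1.ne')
  have hpos : 0 < r ^ b.maxDim p := pow_pos hr.1 _
  rw [hdom, lintegral_image_eq_lintegral_abs_det_fderiv_mul volume hpre
    (fun s _ => (b.stretch α r).hasFDerivWithinAt) hinj.injOn, b.det_stretch α r,
    h.adapted.multiDeg_eq, abs_of_pos hpos, lintegral_const_mul' _ _ ENNReal.ofReal_ne_top]
  rw [mul_comm]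
  exact ENNReal.mul_div_cancel_right (by simpa using hpos) ENNReal.ofReal_ne_top

/-- Dominated convergence: off the null unit sphere the indicators of the rescaled domains converge
to that of the coordinate ball, and inside it the densities converge to their value at the origin.
-/
theorem tendsto_surfaceMeasure_ball :
    Tendsto (fun r : ℝ => surfaceMeasure gt p M (M ∩ ρ.ball x r) / ENNReal.ofReal (r ^ b.maxDim p))
      (𝓝[>] 0) (𝓝 (ENNReal.ofReal (surfaceDensity gt Ψ 0) * volume (coordBall b α w ρ 1))) := by
  obtain ⟨R, hR0, hR, hRz⟩ := h.adapted.exists_coordBall_subset ρ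
  have hJ : ContinuousOn (surfaceDensity gt Ψ) B := h.param.continuousOn_surfaceDensity gt
  have hJ0 : ContinuousAt (surfaceDensity gt Ψ) 0 :=
    hJ.continuousAt (h.param.isOpen.mem_nhds h.zero_mem)
  set W : ℝ → Set (EuclideanSpace ℝ (Fin p)) := fun r =>
    b.stretch α r ⁻¹' (B ∩ Ψ ⁻¹' ρ.ball x r) with hW
  have hWopen : ∀ r, IsOpen (W r) := fun r => 
    (h.param.continuousOn.isOpen_inter_preimage h.param.isOpen (ρ.isOpen_ball x r)).preimage
      (b.stretch α r).continuous
  set f : ℝ → EuclideanSpace ℝ (Fin p) → ℝ≥0∞ := fun r =>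
    (W r).indicator fun s => ENNReal.ofReal (surfaceDensity gt Ψ (b.stretch α r s)) with hf
  have hlim : ∫⁻ s, (coordBall b α w ρ 1).indicator
      (fun _ => ENNReal.ofReal (surfaceDensity gt Ψ 0)) s =
      ENNReal.ofReal (surfaceDensity gt Ψ 0) * volume (coordBall b α w ρ 1) := by
    rw [lintegral_indicator (isOpen_coordBall ρ 1).measurableSet, setLIntegral_const]
  rw [← hlim]
  have hev : (fun r => ∫⁻ s, f r s) =ᶠ[𝓝[>] 0] fun r : ℝ =>
      surfaceMeasure gt p M (M ∩ ρ.ball x r) / ENNReal.ofReal (r ^ b.maxDim p) := by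
    filter_upwards [h.eventually_surfaceMeasure_ball_eq ρ gt] with r hr
    rw [hr, hf, lintegral_indicator (hWopen r).measurableSet]
  refine Tendsto.congr' hev ?_
  obtain ⟨η, hη, hηJ⟩ := Metric.continuousAt_iff.1 hJ0 1 one_pos
  refine tendsto_lintegral_filter_of_dominated_convergence
    ((Metric.closedBall 0 R).indicator fun _ => ENNReal.ofReal (surfaceDensity gt Ψ 0 + 1))
    (Eventually.of_forall fun r => ?_) ?_ ?_ ?_
  · classical
    have : ContinuousOn (fun s => ENNReal.ofReal (surfaceDensity gt Ψ (b.stretch α r s))) (W r) :=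
      ENNReal.continuous_ofReal.comp_continuousOn
        (hJ.comp (b.stretch α r).continuous.continuousOn fun s hs => hs.1)
    have h2 := this.measurable_piecewise (continuousOn_const (c := (0 : ℝ≥0∞)))
      (hWopen r).measurableSet
    have h3 : f r = (W r).piecewise (fun s =>
        ENNReal.ofReal (surfaceDensity gt Ψ (b.stretch α r s))) fun _ => 0 :=
      piecewise_eq_indicator.symm
    rw [h3]
    exact h2
  · have h1 : ∀ᶠ r in 𝓝[>] (0 : ℝ), r * R < η := by
      have : Tendsto (fun r : ℝ => r * R) (𝓝[>] 0) (𝓝 0) := by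
        have : Continuous fun r : ℝ => r * R := by fun_prop
        simpa using (this.tendsto 0).mono_left nhdsWithin_le_nhds
      exact this.eventually_lt_const hη
    filter_upwards [h1, Ioo_mem_nhdsGT one_pos] with r hr hr1
    refine Eventually.of_forall fun s => ?_
    by_cases hs : s ∈ W r
    -- The rescaled point lies in the unit ball of `d`, and its coordinates of index in `α` are `s`;
    -- this bounds `s` independently of `r`.
    · have hsR : ‖s‖ ≤ R := by
        have h2 := hRz _ ((mem_ball_iff ρ hr1.1 s).1 hs.2)
        rwa [h.coords_rescaled hr1.1.ne' hs.1] at h2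
      simp only [hf]
      rw [indicator_of_mem hs, indicator_of_mem (by simpa using hsR)]
      refine ENNReal.ofReal_le_ofReal ?_
      have h3 := b.norm_stretch_le α (m := 1) (fun i => b.deg_pos _) hr1.1.le hr1.2.le s
      rw [pow_one] at h3
      have h4 := hηJ (x := b.stretch α r s) (by
        rw [dist_zero_right]
        exact (h3.trans (mul_le_mul_of_nonneg_left hsR hr1.1.le)).trans_lt hr)
      rw [Real.dist_eq] at h4
      linarith [(abs_lt.1 h4).2]
    · simp only [hf]
      rw [indicator_of_notMem hs]
      exact zero_le
  · rw [lintegral_indicator Metric.isClosed_closedBall.measurableSet, setLIntegral_const]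
    exact ENNReal.mul_ne_top ENNReal.ofReal_ne_top measure_closedBall_lt_top.ne
  · have hnull := h.adapted.volume_coordSphere ρ
    filter_upwards [compl_mem_ae_iff.2 hnull] with s hs
    have hs : ρ.d 0 (linParam (b.topPart α w) s) ≠ 1 := hs
    have hst : Tendsto (fun r : ℝ => b.stretch α r s) (𝓝[>] 0) (𝓝 0) := by
      have h1 : Tendsto (fun r : ℝ => r * ‖s‖) (𝓝[>] 0) (𝓝 0) := by
        have : Continuous fun r : ℝ => r * ‖s‖ := by fun_prop
        simpa using (this.tendsto 0).mono_left nhdsWithin_le_nhds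
      refine squeeze_zero_norm' ?_ h1
      filter_upwards [Ioo_mem_nhdsGT one_pos] with r hr1
      simpa using b.norm_stretch_le α (m := 1) (fun i => b.deg_pos _) hr1.1.le hr1.2.le s
    have hpos : ∀ᶠ r in 𝓝[>] (0 : ℝ), 0 < r := eventually_mem_nhdsWithin
    rcases lt_or_gt_of_ne hs with hlt | hgt
    · rw [indicator_of_mem (show s ∈ coordBall b α w ρ 1 from hlt)]
      have h1 : Tendsto (fun r => ENNReal.ofReal (surfaceDensity gt Ψ (b.stretch α r s))) (𝓝[>] 0)
          (𝓝 (ENNReal.ofReal (surfaceDensity gt Ψ 0))) :=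
        (ENNReal.continuous_ofReal.tendsto _).comp (hJ0.tendsto.comp hst)
      refine h1.congr' ?_
      filter_upwards [hpos, h.eventually_stretch_mem ‖s‖, h.eventually_rescaled_mem_of_isOpen
        (isOpen_lt (ρ.continuous_d_left 0) continuous_const) hlt] with r hr h2 h3
      simp only [hf]
      rw [indicator_of_mem]
      exact ⟨h2 s le_rfl, (mem_ball_iff ρ hr s).2 h3⟩
    · rw [indicator_of_notMem (show s ∉ coordBall b α w ρ 1 from not_lt.2 hgt.le)]
      refine tendsto_const_nhds.congr' ?_
      filter_upwards [hpos, h.eventually_rescaled_mem_of_isOpen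
        (isOpen_lt continuous_const (ρ.continuous_d_left 0)) hgt] with r hr h3
      simp only [hf]
      rw [indicator_of_notMem]
      intro hsW
      have h4 := (mem_ball_iff ρ hr s).1 hsW.2
      exact absurd h4 (not_lt.2 (le_of_lt h3))

end IsGraphParam

end GradedBasis

/-! ### Hausdorff dimension of sets carrying a regular measure -/

section Ahlfors

open scoped NNReal

variable {X : Type*} [MetricSpace X] [MeasurableSpace X] [BorelSpace X] {S : Set X} {μ : Measure X}
  {D : ℕ} {c : ℝ≥0∞}

/-- Mass distribution principle: `μ` is at most `c` times the Hausdorff measure of exponent `D`,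
which therefore does not vanish on `S`. -/
theorem natCast_le_dimH_of_measure_ball (hc0 : c ≠ 0) (hc : c ≠ ⊤) (hS : μ Sᶜ = 0)
    (hne : S.Nonempty)
    (hμ : ∀ y ∈ S, ∀ r : ℝ, 0 < r → μ (Metric.ball y r) = ENNReal.ofReal (r ^ D) * c) :
    (D : ℝ≥0∞) ≤ dimH S := by
  -- A set meeting `S` at `y` lies in every ball about `y` of radius above its diameter; let the
  -- radius decrease to the diameter.
  have hdiam : ∀ T : Set X, Metric.ediam T ≤ 1 → μ T ≤ Metric.ediam T ^ D * c := by
    intro T hT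
    rcases (T ∩ S).eq_empty_or_nonempty with h0 | ⟨y, hyT, hyS⟩
    · have hsub : T ⊆ Sᶜ := fun z hz hzS => h0.subset ⟨hz, hzS⟩
      simp [measure_mono_null hsub hS]
    have hfin : Metric.ediam T ≠ ⊤ := ne_top_of_le_ne_top ENNReal.one_ne_top hT
    set δ := (Metric.ediam T).toReal with hδ
    have hle : ∀ r : ℝ, δ < r → μ T ≤ ENNReal.ofReal (r ^ D) * c := by
      intro r hr
      have hr0 : 0 < r := ENNReal.toReal_nonneg.trans_lt hr
      rw [← hμ y hyS r hr0]
      refine measure_mono fun z hz => ?_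
      have h1 : edist z y ≤ Metric.ediam T := Metric.edist_le_ediam_of_mem hz hyT
      rw [Metric.mem_ball, dist_edist]
      exact (ENNReal.toReal_mono hfin h1).trans_lt hr
    have hlim : Tendsto (fun r : ℝ => ENNReal.ofReal (r ^ D) * c) (𝓝[>] δ)
        (𝓝 (ENNReal.ofReal (δ ^ D) * c)) := by
      have h1 : Continuous fun r : ℝ => ENNReal.ofReal (r ^ D) :=
        ENNReal.continuous_ofReal.comp (by fun_prop)
      exact ENNReal.Tendsto.mul_const ((h1.tendsto δ).mono_left nhdsWithin_le_nhds) (Or.inr hc)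
    have h2 := ge_of_tendsto hlim (eventually_mem_nhdsWithin.mono fun r hr => hle r hr)
    rwa [ENNReal.ofReal_pow ENNReal.toReal_nonneg, ENNReal.ofReal_toReal hfin] at h2
  have hμH : c⁻¹ • μ ≤ μH[((D : ℝ≥0) : ℝ)] := by
    refine Measure.le_hausdorffMeasure _ _ 1 one_pos fun T hT => ?_
    rw [Measure.smul_apply, smul_eq_mul, NNReal.coe_natCast, ENNReal.rpow_natCast]
    calc c⁻¹ * μ T ≤ c⁻¹ * (Metric.ediam T ^ D * c) := by gcongr; exact hdiam T hT
      _ = Metric.ediam T ^ D := by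
        rw [mul_comm, mul_assoc, ENNReal.mul_inv_cancel hc0 hc, mul_one]
  have hpos : μ S ≠ 0 := by
    obtain ⟨y, hy⟩ := hne
    intro h0
    have h1 : μ (Metric.ball y 1) ≤ μ S + μ Sᶜ :=
      (measure_mono (by rw [union_compl_self]; exact subset_univ _)).trans (measure_union_le S Sᶜ)
    rw [hμ y hy 1 one_pos, h0, hS] at h1
    simp [hc0] at h1
  have h3 : μH[((D : ℝ≥0) : ℝ)] S ≠ 0 := by
    intro h0
    have h4 := hμH S
    rw [h0, Measure.smul_apply, smul_eq_mul] at h4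
    simp [hpos, hc] at h4
  exact_mod_cast le_dimH_of_hausdorffMeasure_ne_zero h3

/-- Packing argument: balls of radius `ε / 2` about `ε`-separated points are disjoint and lie in the
ball of radius `R + 1`. Comparing measures bounds their number. -/
theorem coveringNumber_le_of_measure_ball (hc0 : c ≠ 0) (hc : c ≠ ⊤)
    (hμ : ∀ y ∈ S, ∀ r : ℝ, 0 < r → μ (Metric.ball y r) = ENNReal.ofReal (r ^ D) * c)
    {y₀ : X} (hy₀ : y₀ ∈ S) {R : ℝ} (hR : 0 < R) {ε : ℝ≥0} (hε : 0 < ε) (hε1 : ε ≤ 1) :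
    Metric.coveringNumber ε (S ∩ Metric.ball y₀ R) ≤ (⌊(2 * (R + 1) / ε) ^ D⌋₊ : ℕ) := by
  refine (Metric.coveringNumber_le_packingNumber _ _).trans ?_
  refine iSup_le fun C => iSup_le fun hCA => iSup_le fun hC => ?_
  have hε' : (0 : ℝ) < ε := hε
  have hε1' : (ε : ℝ) ≤ 1 := hε1
  have h1 : ∑' z : C, μ (Metric.ball (z : X) (ε / 2)) ≤ μ (⋃ z : C, Metric.ball (z : X) (ε / 2)) := by
    refine tsum_meas_le_meas_iUnion_of_disjoint μ (fun z => measurableSet_ball) fun z z' hzz => ?_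
    refine Metric.ball_disjoint_ball ?_
    have h2 : (ε : ℝ≥0∞) < edist (z : X) z' := hC z.2 z'.2 fun h => hzz (Subtype.ext h)
    rw [edist_nndist, ENNReal.coe_lt_coe] at h2
    have h3 : (ε : ℝ) < dist (z : X) z' := h2
    linarith
  have h2 : μ (⋃ z : C, Metric.ball (z : X) (ε / 2)) ≤ ENNReal.ofReal ((R + 1) ^ D) * c := by
    rw [← hμ y₀ hy₀ (R + 1) (by linarith)]
    refine measure_mono (iUnion_subset fun z => Metric.ball_subset_ball' ?_)
    have := Metric.mem_ball.1 (hCA z.2).2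
    linarith
  have h3 : ∀ z : C, μ (Metric.ball (z : X) (ε / 2)) = ENNReal.ofReal ((ε / 2 : ℝ) ^ D) * c :=
    fun z => hμ z (hCA z.2).1 _ (by positivity)
  simp only [h3, ENNReal.tsum_const] at h1
  have h4 := h1.trans h2
  rw [← mul_assoc, ENNReal.mul_le_mul_iff_left hc0 hc] at h4
  have hpos : (0 : ℝ) < (ε / 2 : ℝ) ^ D := by positivity
  change C.encard ≤ _
  have hcard : ENat.card C = C.encard := rfl
  rw [hcard] at h4
  -- An infinite separated set would give infinite total measure, so only the finite case remains.
  cases hk : C.encard with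
  | top =>
    rw [hk, ENat.toENNReal_top, ENNReal.top_mul (by simpa using hpos)] at h4
    exact absurd h4 (by simp)
  | coe k =>
    rw [hk, ENat.toENNReal_coe, ← ENNReal.ofReal_natCast, ← ENNReal.ofReal_mul (by positivity),
      ENNReal.ofReal_le_ofReal_iff (by positivity)] at h4
    refine Nat.cast_le.2 (Nat.le_floor ?_)
    rw [show (2 * (R + 1) / (ε : ℝ)) = (R + 1) / (ε / 2) by field_simp, div_pow, le_div_iff₀ hpos]
    exact h4

/-- Bounded pieces of `S` suffice, by countable stability. A piece is covered by at most `(2 (R + 1)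
/ ε) ^ D` balls of diameter at most `2 ε`, so the sums stay below `(4 (R + 1)) ^ D` for all scales.
-/
theorem dimH_le_natCast_of_measure_ball (hc0 : c ≠ 0) (hc : c ≠ ⊤) (hne : S.Nonempty)
    (hμ : ∀ y ∈ S, ∀ r : ℝ, 0 < r → μ (Metric.ball y r) = ENNReal.ofReal (r ^ D) * c) :
    dimH S ≤ (D : ℝ≥0∞) := by
  obtain ⟨y₀, hy₀⟩ := hne
  have hSU : S = ⋃ k : ℕ, S ∩ Metric.ball y₀ ((k : ℝ) + 1) := by
    rw [← inter_iUnion]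
    refine (inter_eq_left.2 fun z _ => ?_).symm
    obtain ⟨k, hk⟩ := exists_nat_gt (dist z y₀)
    exact mem_iUnion.2 ⟨k, Metric.mem_ball.2 (by linarith)⟩
  rw [hSU, dimH_iUnion]
  refine iSup_le fun k => ?_
  set R : ℝ := (k : ℝ) + 1 with hRdef
  have hR : 0 < R := by positivity
  let ε : ℕ → ℝ≥0 := fun m => 1 / ((m : ℝ≥0) + 1)
  have hε : ∀ m, 0 < ε m := fun m => by positivity
  have hε1 : ∀ m, ε m ≤ 1 := fun m => by
    simp only [ε]
    exact div_le_one_of_le₀ (by simp) (by positivity)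
  have hcov := fun m => coveringNumber_le_of_measure_ball hc0 hc hμ hy₀ hR (hε m) (hε1 m)
  choose C hCA hCfin hCcov hCcard using fun m => Metric.exists_set_encard_eq_coveringNumber
    (ne_top_of_le_ne_top (ENat.natCast_ne_top _) (hcov m))
  let := fun m => (hCfin m).fintype
  have hεlim : Tendsto (fun m => 2 * (ε m : ℝ≥0∞)) atTop (𝓝 0) := by
    have h1 : Tendsto ε atTop (𝓝 0) := tendsto_one_div_add_atTop_nhds_zero_nat
    have h2 : Tendsto (fun m => (ε m : ℝ≥0∞)) atTop (𝓝 0) := by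
      simpa using ENNReal.tendsto_coe.2 h1
    simpa using ENNReal.Tendsto.const_mul h2 (Or.inr (by simp : (2 : ℝ≥0∞) ≠ ⊤))
  have hdiam : ∀ m (z : C m), Metric.ediam (Metric.closedEBall (z : X) (ε m)) ≤ 2 * (ε m : ℝ≥0∞) :=
    fun m z => Metric.ediam_closedEBall_le
  have hmeas := Measure.hausdorffMeasure_le_liminf_sum ((D : ℝ≥0) : ℝ) (S ∩ Metric.ball y₀ R)
    (fun m => 2 * (ε m : ℝ≥0∞)) hεlim (fun m (z : C m) => Metric.closedEBall (z : X) (ε m))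
    (Eventually.of_forall hdiam) (Eventually.of_forall fun m => by
      have := Metric.isCover_iff_subset_iUnion_closedEBall.1 (hCcov m)
      rwa [biUnion_eq_iUnion] at this)
  have hbound : ∀ m, ∑ z : C m, Metric.ediam (Metric.closedEBall (z : X) (ε m)) ^
      ((D : ℝ≥0) : ℝ) ≤ ENNReal.ofReal ((4 * (R + 1)) ^ D) := by
    intro m
    have hεm : (0 : ℝ) < ε m := hε m
    have hcard : (Fintype.card (C m) : ℝ) ≤ (2 * (R + 1) / ε m) ^ D := by
      have h1 := hcov m
      rw [← hCcard m, ← Set.coe_fintypeCard, Nat.cast_le] at h1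
      exact (Nat.le_floor_iff (by positivity)).1 h1
    calc ∑ z : C m, Metric.ediam (Metric.closedEBall (z : X) (ε m)) ^ ((D : ℝ≥0) : ℝ)
        ≤ ∑ _z : C m, ENNReal.ofReal ((2 * ε m) ^ D) := by
          refine Finset.sum_le_sum fun z _ => ?_
          rw [NNReal.coe_natCast, ENNReal.rpow_natCast, ENNReal.ofReal_pow (by positivity)]
          gcongr
          refine (hdiam m z).trans_eq ?_
          rw [ENNReal.ofReal_mul zero_le_two, ENNReal.ofReal_coe_nnreal]
          simp
      _ = ENNReal.ofReal (Fintype.card (C m) * (2 * ε m) ^ D) := by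
          rw [Finset.sum_const, nsmul_eq_mul, ENNReal.ofReal_mul (by positivity),
            ENNReal.ofReal_natCast, Finset.card_univ]
      _ ≤ ENNReal.ofReal ((4 * (R + 1)) ^ D) := by
          refine ENNReal.ofReal_le_ofReal ?_
          calc (Fintype.card (C m) : ℝ) * (2 * ε m) ^ D
              ≤ (2 * (R + 1) / ε m) ^ D * (2 * ε m) ^ D := by gcongr
            _ = (4 * (R + 1)) ^ D := by
                rw [← mul_pow]
                congr 1
                field_simp
                ring
  have hfin : μH[((D : ℝ≥0) : ℝ)] (S ∩ Metric.ball y₀ R) ≠ ⊤ := by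
    have h1 := hmeas.trans (liminf_le_liminf (Eventually.of_forall hbound))
    rw [liminf_const] at h1
    exact ne_top_of_le_ne_top ENNReal.ofReal_ne_top h1
  exact_mod_cast dimH_le_of_hausdorffMeasure_ne_top hfin

end Ahlfors

/-! ### Hausdorff dimension of the blow-up subspace -/

namespace GradedBasis.IsAdaptedFrame

variable {G : Type*} [NormedAddCommGroup G] [InnerProductSpace ℝ G] [FiniteDimensional ℝ G]
  [StratifiedGroup G] {n p : ℕ} {b : GradedBasis G n}
  {α : Set.powersetCard (Fin n) p} {w : Fin p → G} (ρ : HomogeneousDistance G)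

/-- The group operation of the blow-up subspace, in coordinates. -/
noncomputable def coordMul (b : GradedBasis G n) (α : Set.powersetCard (Fin n) p) (w : Fin p → G)
    (q : EuclideanSpace ℝ (Fin p) × EuclideanSpace ℝ (Fin p)) : EuclideanSpace ℝ (Fin p) :=
  b.coords α (linParam (b.topPart α w) q.1 * linParam (b.topPart α w) q.2)

theorem contDiff_coordMul : ContDiff ℝ 1 (coordMul b α w) := by
  refine (b.coords α).contDiff.comp (contDiff_mul.comp (ContDiff.prodMk ?_ ?_))
  · exact (linParam _).contDiff.comp contDiff_fst
  · exact (linParam _).contDiff.comp contDiff_snd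

-- The product stays in the subspace, which is a subgroup, and is thus determined by its coordinates
-- of index in `α`.
omit [FiniteDimensional ℝ G] in
theorem linParam_coordMul (h : b.IsAdaptedFrame α w)
    (q : EuclideanSpace ℝ (Fin p) × EuclideanSpace ℝ (Fin p)) :
    linParam (b.topPart α w) (coordMul b α w q) =
      linParam (b.topPart α w) q.1 * linParam (b.topPart α w) q.2 := by
  obtain ⟨P, -, hP⟩ := exists_normal_subgroup fun x y hy => h.lie_mem_span x hy
  rw [← range_linParam] at hP
  have hmem : ∀ s, linParam (b.topPart α w) s ∈ P := fun s => by
    rw [← SetLike.mem_coe, hP]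
    exact mem_range_self s
  have h1 : linParam (b.topPart α w) q.1 * linParam (b.topPart α w) q.2 ∈ (P : Set G) :=
    P.mul_mem (hmem q.1) (hmem q.2)
  rw [hP] at h1
  obtain ⟨s, hs⟩ := h1
  rw [coordMul, ← hs, h.coords_linParam]

omit [FiniteDimensional ℝ G] in
theorem coordMul_zero (h : b.IsAdaptedFrame α w) (s : EuclideanSpace ℝ (Fin p)) :
    coordMul b α w (0, s) = s := by
  rw [coordMul, map_zero, zero_mul_eq, h.coords_linParam]

omit [FiniteDimensional ℝ G] in
theorem coordMul_neg_coordMul (h : b.IsAdaptedFrame α w) (a s : EuclideanSpace ℝ (Fin p)) :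
    coordMul b α w (-a, coordMul b α w (a, s)) = s := by
  rw [coordMul, h.linParam_coordMul, map_neg, ← inv_eq_neg, inv_mul_cancel_left, h.coords_linParam]

theorem coordMul_stretch (r : ℝ) (a s : EuclideanSpace ℝ (Fin p)) :
    coordMul b α w (b.stretch α r a, b.stretch α r s) = b.stretch α r (coordMul b α w (a, s)) := by
  rw [coordMul, ← dilation_linParam, ← dilation_linParam, ← dilation_mul b, b.coords_dilation]
  rfl

/-- The differential of the left translations of the blow-up subspace, in coordinates. -/
noncomputable def coordMulDeriv (b : GradedBasis G n) (α : Set.powersetCard (Fin n) p) (w : Fin p → G)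
    (q : EuclideanSpace ℝ (Fin p) × EuclideanSpace ℝ (Fin p)) :
    EuclideanSpace ℝ (Fin p) →L[ℝ] EuclideanSpace ℝ (Fin p) :=
  (fderiv ℝ (coordMul b α w) q).comp (ContinuousLinearMap.inr ℝ _ _)

theorem hasFDerivAt_coordMul (a s : EuclideanSpace ℝ (Fin p)) :
    HasFDerivAt (fun s => coordMul b α w (a, s)) (coordMulDeriv b α w (a, s)) s :=
  ((contDiff_coordMul (b := b) (α := α) (w := w)).differentiable one_ne_zero
    (a, s)).hasFDerivAt.comp s (hasFDerivAt_prodMk_right a s)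

theorem continuous_det_coordMulDeriv : Continuous fun q => (coordMulDeriv b α w q).det :=
  ContinuousLinearMap.continuous_det.comp
    (((contDiff_coordMul (b := b) (α := α) (w := w)).continuous_fderiv one_ne_zero).clm_comp
      continuous_const)

/-- Dilations are automorphisms, so the two differentials are conjugate by the chain rule. -/
theorem det_coordMulDeriv_stretch {r : ℝ} (hr : r ≠ 0) (a s : EuclideanSpace ℝ (Fin p)) :
    (coordMulDeriv b α w (b.stretch α r a, b.stretch α r s)).det =
      (coordMulDeriv b α w (a, s)).det := by
  have h1 : HasFDerivAt (fun s => coordMul b α w (b.stretch α r a, b.stretch α r s))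
      ((coordMulDeriv b α w (b.stretch α r a, b.stretch α r s)).comp (b.stretch α r)) s :=
    (hasFDerivAt_coordMul (b.stretch α r a) (b.stretch α r s)).comp s (b.stretch α r).hasFDerivAt
  have h2 : HasFDerivAt (fun s => coordMul b α w (b.stretch α r a, b.stretch α r s))
      ((b.stretch α r).comp (coordMulDeriv b α w (a, s))) s := by
    simp only [coordMul_stretch]
    exact (b.stretch α r).hasFDerivAt.comp s (hasFDerivAt_coordMul a s)
  have h3 := congrArg ContinuousLinearMap.det (h1.unique h2)
  have hdet : (b.stretch α r).det ≠ 0 := by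
    rw [det_stretch]
    exact pow_ne_zero _ hr
  simp only [ContinuousLinearMap.det, ContinuousLinearMap.toLinearMap_comp, LinearMap.det_comp]
    at h3 hdet ⊢
  rw [mul_comm] at h3
  exact mul_left_cancel₀ hdet h3

omit [FiniteDimensional ℝ G] in
theorem tendsto_stretch_zero (s : EuclideanSpace ℝ (Fin p)) :
    Tendsto (fun r : ℝ => b.stretch α r s) (𝓝[>] 0) (𝓝 0) := by
  have h1 : Tendsto (fun r : ℝ => r ^ 1 * ‖s‖) (𝓝[>] 0) (𝓝 0) := by
    have : Continuous fun r : ℝ => r ^ 1 * ‖s‖ := by fun_prop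
    simpa using (this.tendsto 0).mono_left nhdsWithin_le_nhds
  refine squeeze_zero_norm' ?_ h1
  filter_upwards [Ioo_mem_nhdsGT (zero_lt_one (α := ℝ))] with r hr
  exact b.norm_stretch_le α (fun i => b.deg_pos _) hr.1.le hr.2.le s

/-- The determinant is constant along dilation orbits, which shrink to the origin, where the
translation by `0` is the identity. Lebesgue measure in these coordinates is therefore left
invariant. -/
theorem det_coordMulDeriv (h : b.IsAdaptedFrame α w)
    (q : EuclideanSpace ℝ (Fin p) × EuclideanSpace ℝ (Fin p)) :
    (coordMulDeriv b α w q).det = 1 := by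
  have h0 : coordMulDeriv b α w (0, 0) = ContinuousLinearMap.id ℝ _ := by
    refine (hasFDerivAt_coordMul 0 0).unique ?_
    simp only [h.coordMul_zero]
    exact hasFDerivAt_id 0
  have h1 : Tendsto (fun r : ℝ => (coordMulDeriv b α w (b.stretch α r q.1, b.stretch α r q.2)).det)
      (𝓝[>] 0) (𝓝 (coordMulDeriv b α w (0, 0)).det) :=
    (continuous_det_coordMulDeriv.tendsto (0, 0)).comp
      ((tendsto_stretch_zero q.1).prodMk_nhds (tendsto_stretch_zero q.2))
  have h2 : Tendsto (fun r : ℝ => (coordMulDeriv b α w (b.stretch α r q.1, b.stretch α r q.2)).det)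
      (𝓝[>] 0) (𝓝 (coordMulDeriv b α w q).det) :=
    tendsto_const_nhds.congr' (eventually_mem_nhdsWithin.mono fun r hr =>
      (det_coordMulDeriv_stretch (ne_of_gt hr) q.1 q.2).symm)
  rw [tendsto_nhds_unique h2 h1, h0]
  simp [ContinuousLinearMap.det]

/-- The ball is the left translate of a ball about the origin, and translations preserve volume. -/
theorem volume_preimage_ball (h : b.IsAdaptedFrame α w) (a : EuclideanSpace ℝ (Fin p)) {r : ℝ}
    (hr : 0 < r) :
    volume (linParam (b.topPart α w) ⁻¹' ρ.ball (linParam (b.topPart α w) a) r) =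
      ENNReal.ofReal (r ^ b.maxDim p) * volume (coordBall b α w ρ 1) := by
  have himage : linParam (b.topPart α w) ⁻¹' ρ.ball (linParam (b.topPart α w) a) r =
      (fun s => coordMul b α w (a, s)) '' coordBall b α w ρ r := by
    ext s
    constructor
    · intro hs
      refine ⟨coordMul b α w (-a, s), ?_, ?_⟩
      · change ρ.d 0 _ < r
        rw [h.linParam_coordMul, map_neg, ← inv_eq_neg, ← ρ.d_eq]
        exact hs
      · simpa using h.coordMul_neg_coordMul (-a) s
    · rintro ⟨s, hs, rfl⟩
      change ρ.d _ _ < r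
      rw [h.linParam_coordMul, ρ.d_eq, inv_mul_cancel_left]
      exact hs
  rw [himage, ← h.volume_coordBall ρ hr]
  have hinj : InjOn (fun s => coordMul b α w (a, s)) (coordBall b α w ρ r) :=
    (Function.LeftInverse.injective (g := fun s => coordMul b α w (-a, s))
      (h.coordMul_neg_coordMul a)).injOn
  rw [← lintegral_abs_det_fderiv_eq_addHaar_image volume (isOpen_coordBall ρ r).measurableSet
    (fun s _ => (hasFDerivAt_coordMul a s).hasFDerivWithinAt) hinj]
  simp [h.det_coordMulDeriv]

theorem dimH_span (h : b.IsAdaptedFrame α w) :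
    ρ.dimH (Submodule.span ℝ (range (b.topPart α w)) : Set G) = (b.maxDim p : ℝ≥0∞) := by
  let _m : MeasurableSpace G := borel G
  have _hB : BorelSpace G := ⟨rfl⟩
  -- The metric topology of `d` and the norm topology have the same Borel sets; this allows the
  -- metric lemmas to be applied.
  have hB : @BorelSpace G ρ.metricSpace.toUniformSpace.toTopologicalSpace _m := by
    rw [ρ.toTopologicalSpace_eq b]
    exact ⟨rfl⟩
  let L := linParam (b.topPart α w)
  have hL : Continuous L := L.continuous
  rw [← range_linParam]
  have hcl : IsClosed (range L) := by
    rw [range_linParam]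
    exact Submodule.closed_of_finiteDimensional _
  have hS : (volume.map L) (range L)ᶜ = 0 := by
    rw [Measure.map_apply hL.measurable hcl.measurableSet.compl]
    simp
  have hμ : ∀ y ∈ range L, ∀ r : ℝ, 0 < r →
      (volume.map L) (@Metric.ball G ρ.metricSpace.toPseudoMetricSpace y r) =
        ENNReal.ofReal (r ^ b.maxDim p) * volume (coordBall b α w ρ 1) := by
    rintro _ ⟨a, rfl⟩ r hr
    have hball : @Metric.ball G ρ.metricSpace.toPseudoMetricSpace (L a) r = ρ.ball (L a) r := by
      ext z
      change ρ.d z (L a) < r ↔ ρ.d (L a) z < r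
      rw [ρ.symm]
    rw [hball, Measure.map_apply hL.measurable (ρ.isOpen_ball _ _).measurableSet]
    exact h.volume_preimage_ball ρ a hr
  have hc0 := (volume_coordBall_pos (b := b) (α := α) (w := w) ρ).ne'
  have hc := h.volume_coordBall_ne_top ρ
  exact le_antisymm
    (@dimH_le_natCast_of_measure_ball G ρ.metricSpace _m hB _ _ _ _ hc0 hc (range_nonempty L) hμ)
    (@natCast_le_dimH_of_measure_ball G ρ.metricSpace _m hB _ _ _ _ hc0 hc hS (range_nonempty L) hμ)

end GradedBasis.IsAdaptedFrame

/-! ### The blow-up theorem -/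

theorem IsC1Param.isTangentFrame {G : Type*} [NormedAddCommGroup G] [InnerProductSpace ℝ G]
    [FiniteDimensional ℝ G] {p : ℕ} {M : Set G} {A : Set (EuclideanSpace ℝ (Fin p))}
    {Φ : EuclideanSpace ℝ (Fin p) → G} (h : IsC1Param M A Φ) (hp : 1 ≤ p)
    {t₀ : EuclideanSpace ℝ (Fin p)} (ht₀ : t₀ ∈ A) :
    IsTangentFrame M (Φ t₀) fun i => fderiv ℝ Φ t₀ (EuclideanSpace.single i 1) := by
  have hT := LinearMap.ker_eq_bot.2 (h.immersion t₀ ht₀)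
  rw [IsTangentFrame, h.tangentCone_eq hp ht₀]
  generalize fderiv ℝ Φ t₀ = T at hT ⊢
  have he : (fun i => T (EuclideanSpace.single i 1)) =
      T.toLinearMap ∘ (EuclideanSpace.basisFun (Fin p) ℝ).toBasis := by
    ext i
    simp
  rw [he]
  refine ⟨(EuclideanSpace.basisFun (Fin p) ℝ).toBasis.linearIndependent.map' T.toLinearMap hT, ?_⟩
  rw [range_comp, Submodule.span_image, Module.Basis.span_eq, Submodule.map_top]
  rfl

theorem IsTangentFrame.exists_matrix {G : Type*} [NormedAddCommGroup G] [NormedSpace ℝ G] {p : ℕ}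
    {M : Set G} {x : G} {v v' : Fin p → G} (hv : IsTangentFrame M x v)
    (hv' : IsTangentFrame M x v') :
    ∃ A : Matrix (Fin p) (Fin p) ℝ, A.det ≠ 0 ∧ v = fun i => ∑ j, A i j • v' j := by
  refine exists_matrix_of_span_eq hv.1 fun i => ?_
  rw [← SetLike.mem_coe, hv'.2, ← hv.2]
  exact Submodule.subset_span (mem_range_self i)

/-! ### Passage from arbitrary tangent frames to a graph parametrization -/

namespace GradedBasis

variable {G : Type*} [NormedAddCommGroup G] [InnerProductSpace ℝ G] [FiniteDimensional ℝ G]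
  [StratifiedGroup G] {n p : ℕ} (b : GradedBasis G n) {M : Set G} {x : G}

include b in
omit [FiniteDimensional ℝ G] in
theorem translatedPVector_sum_smul (A : Matrix (Fin p) (Fin p) ℝ) (v : Fin p → G) :
    translatedPVector x (fun i => ∑ j, A i j • v j) = A.det • translatedPVector x v := by
  rw [translatedPVector, translatedPVector, ← b.ιMulti_sum_smul]
  simp only [map_sum, map_smul]

theorem exists_multiDeg_eq_of_isTransversal (hne : ∃ v : Fin p → G, IsTangentFrame M x v)
    (htr : IsTransversal b p M x) :
    ∃ (v : Fin p → G) (α : Set.powersetCard (Fin n) p), IsTangentFrame M x v ∧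
      b.coord (translatedPVector x v) α ≠ 0 ∧ b.multiDeg α = b.maxDim p := by
  obtain ⟨v, hv⟩ := hne
  have hne0 : translatedPVector x v ≠ 0 := ιMulti_ne_zero_of_linearIndependent
    (hv.1.map' (fderiv ℝ (fun y : G => x⁻¹ * y) x : G →ₗ[ℝ] G)
      (LinearMap.ker_eq_bot.2 (injective_fderiv_inv_mul x)))
  obtain ⟨α, hα⟩ : ∃ α, b.coord (translatedPVector x v) α ≠ 0 := by
    by_contra! hall
    exact hne0 (b.ext_coord fun α => by rw [hall α]; simp [coord])
  -- The supremum defining the degree is attained because the set is nonempty and bounded; otherwise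
  -- `sSup` on the naturals would return the default value `0`.
  have hmem := Nat.sSup_mem (s := {N | ∃ (v : Fin p → G) (α : Set.powersetCard (Fin n) p),
    IsTangentFrame M x v ∧ b.coord (translatedPVector x v) α ≠ 0 ∧ N = b.multiDeg α})
    ⟨_, v, α, hv, hα, rfl⟩ ⟨b.maxDim p, by
      rintro _ ⟨-, β, -, -, rfl⟩
      exact b.multiDeg_le_maxDim β⟩
  obtain ⟨v', β, hv', hβ, hN⟩ := hmem
  exact ⟨v', β, hv', hβ, hN.symm.trans htr⟩

omit [FiniteDimensional ℝ G] in
theorem IsAdaptedFrame.linearIndependent {b : GradedBasis G n} {α : Set.powersetCard (Fin n) p}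
    {w : Fin p → G} (h : b.IsAdaptedFrame α w) : LinearIndependent ℝ w := by
  rw [Fintype.linearIndependent_iff]
  intro c hc i
  have := h.coords_linParam_frame (WithLp.toLp 2 c)
  rw [linParam_apply, hc, map_zero] at this
  exact (congrArg (fun s : EuclideanSpace ℝ (Fin p) => s i) this).symm

theorem exists_isGraphParam_of_isTransversal (hp : 1 ≤ p) (hM : IsC1Submanifold p M) (hx : x ∈ M)
    (htr : IsTransversal b p M x) : ∃ α w B Ψ, b.IsGraphParam (p := p) M x α w B Ψ := by
  obtain ⟨A, Φ, h, t₀, ht₀, rfl⟩ := hM x hx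
  obtain ⟨v, α, hv, hα, hdeg⟩ :=
    b.exists_multiDeg_eq_of_isTransversal ⟨_, h.isTangentFrame hp ht₀⟩ htr
  obtain ⟨C, hC, hw⟩ := b.exists_isAdaptedFrame hdeg hα
  let T := fderiv ℝ (fun y : G => (Φ t₀)⁻¹ * y) (Φ t₀)
  have hli : LinearIndependent ℝ (T ∘ v) := hv.1.map' (T : G →ₗ[ℝ] G)
    (LinearMap.ker_eq_bot.2 (injective_fderiv_inv_mul _))
  -- The adapted frame lies in the translated tangent space and has the same number of independent
  -- vectors.
  have hspan : Submodule.span ℝ (range fun i => ∑ j, C i j • T (v j)) =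
      Submodule.span ℝ (range (T ∘ v)) := by
    refine Submodule.eq_of_le_of_finrank_eq ?_ ?_
    · rw [Submodule.span_le]
      rintro _ ⟨i, rfl⟩
      exact Submodule.sum_mem _ fun j _ => Submodule.smul_mem _ _
        (Submodule.subset_span (mem_range_self j))
    · rw [finrank_span_eq_card hli, finrank_span_eq_card hw.linearIndependent]
  refine ⟨α, _, b.exists_isGraphParam h ht₀ hw ?_⟩
  rw [hspan, range_comp T v]
  have h1 := Submodule.span_image (T : G →ₗ[ℝ] G) (s := range v)
  have h2 : range (fun t => T (fderiv ℝ Φ t₀ t)) = T '' range (fderiv ℝ Φ t₀) := range_comp T _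
  rw [h2, ← h.tangentCone_eq hp ht₀, ← hv.2]
  exact (congrArg (fun S : Submodule ℝ G => (S : Set G)) h1).symm

namespace IsGraphParam

variable {b} {α : Set.powersetCard (Fin n) p} {w : Fin p → G}
  {B : Set (EuclideanSpace ℝ (Fin p))} {Ψ : EuclideanSpace ℝ (Fin p) → G}
  (h : b.IsGraphParam M x α w B Ψ)

include h

theorem isTangentFrame (hp : 1 ≤ p) :
    IsTangentFrame M x fun i => fderiv ℝ Ψ 0 (EuclideanSpace.single i 1) := by
  simpa only [h.map_zero] using h.param.isTangentFrame hp h.zero_mem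

theorem fderiv_inv_mul_fderiv (i : Fin p) :
    fderiv ℝ (fun y : G => x⁻¹ * y) x (fderiv ℝ Ψ 0 (EuclideanSpace.single i 1)) = w i := by
  have h1 : HasFDerivAt (fun y : G => x⁻¹ * y) (fderiv ℝ (fun y : G => x⁻¹ * y) x) (Ψ 0) := by
    rw [h.map_zero]
    exact ((contDiff_mul_left (m := 1) x⁻¹).differentiable one_ne_zero x).hasFDerivAt
  have h2 := (h1.comp 0 (h.param.hasFDerivAt h.zero_mem)).unique h.hasFDerivAt
  have h3 := congrArg (fun L => L (EuclideanSpace.single i 1)) h2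
  rwa [linParam_single] at h3

/-- Any tangent frame is an invertible recombination of the coordinate frame of the graph. The
Riemannian norm scales by the absolute value of its determinant, the `p`-vector by the determinant
itself. -/
theorem exists_smul_eq (hp : 1 ≤ p) (gt : SmoothRiemannianMetric G) {v : Fin p → G}
    (hv : IsTangentFrame M x v) :
    ∃ c : ℝ, c ≠ 0 ∧ riemNorm gt x v = |c| * surfaceDensity gt Ψ 0 ∧
      b.proj (b.maxDim p) (translatedPVector x v) =
        c • exteriorPower.ιMulti ℝ p (b.topPart α w) := by
  obtain ⟨A, hA, rfl⟩ := hv.exists_matrix (h.isTangentFrame hp)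
  refine ⟨A.det, hA, ?_, ?_⟩
  · rw [riemNorm_sum_smul, surfaceDensity, h.map_zero]
  · rw [b.translatedPVector_sum_smul, proj_smul, translatedPVector]
    simp only [h.fderiv_inv_mul_fderiv]
    rw [h.adapted.proj_ιMulti]

theorem blowUpSubspace_eq (hp : 1 ≤ p) (gt : SmoothRiemannianMetric G) {v : Fin p → G}
    (hv : IsTangentFrame M x v) :
    blowUpSubspace b x v = Submodule.span ℝ (range (b.topPart α w)) := by
  obtain ⟨c, hc, -, hproj⟩ := h.exists_smul_eq hp gt hv
  rw [blowUpSubspace, hproj, assocSubspace_smul hc,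
    assocSubspace_ιMulti h.adapted.linearIndependent_topPart]

/-- The scalar `c` changes neither the associated subspace nor the normalized tangent vector's norm,
and the norm of `τ` occurs both as area factor above and below the fraction line. -/
theorem metricFactor_div_eq [MeasurableSpace G] [BorelSpace G] (ρ : HomogeneousDistance G)
    (hp : 1 ≤ p) (gt : SmoothRiemannianMetric G) {v : Fin p → G} (hv : IsTangentFrame M x v) :
    metricFactor ρ (b.proj (b.maxDim p) (translatedPVector x v)) /
        ENNReal.ofReal (b.pnorm (b.proj (b.maxDim p) (unitTangent gt x v))) =
      ENNReal.ofReal (surfaceDensity gt Ψ 0) * volume (IsAdaptedFrame.coordBall b α w ρ 1) := by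
  obtain ⟨c, hc, hnorm, hproj⟩ := h.exists_smul_eq hp gt hv
  set τ := exteriorPower.ιMulti ℝ p (b.topPart α w) with hτ
  have hτ0 : 0 < b.pnorm τ :=
    b.pnorm_pos (ιMulti_ne_zero_of_linearIndependent h.adapted.linearIndependent_topPart)
  have hJ : 0 < surfaceDensity gt Ψ 0 := by
    rw [surfaceDensity, h.map_zero]
    exact riemNorm_pos gt x (h.isTangentFrame hp).1
  have hden : b.pnorm (b.proj (b.maxDim p) (unitTangent gt x v)) =
      b.pnorm τ / surfaceDensity gt Ψ 0 := by
    rw [unitTangent, proj_smul, hproj, pnorm_smul, pnorm_smul, hnorm, abs_inv, abs_mul, abs_abs,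
      abs_of_pos hJ]
    have := abs_pos.2 hc
    field_simp
  have hnum : metricFactor ρ (c • τ) = metricFactor ρ τ := by
    rw [metricFactor, metricFactor, assocSubspace_smul hc]
  have h0 : ENNReal.ofReal (b.pnorm τ) ≠ 0 := by simpa using hτ0
  have h1 : ENNReal.ofReal (surfaceDensity gt Ψ 0) ≠ 0 := by simpa using hJ
  rw [hproj, hnum, hden, hτ, h.adapted.metricFactor_eq ρ, ← hτ, ENNReal.ofReal_div_of_pos hJ,
    ENNReal.div_eq_inv_mul, ENNReal.inv_div (Or.inl ENNReal.ofReal_ne_top) (Or.inl h1),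
    ENNReal.div_eq_inv_mul, mul_comm (ENNReal.ofReal (b.pnorm τ))⁻¹, mul_assoc,
    ← mul_assoc _ (ENNReal.ofReal (b.pnorm τ)), ENNReal.inv_mul_cancel h0 ENNReal.ofReal_ne_top,
    one_mul]

end IsGraphParam

end GradedBasis

theorem theorem1p1 {G : Type*} [NormedAddCommGroup G] [InnerProductSpace ℝ G]
    [FiniteDimensional ℝ G] [MeasurableSpace G] [BorelSpace G] [StratifiedGroup G]
    {n p : ℕ} (hp : 1 ≤ p) (b : GradedBasis G n) (ρ : HomogeneousDistance G)
    (gt : SmoothRiemannianMetric G) (M : Set G) (hM : IsC1Submanifold p M)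
    (x : G) (hx : x ∈ M) (htr : IsTransversal b p M x) :
    -- tangent `p`-vectors exist, and all the claims hold for each of them
    (∃ v : Fin p → G, IsTangentFrame M x v) ∧
    ∀ v : Fin p → G, IsTangentFrame M x v →
      -- `Π` is a `p`-dimensional normal homogeneous subgroup of Hausdorff dimension `D(p)`
      (∃ P : Subgroup G, P.Normal ∧ (P : Set G) = blowUpSubspace b x v) ∧
      Module.finrank ℝ (blowUpSubspace b x v) = p ∧
      (∀ r : ℝ, 0 < r → ∀ w ∈ blowUpSubspace b x v, dilation r w ∈ blowUpSubspace b x v) ∧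
      ρ.dimH (blowUpSubspace b x v : Set G) = (b.maxDim p : ℝ≥0∞) ∧
      -- it has the form `Z ⊕ H_{ℓ+1} ⊕ ⋯ ⊕ H_ι` with `Z ⊆ H_ℓ`
      (∃ (l : ℕ) (Z : Submodule ℝ G), Z ≤ StratifiedGroup.layer l ∧ Z ≠ ⊥ ∧
        blowUpSubspace b x v = Z ⊔ ⨆ j > l, StratifiedGroup.layer (G := G) j) ∧
      -- convergence of the blow-ups, on every compact neighbourhood of the origin
      (∀ F : Set G, IsCompact F → F ∈ 𝓝 (0 : G) →
        (∀ᶠ r in 𝓝[>] (0 : ℝ), IsCompact (F ∩ blowUp M x r)) ∧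
        (∀ ε : ℝ, 0 < ε → ∀ᶠ r in 𝓝[>] (0 : ℝ),
          (∀ z ∈ F ∩ blowUp M x r, ∃ w ∈ F ∩ (blowUpSubspace b x v : Set G), ρ.d z w < ε) ∧
          (∀ w ∈ F ∩ (blowUpSubspace b x v : Set G), ∃ z ∈ blowUp M x r, ρ.d w z < ε)) ∧
        (F ∩ (blowUpSubspace b x v : Set G) ⊆
            closure (interior F ∩ (blowUpSubspace b x v : Set G)) →
          Tendsto (fun r : ℝ => ρ.hausdorffEDist (F ∩ blowUp M x r)
            (F ∩ (blowUpSubspace b x v : Set G))) (𝓝[>] 0) (𝓝 0))) ∧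
      -- the density of the Riemannian surface measure
      Tendsto (fun r : ℝ => surfaceMeasure gt p M (M ∩ ρ.ball x r) /
          ENNReal.ofReal (r ^ b.maxDim p)) (𝓝[>] 0)
        (𝓝 (metricFactor ρ (b.proj (b.maxDim p) (translatedPVector x v)) /
          ENNReal.ofReal (b.pnorm (b.proj (b.maxDim p) (unitTangent gt x v))))) := by
  obtain ⟨α, w, B, Ψ, h⟩ := b.exists_isGraphParam_of_isTransversal hp hM hx htr
  refine ⟨⟨_, h.isTangentFrame hp⟩, fun v hv => ?_⟩
  -- After this rewriting neither the subspace nor the limit depends on the chosen tangent frame.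
  rw [h.metricFactor_div_eq ρ hp gt hv, h.blowUpSubspace_eq hp gt hv]
  refine ⟨exists_normal_subgroup fun _ _ hy => h.adapted.lie_mem_span _ hy, h.adapted.finrank_span,
    fun r _ y hy => ?_, h.adapted.dimH_span ρ, h.adapted.exists_layer_decomposition hp,
    fun F hF _ => ⟨h.eventually_isCompact hF, fun ε hε =>
      (h.eventually_exists_mem_span ρ hF hε).and (h.eventually_exists_mem_blowUp ρ hF hε),
      h.tendsto_hausdorffEDist ρ hF⟩, h.tendsto_surfaceMeasure_ball ρ gt⟩
  rw [← SetLike.mem_coe, ← GradedBasis.range_linParam] at hy ⊢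
  obtain ⟨s, rfl⟩ := hy
  exact ⟨_, (GradedBasis.IsAdaptedFrame.dilation_linParam r s).symm⟩
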